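/- Let $d\ge 1$ be an integer, $1<p<\infty$, $1<\alpha<2$, and let $\Omega\subsetneq\mathbb{R}^d$ be open. Write $a^{\langle k\rangle}=|a|^k\operatorname{sgn}a$, $B(x,y)=\Gamma(x)\Gamma(y)/\Gamma(x+y)$ (with $\Gamma$ extended meromorphically to negative non-integer arguments), and $$\kappa_{d,p,\alpha}=-\frac{\pi^{\frac{d-1}{2}}\Gamma\left(\frac{1+\alpha}{2}\right)}{\Gamma\left(\frac{\alpha+d}{2}\right)}\left(B\left(\tfrac{\alpha-1}{p}+1,-\alpha\right)+B\left(\alpha-\tfrac{\alpha-1}{p},-\alpha\right)+\tfrac1\alpha\right).$$ Let $C_c(\Omega)$ be the class of continuous functions $u:\mathbb{R}^d\to\mathbb{R}$ with compact support contained in $\Omega$, and for $u\in C_c(\Omega)$ let $$\mathcal{E}_p[u]=\frac12\int_\Omega\int_\Omega\frac{(u(x)-u(y))\left(u(x)^{\langle p-1\rangle}-u(y)^{\langle p-1\rangle}\right)}{|x-y|^{d+\alpha}}\,dx\,dy\in[0,\infty].$$ For $x\in\Omega$ and a unit vector $\omega$ let $d_{\omega,\Omega}(x)=\min\{|t|:x+t\omega\notin\Omega\}$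 (with $\min\emptyset=\infty$ and $\infty^{-\alpha}=0$), and let $$m_\alpha(x)^\alpha=\frac{\int_{\mathbb{S}^{d-1}}|\omega_d|^\alpha\,d\omega}{\int_{\mathbb{S}^{d-1}}d_{\omega,\Omega}(x)^{-\alpha}\,d\omega},$$ where $d\omega$ is the surface measure on the unit sphere $\mathbb{S}^{d-1}$ (the counting measure on $\{-1,1\}$ if $d=1$), and $m_\alpha(x)=\infty$, $m_\alpha(x)^{-\alpha}=0$ if the denominator vanishes. Then $\kappa_{d,p,\alpha}\ge 0$, and for every $u\in C_c(\Omega)$, $$\mathcal{E}_p[u]\ge\kappa_{d,p,\alpha}\int_\Omega\frac{|u(x)|^p}{m_\alpha(x)^\alpha}\,dx.$$ In particular, if $\Omega$ is convex, then for every $u\in C_c(\Omega)$, $$\mathcal{E}_p[u]\ge\kappa_{d,p,\alpha}\int_\Omega\frac{|u(x)|^p}{\operatorname{dist}(x,\partial\Omega)^\alpha}\,dx,$$ and, for every nonempty convex open $\Omega\subsetneq\mathbb{R}^d$, the constant $\kappa_{d,p,\alpha}$ in the last inequality is optimal: if $c\in\mathbb{R}$ is such that $\mathcal{E}_p[u]\ge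 c\int_\Omega|u(x)|^p\operatorname{dist}(x,\partial\Omega)^{-\alpha}\,dx$ for all $u\in C_c(\Omega)$, then $c\le\kappa_{d,p,\alpha}$. -/

import Mathlib

open MeasureTheory Set
open scoped ENNReal

noncomputable section

namespace SobolevBregman

/-- The signed power `a^⟨k⟩ = |a|^k sgn a`. -/
def signedPow (a k : ℝ) : ℝ := |a| ^ k * Real.sign a

/-- The Euler beta function `B(x, y) = Γ(x) Γ(y) / Γ(x + y)`, where `Γ` is the meromorphic
extension of the Euler gamma function (so negative non-integer arguments are allowed). -/
def eulerBeta (x y : ℝ) : ℝ := Real.Gamma x * Real.Gamma y / Real.Gamma (x + y)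

/-- The constant `κ_{d,p,α}`. -/
def kappa (d : ℕ) (p α : ℝ) : ℝ :=
  -(Real.pi ^ (((d : ℝ) - 1) / 2) * Real.Gamma ((1 + α) / 2) / Real.Gamma ((α + d) / 2)) *
    (eulerBeta ((α - 1) / p + 1) (-α) + eulerBeta (α - (α - 1) / p) (-α) + 1 / α)

/-- `u ∈ C_c(Ω)`: `u : ℝ^d → ℝ` is continuous with compact support contained in `Ω`. -/
def IsCc {d : ℕ} (Ω : Set (EuclideanSpace ℝ (Fin d))) (u : EuclideanSpace ℝ (Fin d) → ℝ) : Prop :=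
  Continuous u ∧ HasCompactSupport u ∧ tsupport u ⊆ Ω

/-- The Sobolev-Bregman form of `u` on `Ω`. The integrand is nonnegative for `p > 1`, and the form
takes values in `[0, ∞]`. -/
def form {d : ℕ} (p α : ℝ) (Ω : Set (EuclideanSpace ℝ (Fin d)))
    (u : EuclideanSpace ℝ (Fin d) → ℝ) : ℝ≥0∞ :=
  (1 / 2) * ∫⁻ x in Ω, ∫⁻ y in Ω,
    ENNReal.ofReal ((u x - u y) * (signedPow (u x) (p - 1) - signedPow (u y) (p - 1)) /
      ‖x - y‖ ^ ((d : ℝ) + α))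

/-- The distance `d_{ω,Ω}(x) = min {|t| : x + tω ∉ Ω}` from `x` to the complement of `Ω` along the
line in direction `ω`; it is `∞` if the whole line lies in `Ω`. -/
def dirDist {d : ℕ} (Ω : Set (EuclideanSpace ℝ (Fin d))) (ω x : EuclideanSpace ℝ (Fin d)) : ℝ≥0∞ :=
  ⨅ (t : ℝ) (_ : x + t • ω ∉ Ω), ENNReal.ofReal |t|

/-- The averaged distance `m_α(x)`, with
`m_α(x)^α = (∫_{S^{d-1}} |ω_d|^α dω) / (∫_{S^{d-1}} d_{ω,Ω}(x)^{-α} dω)`, where `dω` is the surface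
measure of the unit sphere (the counting measure on `{-1, 1}` if `d = 1`) and `ω_d` is the last
coordinate of `ω`. It is `∞` if the denominator is `0`. -/
def avgDist {d : ℕ} [NeZero d] (α : ℝ) (Ω : Set (EuclideanSpace ℝ (Fin d)))
    (x : EuclideanSpace ℝ (Fin d)) : ℝ≥0∞ :=
  ((∫⁻ ω : Metric.sphere (0 : EuclideanSpace ℝ (Fin d)) 1,
      ENNReal.ofReal (|ω.1 ⟨d - 1, Nat.sub_one_lt (NeZero.ne d)⟩| ^ α)
        ∂(volume : Measure (EuclideanSpace ℝ (Fin d))).toSphere) /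
    (∫⁻ ω : Metric.sphere (0 : EuclideanSpace ℝ (Fin d)) 1, (dirDist Ω ω.1 x) ^ (-α)
        ∂(volume : Measure (EuclideanSpace ℝ (Fin d))).toSphere)) ^ (1 / α)

/-- The weighted integral `∫_Ω |u(x)|^p m_α(x)^{-α} dx`. -/
def avgHardyIntegral {d : ℕ} [NeZero d] (p α : ℝ) (Ω : Set (EuclideanSpace ℝ (Fin d)))
    (u : EuclideanSpace ℝ (Fin d) → ℝ) : ℝ≥0∞ :=
  ∫⁻ x in Ω, ENNReal.ofReal (|u x| ^ p) / (avgDist α Ω x) ^ α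

/-- The weighted integral `∫_Ω |u(x)|^p dist(x, ∂Ω)^{-α} dx`. -/
def hardyIntegral {d : ℕ} (p α : ℝ) (Ω : Set (EuclideanSpace ℝ (Fin d)))
    (u : EuclideanSpace ℝ (Fin d) → ℝ) : ℝ≥0∞ :=
  ∫⁻ x in Ω, ENNReal.ofReal (|u x| ^ p / (Metric.infDist x (frontier Ω)) ^ α)

end SobolevBregman

end

/-! In polar coordinates the form is an average over directions `ω` of one-dimensional forms, so the
first inequality follows from a Hardy inequality along each direction, with weight `dirDist Ω ω x ^
(-α)` and constant `kappaOne p α` (`kappaOne_mul_lintegral_dirDist_le`). The factor `sphereMoment d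
α / 2` between `kappaOne` and `kappa` is half of the numerator in the definition of `m_α ^ α`.

On a line the argument is a ground state substitution with w = dist ^ ((α - 1) / p). Young's
inequality bounds the Bregman integrand below by a linear expression in |u(x)|^p and |u(y)|^p whose
coefficients depend on w(y)/w(x) (`abs_rpow_add_le_mul_signedPow_sub`), so it remains to see that w
is a supersolution. On a half-line, with x at 1 and the endpoint at 0, folding (1, ∞) onto (0, 1) by
t ↦ 1/t turns the defect exactly into `hardyKernel`, whose integral is `kappaOne`. In general the
distance is at most the distance to the nearest missing point, and comparison with the half-line
goes in the right direction (`lintegral_youngWeight_add_le`). The supersolution integral converges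
at the diagonal only as a principal value. Hence only pairs whose distances have ratio outside [ρ,
1/ρ] are kept, a condition symmetric in the pair; all terms to be cancelled are then finite, and ρ →
1 at the end.

For convex Ω a supporting hyperplane at a nearest boundary point, with unit normal n, gives d_ω(x) ≤
dist(x, ∂Ω) / |⟨n, ω⟩|, and averaging over ω yields m_α(x) ≤ dist(x, ∂Ω).

For optimality, let h be the height over a supporting hyperplane at a boundary point touched by an
interior ball. The test functions are h ^ ((α - 1) / p) φ ^ (2 / p), with a cutoff φ that varies
slowly in log h and in the tangential variables at scale h. Rescaling around x by h(x) freezes φ,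
and the form is at most κ ∫ φ²/h plus an error times ∫ 1/h over the support (`form_testFun_le`). The
two integrals are comparable uniformly (`lintegral_cutoff_comparison`) and the error tends to zero
(`tendsto_totalError`), while the Hardy integral is at least ∫ φ²/h. -/

open MeasureTheory Set
open scoped ENNReal

noncomputable section

namespace SobolevBregman

/-! ### Polar coordinates and moments of the unit sphere. -/

section

/-- Polar coordinates for the lower Lebesgue integral. -/
theorem lintegral_eq_lintegral_sphere_lintegral_Ioi {E : Type*} [NormedAddCommGroup E]
    [NormedSpace ℝ E] [MeasurableSpace E] [BorelSpace E] [FiniteDimensional ℝ E] [Nontrivial E]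
    (μ : Measure E) [μ.IsAddHaarMeasure] {f : E → ℝ≥0∞} (hf : Measurable f) :
    ∫⁻ x, f x ∂μ = ∫⁻ ω : Metric.sphere (0 : E) 1,
      (∫⁻ r in Ioi (0 : ℝ), ENNReal.ofReal (r ^ (Module.finrank ℝ E - 1)) * f (r • (ω : E)))
        ∂μ.toSphere := by
  have hmp := μ.measurePreserving_homeomorphUnitSphereProd.symm
    (homeomorphUnitSphereProd E).toMeasurableEquiv
  have h1 : ∫⁻ x, f x ∂μ = ∫⁻ x : ({(0 : E)}ᶜ : Set E), f x ∂(μ.comap (↑)) := by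
    rw [lintegral_subtype_comap (measurableSet_singleton (0 : E)).compl f,
      restrict_compl_singleton]
  have h2 := hmp.lintegral_comp (hf.comp measurable_subtype_coe)
  simp only [Function.comp_def] at h2
  rw [h1, ← h2, lintegral_prod]
  · refine lintegral_congr fun ω => ?_
    rw [Measure.volumeIoiPow, lintegral_withDensity_eq_lintegral_mul _ (by fun_prop)]
    · rw [← lintegral_subtype_comap measurableSet_Ioi]
      refine lintegral_congr fun r => ?_
      simp [Homeomorph.toMeasurableEquiv]
    · exact (hf.comp measurable_subtype_coe).comp (hmp.measurable.comp measurable_prodMk_left)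
  · exact ((hf.comp measurable_subtype_coe).comp hmp.measurable).aemeasurable

theorem integral_gaussian_eq : ∫ x : ℝ, Real.exp (-x ^ 2) = Real.pi ^ ((1 : ℝ) / 2) := by
  have := integral_gaussian 1
  simpa [Real.sqrt_eq_rpow] using this

theorem integral_Ioi_rpow_mul_exp_neg_sq {s : ℝ} (hs : -1 < s) :
    ∫ x in Ioi (0 : ℝ), x ^ s * Real.exp (-x ^ 2) = Real.Gamma ((s + 1) / 2) / 2 := by
  have := integral_rpow_mul_exp_neg_rpow (p := 2) (q := s) two_pos hs
  simp only [Real.rpow_two] at this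
  rw [this]; ring

theorem integrableOn_Ioi_rpow_mul_exp_neg_sq {s : ℝ} (hs : -1 < s) :
    IntegrableOn (fun x : ℝ => x ^ s * Real.exp (-x ^ 2)) (Ioi 0) := by
  have := integrableOn_rpow_mul_exp_neg_mul_sq (b := 1) one_pos hs
  simpa using this

theorem integral_abs_rpow_mul_exp_neg_sq {s : ℝ} (hs : -1 < s) :
    ∫ x : ℝ, |x| ^ s * Real.exp (-x ^ 2) = Real.Gamma ((s + 1) / 2) := by
  have := integral_comp_abs (f := fun x : ℝ => x ^ s * Real.exp (-x ^ 2))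
  simp only [sq_abs] at this
  rw [this, integral_Ioi_rpow_mul_exp_neg_sq hs]; ring

theorem integrable_abs_rpow_mul_exp_neg_sq {s : ℝ} (hs : -1 < s) :
    Integrable (fun x : ℝ => |x| ^ s * Real.exp (-x ^ 2)) :=
  Integrable.of_integral_ne_zero (by
    rw [integral_abs_rpow_mul_exp_neg_sq hs]
    exact (Real.Gamma_pos_of_pos (by linarith)).ne')

theorem exists_orthonormalBasis_apply_eq {ι : Type*} [Fintype ι] [DecidableEq ι] (i : ι)
    {n : EuclideanSpace ℝ ι} (hn : ‖n‖ = 1) :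
    ∃ b : OrthonormalBasis ι ℝ (EuclideanSpace ℝ ι), b i = n := by
  obtain ⟨b, hb⟩ := Orthonormal.exists_orthonormalBasis_extension_of_card_eq
    (𝕜 := ℝ) (E := EuclideanSpace ℝ ι) (ι := ι) (by simp) (v := fun _ => n) (s := {i}) (by
      rw [orthonormal_iff_ite]
      rintro ⟨j, rfl⟩ ⟨k, rfl⟩
      simp [hn])
  exact ⟨b, hb i rfl⟩

/-- In an orthonormal basis containing `n` the integrand is a product of one-variable functions: one
absolute Gaussian moment and `d - 1` Gaussian integrals. -/
theorem lintegral_abs_inner_rpow_mul_exp_neg_norm_sq {d : ℕ} [NeZero d] {s : ℝ} (hs : -1 < s)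
    {n : EuclideanSpace ℝ (Fin d)} (hn : ‖n‖ = 1) :
    ∫⁻ x : EuclideanSpace ℝ (Fin d), ENNReal.ofReal (|inner ℝ n x| ^ s * Real.exp (-‖x‖ ^ 2)) =
      ENNReal.ofReal (Real.Gamma ((s + 1) / 2) * Real.pi ^ (((d : ℝ) - 1) / 2)) := by
  obtain ⟨b, hb⟩ := exists_orthonormalBasis_apply_eq (0 : Fin d) hn
  have hmp := (PiLp.volume_preserving_ofLp (Fin d)).comp b.measurePreserving_repr
  let g : Fin d → ℝ → ℝ := fun i x =>
    if i = 0 then |x| ^ s * Real.exp (-x ^ 2) else Real.exp (-x ^ 2)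
  have hg : ∀ i x, 0 ≤ g i x := fun i x => by
    simp only [g]; split_ifs <;> positivity
  have hgi : ∀ i, Integrable (g i) := fun i => by
    by_cases hi : i = 0
    · simpa [g, hi] using! integrable_abs_rpow_mul_exp_neg_sq hs
    · simpa [g, hi] using! integrable_exp_neg_mul_sq (b := 1) one_pos
  have hgint : ∀ i, ∫ x, g i x = if i = 0 then Real.Gamma ((s + 1) / 2)
      else Real.pi ^ ((1 : ℝ) / 2) := fun i => by
    by_cases hi : i = 0
    · simpa [g, hi] using! integral_abs_rpow_mul_exp_neg_sq hs
    · simpa [g, hi] using! integral_gaussian_eq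
  have key : ∀ x : EuclideanSpace ℝ (Fin d),
      |inner ℝ n x| ^ s * Real.exp (-‖x‖ ^ 2) = ∏ i, g i ((b.repr x).ofLp i) := by
    intro x
    have h1 : ‖x‖ ^ 2 = ∑ i, ((b.repr x).ofLp i) ^ 2 := by
      rw [← b.repr.norm_map x, EuclideanSpace.norm_sq_eq]; simp
    have h2 : ∀ i, g i ((b.repr x).ofLp i) =
        (if i = 0 then |(b.repr x).ofLp 0| ^ s else 1) * Real.exp (-((b.repr x).ofLp i) ^ 2) := by
      intro i; simp only [g]; split_ifs with h
      · rw [h]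
      · simp
    rw [Finset.prod_congr rfl fun i _ => h2 i, Finset.prod_mul_distrib, ← Real.exp_sum,
      Finset.prod_ite_eq' Finset.univ (0 : Fin d), h1, Finset.sum_neg_distrib]
    simp [OrthonormalBasis.repr_apply_apply, hb]
  have hgm : Measurable fun y : Fin d → ℝ => ENNReal.ofReal (∏ i, g i (y i)) := by
    refine ENNReal.measurable_ofReal.comp (Finset.measurable_prod _ fun i _ => ?_)
    have : Measurable (g i) := by
      simp only [g]; split_ifs <;> fun_prop
    exact this.comp (measurable_pi_apply i)
  simp_rw [key]
  have h3 := hmp.lintegral_comp hgm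
  simp only [Function.comp_def] at h3
  rw [h3, volume_pi, ← ofReal_integral_eq_lintegral_ofReal 
    (Integrable.fintype_prod (μ := fun _ : Fin d => (volume : Measure ℝ)) hgi)
    (Filter.Eventually.of_forall fun y => Finset.prod_nonneg fun i _ => hg i _),
    integral_fintype_prod_eq_prod]
  simp_rw [hgint]
  rw [Finset.prod_ite]
  congr 1
  have hc : (Finset.univ.filter fun x : Fin d => ¬ x = 0).card = d - 1 := by
    rw [Finset.filter_not, Finset.filter_eq']; simp [Finset.card_sdiff]
  rw [Finset.prod_const, Finset.prod_const, hc, Finset.filter_eq']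
  have hd : ((d - 1 : ℕ) : ℝ) = d - 1 := by
    rw [Nat.cast_sub (Nat.one_le_iff_ne_zero.2 (NeZero.ne d))]; simp
  rw [← Real.rpow_mul_natCast Real.pi_pos.le, hd]
  simp
  left; congr 1; ring

/-- The total mass of `|⟨n, ω⟩|^s` on the unit sphere. -/
def sphereMoment (d : ℕ) (s : ℝ) : ℝ :=
  2 * Real.pi ^ (((d : ℝ) - 1) / 2) * Real.Gamma ((1 + s) / 2) / Real.Gamma ((s + d) / 2)

theorem sphereMoment_pos {d : ℕ} {s : ℝ} (hs : 0 < s) : 0 < sphereMoment d s := by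
  have h1 : 0 < Real.Gamma ((1 + s) / 2) := Real.Gamma_pos_of_pos (by positivity)
  have h2 : 0 < Real.Gamma ((s + d) / 2) := Real.Gamma_pos_of_pos (by positivity)
  unfold sphereMoment
  positivity

/-- Gaussian trick: in polar coordinates the preceding integral is this sphere moment times a radial
Gamma integral. Independence of `n` is what allows supporting hyperplanes with arbitrary normals
later. -/
theorem lintegral_sphere_abs_inner_rpow {d : ℕ} [NeZero d] {s : ℝ} (hs : 0 < s)
    {n : EuclideanSpace ℝ (Fin d)} (hn : ‖n‖ = 1) :
    ∫⁻ ω : Metric.sphere (0 : EuclideanSpace ℝ (Fin d)) 1,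
      ENNReal.ofReal (|inner ℝ n (ω : EuclideanSpace ℝ (Fin d))| ^ s)
        ∂(volume : Measure (EuclideanSpace ℝ (Fin d))).toSphere =
      ENNReal.ofReal (sphereMoment d s) := by
  have hd : 1 ≤ d := Nat.one_le_iff_ne_zero.2 (NeZero.ne d)
  have h0 := lintegral_abs_inner_rpow_mul_exp_neg_norm_sq (s := s) (by linarith) hn
  rw [lintegral_eq_lintegral_sphere_lintegral_Ioi volume (by fun_prop)] at h0
  have hG : 0 < Real.Gamma ((s + d) / 2) := Real.Gamma_pos_of_pos (by positivity)
  have h1 : ∀ ω : Metric.sphere (0 : EuclideanSpace ℝ (Fin d)) 1,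
      ∫⁻ r in Ioi (0 : ℝ), ENNReal.ofReal
        (r ^ (Module.finrank ℝ (EuclideanSpace ℝ (Fin d)) - 1)) *
        ENNReal.ofReal (|inner ℝ n (r • (ω : EuclideanSpace ℝ (Fin d)))| ^ s *
          Real.exp (-‖r • (ω : EuclideanSpace ℝ (Fin d))‖ ^ 2)) =
      ENNReal.ofReal (|inner ℝ n (ω : EuclideanSpace ℝ (Fin d))| ^ s) *
        ENNReal.ofReal (Real.Gamma ((s + d) / 2) / 2) := by
    intro ω
    have hω : ‖(ω : EuclideanSpace ℝ (Fin d))‖ = 1 := by simp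
    have h2 := integral_Ioi_rpow_mul_exp_neg_sq (s := s + d - 1) (by
      have : (1 : ℝ) ≤ d := by exact_mod_cast hd
      linarith)
    have h3 := integrableOn_Ioi_rpow_mul_exp_neg_sq (s := s + d - 1) (by
      have : (1 : ℝ) ≤ d := by exact_mod_cast hd
      linarith)
    rw [sub_add_cancel] at h2
    rw [← h2, ofReal_integral_eq_lintegral_ofReal h3
      (ae_restrict_of_forall_mem measurableSet_Ioi fun x hx => by
        have : 0 ≤ x := le_of_lt hx
        positivity), ← lintegral_const_mul _ (by fun_prop)]
    refine setLIntegral_congr_fun measurableSet_Ioi fun r hr => ?_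
    have hr : 0 < r := hr
    rw [← ENNReal.ofReal_mul (by positivity), ← ENNReal.ofReal_mul (by positivity)]
    congr 1
    rw [inner_smul_right, abs_mul, abs_of_pos hr, norm_smul, hω, Real.norm_of_nonneg hr.le, mul_one,
      Real.mul_rpow hr.le (abs_nonneg _), finrank_euclideanSpace_fin, ← Real.rpow_natCast,
      Nat.cast_sub hd, Nat.cast_one, add_sub_assoc, Real.rpow_add hr]
    ring
  simp_rw [h1] at h0
  rw [lintegral_mul_const _ (by fun_prop)] at h0
  have h4 : ENNReal.ofReal (Real.Gamma ((s + d) / 2) / 2) ≠ 0 := by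
    simp only [ne_eq, ENNReal.ofReal_eq_zero, not_le]; positivity
  rw [ENNReal.eq_div_iff h4 ENNReal.ofReal_ne_top |>.2 ((mul_comm _ _).trans h0),
    ← ENNReal.ofReal_div_of_pos (by positivity)]
  congr 1
  rw [sphereMoment, add_comm 1 s]
  field_simp

end

/-! ### The one-dimensional constant as a convergent integral. -/

section

open Filter Topology

/-- The density `(1 - t^b) (1 - t^b') (1 - t)^(-1-α)`, whose integral over `(0, 1)` is the sharp
one-dimensional constant. -/
def hardyKernel (α b b' t : ℝ) : ℝ := (1 - t ^ b) * (1 - t ^ b') * (1 - t) ^ (-1 - α)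

theorem lintegral_Ioo_rpow_mul_one_sub_rpow {u v : ℝ} (hu : 0 < u) (hv : 0 < v) :
    ∫⁻ t in Ioo (0 : ℝ) 1, ENNReal.ofReal (t ^ (u - 1) * (1 - t) ^ (v - 1)) =
      ENNReal.ofReal (eulerBeta u v) := by
  have h := ProbabilityTheory.lintegral_betaPDF_eq_one hu hv
  have hb : 0 < eulerBeta u v := ProbabilityTheory.beta_pos hu hv
  have hb' : ProbabilityTheory.beta u v = eulerBeta u v := rfl
  rw [ProbabilityTheory.lintegral_betaPDF, hb'] at h
  simp_rw [mul_assoc] at h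
  rw [← mul_one (ENNReal.ofReal (eulerBeta u v)), ← h, ← lintegral_const_mul _ (by fun_prop)]
  refine lintegral_congr fun t => ?_
  rw [← ENNReal.ofReal_mul hb.le]
  congr 1
  field_simp

theorem integrableOn_Ioo_rpow_mul_one_sub_rpow {u v : ℝ} (hu : 0 < u) (hv : 0 < v) :
    IntegrableOn (fun t : ℝ => t ^ (u - 1) * (1 - t) ^ (v - 1)) (Ioo 0 1) := by
  refine ⟨by fun_prop, ?_⟩
  rw [hasFiniteIntegral_iff_ofReal (ae_restrict_of_forall_mem measurableSet_Ioo fun t ht => ?_),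
    lintegral_Ioo_rpow_mul_one_sub_rpow hu hv]
  · exact ENNReal.ofReal_lt_top
  · have := ht.1; have : 0 ≤ 1 - t := by linarith [ht.2]
    positivity

theorem integral_Ioo_rpow_mul_one_sub_rpow {u v : ℝ} (hu : 0 < u) (hv : 0 < v) :
    ∫ t in Ioo (0 : ℝ) 1, t ^ (u - 1) * (1 - t) ^ (v - 1) = eulerBeta u v := by
  have hb : 0 < eulerBeta u v := ProbabilityTheory.beta_pos hu hv
  rw [integral_eq_lintegral_of_nonneg_ae _ (by fun_prop), lintegral_Ioo_rpow_mul_one_sub_rpow hu hv,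
    ENNReal.toReal_ofReal hb.le]
  refine ae_restrict_of_forall_mem measurableSet_Ioo fun t ht => ?_
  have := ht.1; have : 0 ≤ 1 - t := by linarith [ht.2]
  positivity

theorem one_sub_rpow_le {t b : ℝ} (ht : t ∈ Ioo (0 : ℝ) 1) (hb : b ≤ 1) : 1 - t ^ b ≤ 1 - t := by
  have := Real.rpow_le_rpow_of_exponent_ge ht.1 ht.2.le hb
  rw [Real.rpow_one] at this
  linarith

theorem one_sub_rpow_nonneg {t b : ℝ} (ht : t ∈ Ioo (0 : ℝ) 1) (hb : 0 ≤ b) : 0 ≤ 1 - t ^ b := by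
  have := Real.rpow_le_one ht.1.le ht.2.le hb
  linarith

theorem hardyKernel_nonneg {α b b' t : ℝ} (ht : t ∈ Ioo (0 : ℝ) 1) (hb : 0 ≤ b) (hb' : 0 ≤ b') :
    0 ≤ hardyKernel α b b' t :=
  mul_nonneg (mul_nonneg (one_sub_rpow_nonneg ht hb) (one_sub_rpow_nonneg ht hb'))
    (Real.rpow_nonneg (by linarith [ht.2]) _)

/-- Both factors `1 - t ^ b` and `1 - t ^ b'` are at most `1 - t`, so the singularity at `1` is
integrable when `α < 2`. -/
theorem hardyKernel_le {α b b' t : ℝ} (ht : t ∈ Ioo (0 : ℝ) 1) (hb' : 0 ≤ b')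
    (hb1 : b ≤ 1) (hb1' : b' ≤ 1) : hardyKernel α b b' t ≤ (1 - t) ^ (1 - α) := by
  have h1 : 0 < 1 - t := by linarith [ht.2]
  calc hardyKernel α b b' t ≤ (1 - t) * (1 - t) * (1 - t) ^ (-1 - α) := by
        exact mul_le_mul_of_nonneg_right (mul_le_mul (one_sub_rpow_le ht hb1)
          (one_sub_rpow_le ht hb1') (one_sub_rpow_nonneg ht hb') h1.le) (Real.rpow_nonneg h1.le _)
    _ = (1 - t) ^ (1 - α) := by
        rw [← pow_two, ← Real.rpow_natCast, ← Real.rpow_add h1]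
        congr 1; push_cast; ring

theorem measurable_hardyKernel (α b b' : ℝ) : Measurable (hardyKernel α b b') := by
  unfold hardyKernel; fun_prop

theorem integrableOn_hardyKernel {α b b' : ℝ} (hα₂ : α < 2) (hb : 0 ≤ b)
    (hb' : 0 ≤ b') (hb1 : b ≤ 1) (hb1' : b' ≤ 1) :
    IntegrableOn (hardyKernel α b b') (Ioo 0 1) := by
  have h := integrableOn_Ioo_rpow_mul_one_sub_rpow (u := 1) (v := 2 - α) one_pos (by linarith)
  refine Integrable.mono' h (measurable_hardyKernel α b b').aestronglyMeasurable
    (ae_restrict_of_forall_mem measurableSet_Ioo fun t ht => ?_)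
  rw [Real.norm_of_nonneg (hardyKernel_nonneg ht hb hb')]
  have := hardyKernel_le (α := α) ht hb' hb1 hb1'
  simp only [sub_self, Real.rpow_zero, one_mul]
  rwa [show 2 - α - 1 = 1 - α by ring]

/-- The functional equation of Γ, applied to `b`, twice starting from `-α`, and to `b + 1 - α =
-b'`, moves the second argument up to `2 - α > 0`, where the beta function is a convergent integral.
-/
theorem eulerBeta_add_one_neg {α b b' : ℝ} (hα₂ : α < 2) (hb : 0 < b) (hb' : 0 < b')
    (hbb : b + b' = α - 1) :
    eulerBeta (b + 1) (-α) = -(b * b' / (α * (α - 1))) * eulerBeta b (2 - α) := by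
  have h1 : Real.Gamma (b + 1) = b * Real.Gamma b := Real.Gamma_add_one hb.ne'
  have h2 : Real.Gamma (2 - α) = (1 - α) * (-α * Real.Gamma (-α)) := by
    rw [← Real.Gamma_add_one (by linarith), show -α + 1 = 1 - α by ring,
      ← Real.Gamma_add_one (by linarith), show 1 - α + 1 = 2 - α by ring]
  have h3 : Real.Gamma (b + (2 - α)) = -b' * Real.Gamma (b + 1 + -α) := by
    rw [show b + 1 + -α = -b' by linarith, ← Real.Gamma_add_one (by linarith)]
    congr 1; linarith
  unfold eulerBeta
  rw [h1, h2, h3]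
  have h4 : Real.Gamma (b + 1 + -α) ≠ 0 := by
    intro h
    rw [h, mul_zero] at h3
    exact (Real.Gamma_pos_of_pos (by linarith)).ne' h3
  have : α ≠ 0 := by linarith
  have : α - 1 ≠ 0 := by linarith
  field_simp
  ring

/-- Up to the exact derivative of `G`, the kernel is a combination `H` of two beta densities; this
is two integrations by parts in one step. The limit `1` of `G` at `0` produces the summand `1 / α`.
-/
theorem integral_hardyKernel {α b b' : ℝ} (hα₁ : 1 < α) (hα₂ : α < 2) (hb : 0 < b) (hb' : 0 < b')
    (hbb : b + b' = α - 1) :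
    ∫ t in Ioo (0 : ℝ) 1, hardyKernel α b b' t =
      -(eulerBeta (b + 1) (-α) + eulerBeta (b' + 1) (-α) + 1 / α) := by
  have hα0 : α ≠ 0 := by linarith
  have hα1 : α - 1 ≠ 0 := by linarith
  set g : ℝ → ℝ := fun t => (1 - t ^ b) * (1 - t ^ b') with hg
  -- This is `t * g' t`. The factor `t` keeps the boundary term bounded at `0`, where `g'` itself
  -- blows up.
  set g₁ : ℝ → ℝ := fun t => b * (t ^ b * (t ^ b' - 1)) + b' * (t ^ b' * (t ^ b - 1)) with hg₁
  set G : ℝ → ℝ := fun t => g t * (1 - t) ^ (-α) - 1 / (α - 1) * (g₁ t * (1 - t) ^ (1 - α)) with hG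
  set H : ℝ → ℝ := fun t => t ^ (b - 1) * (1 - t) ^ ((2 - α) - 1) +
    t ^ (b' - 1) * (1 - t) ^ ((2 - α) - 1) with hH
  have hHint : IntegrableOn H (Ioo 0 1) :=
    (integrableOn_Ioo_rpow_mul_one_sub_rpow hb (by linarith)).add
      (integrableOn_Ioo_rpow_mul_one_sub_rpow hb' (by linarith))
  have hHval : ∫ t in Ioo (0 : ℝ) 1, H t = eulerBeta b (2 - α) + eulerBeta b' (2 - α) := by
    rw [hH, integral_add (integrableOn_Ioo_rpow_mul_one_sub_rpow hb (by linarith))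
      (integrableOn_Ioo_rpow_mul_one_sub_rpow hb' (by linarith)),
      integral_Ioo_rpow_mul_one_sub_rpow hb (by linarith),
      integral_Ioo_rpow_mul_one_sub_rpow hb' (by linarith)]
  have hFint := integrableOn_hardyKernel (α := α) (b := b) (b' := b') hα₂ hb.le hb'.le
    (by linarith) (by linarith)
  set f' : ℝ → ℝ := fun t => α * hardyKernel α b b' t - b * b' / (α - 1) * H t with hf'
  have hf'int : IntegrableOn f' (Ioo 0 1) := (hFint.const_mul α).sub (hHint.const_mul _)
  have hderiv : ∀ t ∈ Ioo (0 : ℝ) 1, HasDerivAt G (f' t) t := by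
    intro t ht
    have ht0 : 0 < t := ht.1
    have ht1 : 0 < 1 - t := by linarith [ht.2]
    have hp : ∀ c : ℝ, HasDerivAt (fun t : ℝ => t ^ c) (c * t ^ (c - 1)) t := fun c =>
      Real.hasDerivAt_rpow_const (Or.inl ht0.ne')
    have hq : ∀ c : ℝ, HasDerivAt (fun t : ℝ => (1 - t) ^ c) (-1 * c * (1 - t) ^ (c - 1)) t :=
      fun c => ((hasDerivAt_id t).const_sub 1).rpow_const (Or.inl ht1.ne')
    have h1 : HasDerivAt g (-(b * t ^ (b - 1)) * (1 - t ^ b') +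
        (1 - t ^ b) * -(b' * t ^ (b' - 1))) t :=
      ((hp b).const_sub 1).mul ((hp b').const_sub 1)
    have h2 := ((((hp b).mul ((hp b').sub_const 1)).const_mul b).add
      (((hp b').mul ((hp b).sub_const 1)).const_mul b'))
    have h3 := (h1.mul (hq (-α))).sub (((h2.mul (hq (1 - α)))).const_mul (1 / (α - 1)))
    refine h3.congr_deriv ?_
    have e1 : t ^ (b - 1) = t ^ b / t := by rw [Real.rpow_sub_one ht0.ne']
    have e2 : t ^ (b' - 1) = t ^ b' / t := by rw [Real.rpow_sub_one ht0.ne']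
    have e3 : (1 - t) ^ (-α) = (1 - t) ^ (-1 - α) * (1 - t) := by
      rw [← Real.rpow_add_one ht1.ne']; congr 1; ring
    have e3' : (1 - t) ^ (-α - 1) = (1 - t) ^ (-1 - α) := by congr 1; ring
    have e4 : (1 - t) ^ (1 - α) = (1 - t) ^ (-1 - α) * (1 - t) * (1 - t) := by
      rw [← Real.rpow_add_one ht1.ne', ← Real.rpow_add_one ht1.ne']; congr 1; ring
    have e5 : (1 - t) ^ (2 - α - 1) = (1 - t) ^ (-1 - α) * (1 - t) * (1 - t) := by
      rw [← e4]; congr 1; ring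
    have e6 : (1 - t) ^ (1 - α - 1) = (1 - t) ^ (-1 - α) * (1 - t) := by
      rw [← e3]; congr 1; ring
    simp only [hf', hH, hg, hardyKernel, Pi.add_apply, Pi.mul_apply, e1, e2, e3, e3', e4, e5, e6]
    obtain rfl : α = b + b' + 1 := by linarith
    field_simp
    ring
  have hG0 : Tendsto G (𝓝[>] 0) (𝓝 1) := by
    have hc : ContinuousAt G 0 := by
      have hp : ∀ c : ℝ, 0 < c → ContinuousAt (fun t : ℝ => t ^ c) 0 := fun c hc =>
        Real.continuousAt_rpow_const _ _ (Or.inr hc.le)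
      have hq : ∀ c : ℝ, ContinuousAt (fun t : ℝ => (1 - t) ^ c) 0 := fun c =>
        (continuousAt_const.sub continuousAt_id).rpow_const (Or.inl (by simp))
      have := hp b hb; have := hp b' hb'; have := hq (-α); have := hq (1 - α)
      simp only [hG, hg, hg₁]
      fun_prop
    have : G 0 = 1 := by simp [hG, hg, hg₁, hb.ne', hb'.ne']
    exact this ▸ hc.tendsto.mono_left nhdsWithin_le_nhds
  have hG1 : Tendsto G (𝓝[<] 1) (𝓝 0) := by
    have hlim : Tendsto (fun t : ℝ => 2 * (1 - t) ^ (2 - α)) (𝓝[<] 1) (𝓝 0) := by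
      have hc : ContinuousAt (fun t : ℝ => 2 * (1 - t) ^ (2 - α)) 1 :=
        continuousAt_const.mul ((continuousAt_const.sub continuousAt_id).rpow_const
          (Or.inr (by linarith)))
      have := hc.tendsto.mono_left (nhdsWithin_le_nhds (s := Iio 1))
      simpa [Real.zero_rpow (show 2 - α ≠ 0 by linarith)] using! this
    refine squeeze_zero_norm' ?_ hlim
    filter_upwards [Ioo_mem_nhdsLT (show (0 : ℝ) < 1 by norm_num)] with t ht
    have ht1 : 0 < 1 - t := by linarith [ht.2]
    have a1 := one_sub_rpow_nonneg ht hb.le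
    have a2 := one_sub_rpow_nonneg ht hb'.le
    have a3 := one_sub_rpow_le ht (show b ≤ 1 by linarith)
    have a4 := one_sub_rpow_le ht (show b' ≤ 1 by linarith)
    have p1 := Real.rpow_nonneg ht.1.le b
    have p2 := Real.rpow_nonneg ht.1.le b'
    have h1 : |g t| ≤ (1 - t) ^ (2 : ℝ) := by
      rw [hg, abs_of_nonneg (mul_nonneg a1 a2), Real.rpow_two, pow_two]
      exact mul_le_mul a3 a4 a2 ht1.le
    have h2 : |g₁ t| ≤ (α - 1) * (1 - t) := by
      rw [abs_le]
      have q1 : t ^ b * (1 - t ^ b') ≤ 1 - t := by nlinarith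
      have q2 : t ^ b' * (1 - t ^ b) ≤ 1 - t := by nlinarith
      have q3 : 0 ≤ t ^ b * (1 - t ^ b') := mul_nonneg p1 a2
      have q4 : 0 ≤ t ^ b' * (1 - t ^ b) := mul_nonneg p2 a1
      simp only [hg₁]
      rw [← hbb]
      constructor <;> nlinarith
    have e1 : (1 - t) ^ (2 : ℝ) * (1 - t) ^ (-α) = (1 - t) ^ (2 - α) := by
      rw [← Real.rpow_add ht1]; congr 1
    have e2 : (1 - t) * (1 - t) ^ (1 - α) = (1 - t) ^ (2 - α) := by
      rw [mul_comm, ← Real.rpow_add_one ht1.ne']; congr 1; ring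
    calc ‖G t‖ ≤ |g t * (1 - t) ^ (-α)| + |1 / (α - 1) * (g₁ t * (1 - t) ^ (1 - α))| :=
          abs_sub _ _
      _ = |g t| * (1 - t) ^ (-α) + 1 / (α - 1) * (|g₁ t| * (1 - t) ^ (1 - α)) := by
          rw [abs_mul (g t), abs_mul (1 / (α - 1)), abs_mul (g₁ t),
            abs_of_pos (Real.rpow_pos_of_pos ht1 _),
            abs_of_pos (Real.rpow_pos_of_pos ht1 _),
            abs_of_pos (show 0 < 1 / (α - 1) from one_div_pos.2 (by linarith))]
      _ ≤ (1 - t) ^ (2 : ℝ) * (1 - t) ^ (-α) +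
          1 / (α - 1) * ((α - 1) * (1 - t) * (1 - t) ^ (1 - α)) := by
          have : 0 < 1 / (α - 1) := one_div_pos.2 (by linarith)
          gcongr
      _ = 2 * (1 - t) ^ (2 - α) := by
          rw [e1, mul_assoc (α - 1), e2]; field_simp; ring
  have hint := intervalIntegral.integral_eq_sub_of_hasDerivAt_of_tendsto (zero_lt_one' ℝ) hderiv
    ((intervalIntegrable_iff_integrableOn_Ioo_of_le zero_le_one).2 hf'int) hG0 hG1
  rw [intervalIntegral.integral_of_le zero_le_one, integral_Ioc_eq_integral_Ioo, hf',
    integral_sub (hFint.const_mul α) (hHint.const_mul _), integral_const_mul, integral_const_mul,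
    hHval] at hint
  rw [eulerBeta_add_one_neg hα₂ hb hb' hbb,
    eulerBeta_add_one_neg hα₂ hb' hb (by linarith)]
  have : (∫ t in Ioo (0 : ℝ) 1, hardyKernel α b b' t) =
    (0 - 1 + b * b' / (α - 1) * (eulerBeta b (2 - α) + eulerBeta b' (2 - α))) / α := by
    rw [← hint]; field_simp; ring
  rw [this]
  field_simp
  ring

/-- The sharp constant in dimension one. -/
def kappaOne (p α : ℝ) : ℝ :=
  -(eulerBeta ((α - 1) / p + 1) (-α) + eulerBeta (α - (α - 1) / p) (-α) + 1 / α)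

theorem kappa_eq (d : ℕ) (p α : ℝ) : kappa d p α = kappaOne p α * (sphereMoment d α / 2) := by
  unfold kappa kappaOne sphereMoment; ring

theorem kappaOne_eq_integral {p α : ℝ} (hp : 1 < p) (hα₁ : 1 < α) (hα₂ : α < 2) :
    kappaOne p α =
      ∫ t in Ioo (0 : ℝ) 1, hardyKernel α ((α - 1) / p) (α - 1 - (α - 1) / p) t := by
  have hb : 0 < (α - 1) / p := div_pos (by linarith) (by linarith)
  have hb' : (α - 1) / p < α - 1 := div_lt_self (by linarith) hp
  rw [integral_hardyKernel hα₁ hα₂ hb (by linarith) (by ring), kappaOne]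
  congr 4; ring

theorem kappaOne_nonneg {p α : ℝ} (hp : 1 < p) (hα₁ : 1 < α) (hα₂ : α < 2) :
    0 ≤ kappaOne p α := by
  have hb : 0 < (α - 1) / p := div_pos (by linarith) (by linarith)
  have hb' : (α - 1) / p < α - 1 := div_lt_self (by linarith) hp
  rw [kappaOne_eq_integral hp hα₁ hα₂]
  exact setIntegral_nonneg measurableSet_Ioo fun t ht =>
    hardyKernel_nonneg ht hb.le (by linarith)

theorem kappa_nonneg (d : ℕ) {p α : ℝ} (hp : 1 < p) (hα₁ : 1 < α) (hα₂ : α < 2) :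
    0 ≤ kappa d p α := by
  rw [kappa_eq]
  have := kappaOne_nonneg hp hα₁ hα₂
  have := sphereMoment_pos (d := d) (s := α) (by linarith)
  positivity

theorem ofReal_kappaOne_eq_lintegral {p α : ℝ} (hp : 1 < p) (hα₁ : 1 < α) (hα₂ : α < 2) :
    ENNReal.ofReal (kappaOne p α) = ∫⁻ t in Ioo (0 : ℝ) 1,
      ENNReal.ofReal (hardyKernel α ((α - 1) / p) (α - 1 - (α - 1) / p) t) := by
  have hb : 0 < (α - 1) / p := div_pos (by linarith) (by linarith)
  have hb' : (α - 1) / p < α - 1 := div_lt_self (by linarith) hp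
  rw [kappaOne_eq_integral hp hα₁ hα₂, ofReal_integral_eq_lintegral_ofReal
    (integrableOn_hardyKernel hα₂ hb.le (by linarith) (by linarith) (by linarith))
    (ae_restrict_of_forall_mem measurableSet_Ioo fun t ht =>
      hardyKernel_nonneg ht hb.le (by linarith))]

end

/-! ### The ground state inequality and the supersolution estimate on a line. -/

section

/-- The weight `q^(p-1)/p + (1 - 1/p) q` of Young's inequality. -/
def youngWeight (p q : ℝ) : ℝ := 1 / p * q ^ (p - 1) + (p - 1) / p * q

theorem measurable_youngWeight (p : ℝ) : Measurable (youngWeight p) := by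
  unfold youngWeight; fun_prop

theorem youngWeight_nonneg {p q : ℝ} (hp : 1 < p) (hq : 0 ≤ q) : 0 ≤ youngWeight p q := by
  have := Real.rpow_nonneg hq (p - 1)
  have : 0 < p := by linarith
  have : 0 ≤ p - 1 := by linarith
  unfold youngWeight; positivity

theorem youngWeight_mono {p q q' : ℝ} (hp : 1 < p) (hq : 0 ≤ q) (h : q ≤ q') :
    youngWeight p q ≤ youngWeight p q' := by
  have := Real.rpow_le_rpow hq h (show 0 ≤ p - 1 by linarith)
  have : 0 < p := by linarith
  have : 0 ≤ p - 1 := by linarith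
  unfold youngWeight; gcongr

theorem youngWeight_one {p : ℝ} (hp : 1 < p) : youngWeight p 1 = 1 := by
  have : p ≠ 0 := by linarith
  unfold youngWeight; rw [Real.one_rpow]; field_simp; ring

/-- Young's inequality with exponents `p / (p - 1)` and `p`, after a power of `s / t` has been
shifted between the factors. The shift is chosen so that equality holds at `a = s`, `b = t`, the
values of the ground state. -/
theorem abs_signedPow_mul_le {p : ℝ} (hp : 1 < p) {s t : ℝ} (hs : 0 < s) (ht : 0 < t) (a b : ℝ) :
    signedPow a (p - 1) * b ≤
      1 / p * (|b| ^ p * (s / t) ^ (p - 1)) + (p - 1) / p * (|a| ^ p * (t / s)) := by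
  have hp0 : 0 < p := by linarith
  have hp1 : 0 < p - 1 := by linarith
  have hq : 0 < s / t := by positivity
  have h1 : signedPow a (p - 1) * b ≤ |a| ^ (p - 1) * |b| := by
    have : |signedPow a (p - 1)| ≤ |a| ^ (p - 1) := by
      unfold signedPow
      rw [abs_mul, abs_of_nonneg (by positivity)]
      refine mul_le_of_le_one_right (by positivity) ?_
      rcases lt_trichotomy a 0 with h | h | h <;> simp [h, Real.sign_of_neg, Real.sign_of_pos]
    calc signedPow a (p - 1) * b ≤ |signedPow a (p - 1) * b| := le_abs_self _
      _ ≤ _ := by rw [abs_mul]; gcongr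
  have hconj : (p / (p - 1)).HolderConjugate p := (Real.HolderConjugate.conjExponent hp).symm
  have h2 := Real.young_inequality_of_nonneg
    (a := |a| ^ (p - 1) * (s / t) ^ (-((p - 1) / p))) (b := |b| * (s / t) ^ ((p - 1) / p))
    (by positivity) (by positivity) hconj
  have e1 : |a| ^ (p - 1) * (s / t) ^ (-((p - 1) / p)) * (|b| * (s / t) ^ ((p - 1) / p)) =
      |a| ^ (p - 1) * |b| := by
    rw [Real.rpow_neg hq.le]
    have : (s / t) ^ ((p - 1) / p) ≠ 0 := by positivity
    field_simp
  have e2 : (|a| ^ (p - 1) * (s / t) ^ (-((p - 1) / p))) ^ (p / (p - 1)) =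
      |a| ^ p * (t / s) := by
    rw [Real.mul_rpow (by positivity) (by positivity), ← Real.rpow_mul (abs_nonneg a),
      ← Real.rpow_mul hq.le]
    have e3 : (p - 1) * (p / (p - 1)) = p := by field_simp
    have e4 : -((p - 1) / p) * (p / (p - 1)) = -1 := by field_simp
    rw [e3, e4, Real.rpow_neg_one, inv_div]
  have e3 : (|b| * (s / t) ^ ((p - 1) / p)) ^ p = |b| ^ p * (s / t) ^ (p - 1) := by
    rw [Real.mul_rpow (by positivity) (by positivity), ← Real.rpow_mul hq.le]
    congr 2; field_simp
  rw [e1, e2, e3] at h2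
  refine h1.trans (h2.trans_eq ?_)
  field_simp
  ring

theorem signedPow_mul_self {p : ℝ} (hp : 1 < p) (a : ℝ) : a * signedPow a (p - 1) = |a| ^ p := by
  unfold signedPow
  have h : |a| * |a| ^ (p - 1) = |a| ^ p := by
    rcases eq_or_ne a 0 with rfl | h
    · simp [Real.zero_rpow (show p ≠ 0 by linarith)]
    · rw [mul_comm, ← Real.rpow_add_one (abs_pos.2 h).ne']; congr 1; ring
  rw [← h, mul_comm (|a| ^ _), ← mul_assoc]
  congr 1
  rcases lt_trichotomy a 0 with h | h | h
  · simp [Real.sign_of_neg h, abs_of_neg h]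
  · simp [h]
  · simp [Real.sign_of_pos h, abs_of_pos h]

/-- The pointwise ground state inequality for the Sobolev-Bregman integrand. -/
theorem abs_rpow_add_le_mul_signedPow_sub {p : ℝ} (hp : 1 < p) {s t : ℝ} (hs : 0 < s) (ht : 0 < t)
    (a b : ℝ) : |a| ^ p + |b| ^ p ≤
      (a - b) * (signedPow a (p - 1) - signedPow b (p - 1)) +
        |a| ^ p * youngWeight p (t / s) + |b| ^ p * youngWeight p (s / t) := by
  have h1 := abs_signedPow_mul_le hp hs ht a b
  have h2 := abs_signedPow_mul_le hp ht hs b a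
  have h3 := signedPow_mul_self hp a
  have h4 := signedPow_mul_self hp b
  unfold youngWeight
  linarith

theorem mul_signedPow_sub_nonneg {p : ℝ} (hp : 1 < p) (a b : ℝ) :
    0 ≤ (a - b) * (signedPow a (p - 1) - signedPow b (p - 1)) := by
  have h := abs_rpow_add_le_mul_signedPow_sub hp one_pos one_pos a b
  rw [div_one, youngWeight_one hp] at h
  linarith

theorem setLIntegral_Ioi_inv {ρ : ℝ} (hρ : 0 < ρ) (f : ℝ → ℝ≥0∞) :
    ∫⁻ t in Ioi ρ⁻¹, f t = ∫⁻ t in Ioo 0 ρ, ENNReal.ofReal (t ^ (-2 : ℝ)) * f t⁻¹ := by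
  have himg : (fun t : ℝ => t⁻¹) '' Ioo 0 ρ = Ioi ρ⁻¹ := by
    ext t
    simp only [mem_image, mem_Ioo, mem_Ioi]
    constructor
    · rintro ⟨x, ⟨h0, h1⟩, rfl⟩
      exact (inv_lt_inv₀ hρ h0).2 h1
    · intro h
      have h0 : 0 < t := (inv_pos.2 hρ).trans h
      exact ⟨t⁻¹, ⟨inv_pos.2 h0, (inv_lt_comm₀ h0 hρ).2 h⟩, inv_inv t⟩
  rw [← himg, lintegral_image_eq_lintegral_abs_deriv_mul measurableSet_Ioo
    (fun t ht => (hasDerivAt_inv ht.1.ne').hasDerivWithinAt) inv_injective.injOn]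
  refine setLIntegral_congr_fun measurableSet_Ioo fun t ht => ?_
  have := ht.1
  congr 2
  rw [abs_neg, abs_of_nonneg (by positivity), Real.rpow_neg this.le, Real.rpow_two]

/-- The set of `t > 0` with `t < ρ` or `t⁻¹ < ρ`. -/
def ratioSet (ρ : ℝ) : Set ℝ := Ioo 0 ρ ∪ Ioi ρ⁻¹

theorem measurableSet_ratioSet (ρ : ℝ) : MeasurableSet (ratioSet ρ) :=
  measurableSet_Ioo.union measurableSet_Ioi

theorem setLIntegral_ratioSet {ρ : ℝ} (hρ : 0 < ρ) (hρ1 : ρ < 1) {f : ℝ → ℝ≥0∞}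
    (hf : Measurable f) :
    ∫⁻ t in ratioSet ρ, f t =
      ∫⁻ t in Ioo 0 ρ, (f t + ENNReal.ofReal (t ^ (-2 : ℝ)) * f t⁻¹) := by
  rw [ratioSet, lintegral_union measurableSet_Ioi, setLIntegral_Ioi_inv hρ, lintegral_add_left hf]
  refine Set.disjoint_left.2 fun t h1 h2 => ?_
  have := one_lt_inv_iff₀.2 ⟨hρ, hρ1⟩
  have := h1.2; have h2 : ρ⁻¹ < t := h2
  linarith

theorem abs_one_sub_inv_rpow {α t : ℝ} (ht : t ∈ Ioo (0 : ℝ) 1) :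
    t ^ (-2 : ℝ) * |1 - t⁻¹| ^ (-1 - α) = t ^ (α - 1) * (1 - t) ^ (-1 - α) := by
  have h0 := ht.1
  have h1 : 0 < 1 - t := by linarith [ht.2]
  have : |1 - t⁻¹| = (1 - t) * t⁻¹ := by
    rw [abs_sub_comm, abs_of_pos (by have := one_lt_inv_iff₀.2 ht; linarith)]
    field_simp
  rw [this, Real.mul_rpow h1.le (by positivity), ← Real.rpow_neg_one, ← Real.rpow_mul h0.le,
    mul_comm ((1 - t) ^ _), ← mul_assoc, ← Real.rpow_add h0]
  congr 2; ring

/-- After inversion the claim is 1 + t^(α-1) - Y(t^b) - t^(α-1) Y(t^(-b)) = (1 - t^b)(1 - t^(α-1-b))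
with Y = `youngWeight p` and b = (α-1)/p. This b makes the two mixed exponents of the first weight
reappear, exchanged, in the second. -/
theorem ratio_identity {p α t : ℝ} (hp : 1 < p) (ht : t ∈ Ioo (0 : ℝ) 1) :
    |1 - t| ^ (-1 - α) + t ^ (-2 : ℝ) * |1 - t⁻¹| ^ (-1 - α) =
      youngWeight p (t ^ ((α - 1) / p)) * |1 - t| ^ (-1 - α) +
        t ^ (-2 : ℝ) * (youngWeight p (t⁻¹ ^ ((α - 1) / p)) * |1 - t⁻¹| ^ (-1 - α)) +
      hardyKernel α ((α - 1) / p) (α - 1 - (α - 1) / p) t := by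
  have h0 := ht.1
  have h1 : 0 < 1 - t := by linarith [ht.2]
  have hp0 : p ≠ 0 := by linarith
  rw [mul_left_comm (t ^ (-2 : ℝ)), abs_one_sub_inv_rpow ht, abs_of_pos h1]
  unfold hardyKernel youngWeight
  set b := (α - 1) / p with hb
  have e0 : b * (p - 1) = α - 1 - b := by rw [hb]; field_simp
  rw [← Real.rpow_mul h0.le, ← Real.rpow_mul (inv_nonneg.2 h0.le), e0, Real.inv_rpow h0.le,
    Real.inv_rpow h0.le, Real.rpow_sub h0 (α - 1) b]
  have : t ^ b ≠ 0 := (Real.rpow_pos_of_pos h0 b).ne'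
  have : t ^ (α - 1) ≠ 0 := (Real.rpow_pos_of_pos h0 _).ne'
  field_simp
  ring

/-- The model case of a half-line, where the distance to the endpoint is `t` itself: the truncated
supersolution estimate is an equality. -/
theorem lintegral_ratioSet_eq {p α ρ : ℝ} (hp : 1 < p) (hα₁ : 1 < α) (hρ : 0 < ρ) (hρ1 : ρ < 1) :
    ∫⁻ t in ratioSet ρ, ENNReal.ofReal (|1 - t| ^ (-1 - α)) =
      (∫⁻ t in ratioSet ρ,
        ENNReal.ofReal (youngWeight p (t ^ ((α - 1) / p)) * |1 - t| ^ (-1 - α))) +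
      ∫⁻ t in Ioo 0 ρ,
        ENNReal.ofReal (hardyKernel α ((α - 1) / p) (α - 1 - (α - 1) / p) t) := by
  have hy := measurable_youngWeight p
  have hm := measurable_hardyKernel α ((α - 1) / p) (α - 1 - (α - 1) / p)
  have hb : 0 < (α - 1) / p := div_pos (by linarith) (by linarith)
  have hb' : (α - 1) / p < α - 1 := div_lt_self (by linarith) hp
  rw [setLIntegral_ratioSet hρ hρ1 (by fun_prop), setLIntegral_ratioSet hρ hρ1 (by fun_prop),
    ← lintegral_add_right _ (by fun_prop)]
  refine setLIntegral_congr_fun measurableSet_Ioo fun t ht => ?_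
  have ht' : t ∈ Ioo (0 : ℝ) 1 := ⟨ht.1, ht.2.trans hρ1⟩
  have h0 := ht.1
  have y1 := youngWeight_nonneg hp (Real.rpow_nonneg h0.le ((α - 1) / p))
  have y2 := youngWeight_nonneg hp (Real.rpow_nonneg (inv_nonneg.2 h0.le) ((α - 1) / p))
  have k := hardyKernel_nonneg (α := α) ht' hb.le (b' := α - 1 - (α - 1) / p) (by linarith)
  rw [← ENNReal.ofReal_mul (by positivity), ← ENNReal.ofReal_mul (by positivity),
    ← ENNReal.ofReal_add (by positivity) (by positivity),
    ← ENNReal.ofReal_add (by positivity) (by positivity),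
    ← ENNReal.ofReal_add (by positivity) k, ratio_identity hp ht']

theorem lintegral_ratioSet_lt_top {α ρ : ℝ} (hα₁ : 1 < α) (hρ : 0 < ρ) (hρ1 : ρ < 1) :
    ∫⁻ t in ratioSet ρ, ENNReal.ofReal (|1 - t| ^ (-1 - α)) < ∞ := by
  rw [setLIntegral_ratioSet hρ hρ1 (by fun_prop)]
  have h : ∀ t ∈ Ioo 0 ρ, ENNReal.ofReal (|1 - t| ^ (-1 - α)) +
      ENNReal.ofReal (t ^ (-2 : ℝ)) * ENNReal.ofReal (|1 - t⁻¹| ^ (-1 - α)) ≤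
      ENNReal.ofReal (2 * (1 - ρ) ^ (-1 - α)) := by
    intro t ht
    have ht' : t ∈ Ioo (0 : ℝ) 1 := ⟨ht.1, ht.2.trans hρ1⟩
    have h0 := ht.1
    have h1 : 0 < 1 - t := by linarith [ht'.2]
    rw [← ENNReal.ofReal_mul (by positivity), ← ENNReal.ofReal_add (by positivity) (by positivity),
      abs_one_sub_inv_rpow ht', abs_of_pos h1]
    refine ENNReal.ofReal_le_ofReal ?_
    have h2 : (1 - t) ^ (-1 - α) ≤ (1 - ρ) ^ (-1 - α) :=
      Real.rpow_le_rpow_of_nonpos (by linarith) (by linarith [ht.2]) (by linarith)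
    have h3 : t ^ (α - 1) ≤ 1 := Real.rpow_le_one h0.le ht'.2.le (by linarith)
    have h4 : 0 < (1 - t) ^ (-1 - α) := by positivity
    nlinarith
  refine (setLIntegral_mono measurable_const h).trans_lt ?_
  rw [setLIntegral_const, Real.volume_Ioo]
  exact ENNReal.mul_lt_top ENNReal.ofReal_lt_top ENNReal.ofReal_lt_top

/-- The one-dimensional supersolution estimate: `q` is the distance to the complement along a line,
normalized to be `1` at `t = 1`, and dominated by the distance `t` to the nearest endpoint. -/
theorem lintegral_youngWeight_add_le {p α ρ : ℝ} (hp : 1 < p) (hα₁ : 1 < α) (hρ : 0 < ρ)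
    (hρ1 : ρ < 1) {S : Set ℝ} (hS : MeasurableSet S) {q : ℝ → ℝ} (hq0 : ∀ t ∈ S, 0 ≤ q t)
    (hq : ∀ t ∈ S, q t ≤ t) (hqS : ∀ t ∈ S, q t < ρ ∨ 1 < ρ * q t) (hpos : S ⊆ Ioi 0)
    (hsub : Ioo 0 ρ ⊆ S) :
    (∫⁻ t in S, ENNReal.ofReal (youngWeight p (q t ^ ((α - 1) / p)) * |1 - t| ^ (-1 - α))) +
      ∫⁻ t in Ioo 0 ρ, ENNReal.ofReal (hardyKernel α ((α - 1) / p) (α - 1 - (α - 1) / p) t) ≤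
    ∫⁻ t in S, ENNReal.ofReal (|1 - t| ^ (-1 - α)) := by
  set T := ratioSet ρ with hT
  have hTm : MeasurableSet T := measurableSet_ratioSet ρ
  set K := ∫⁻ t in Ioo 0 ρ, ENNReal.ofReal (hardyKernel α ((α - 1) / p) (α - 1 - (α - 1) / p) t)
  set n : ℝ → ℝ≥0∞ := fun t => ENNReal.ofReal (|1 - t| ^ (-1 - α)) with hn
  set c : ℝ → ℝ≥0∞ := fun t =>
    ENNReal.ofReal (youngWeight p (t ^ ((α - 1) / p)) * |1 - t| ^ (-1 - α)) with hc
  set cq : ℝ → ℝ≥0∞ := fun t =>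
    ENNReal.ofReal (youngWeight p (q t ^ ((α - 1) / p)) * |1 - t| ^ (-1 - α)) with hcq
  have hb : 0 < (α - 1) / p := div_pos (by linarith) (by linarith)
  have hnm : Measurable n := by fun_prop
  have hcm : Measurable c := by have := measurable_youngWeight p; fun_prop
  have hTeq : ∫⁻ t in T, n t = (∫⁻ t in T, c t) + K := lintegral_ratioSet_eq hp hα₁ hρ hρ1
  have hTfin : ∫⁻ t in T, n t < ∞ := lintegral_ratioSet_lt_top hα₁ hρ hρ1
  -- Off the model set `t ≤ ρ⁻¹`, which together with `q t ≤ t` leaves only the alternative `q t <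
  -- ρ`; there the Young weight is at most `1`.
  have hST : ∫⁻ t in S \ T, cq t ≤ ∫⁻ t in S \ T, n t := by
    refine setLIntegral_mono hnm fun t ht => ENNReal.ofReal_le_ofReal ?_
    have h0 : 0 < t := hpos ht.1
    have h1 : t ≤ ρ⁻¹ := not_lt.1 fun h => ht.2 (Or.inr h)
    have h2 : q t < ρ := by
      rcases hqS t ht.1 with h | h
      · exact h
      · exfalso
        have := hq t ht.1
        have h3 : ρ * q t ≤ ρ * ρ⁻¹ := by gcongr; exact this.trans h1
        rw [mul_inv_cancel₀ hρ.ne'] at h3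
        linarith
    have h3 : youngWeight p (q t ^ ((α - 1) / p)) ≤ 1 := by
      refine le_of_le_of_eq ?_ (youngWeight_one hp)
      exact youngWeight_mono hp (Real.rpow_nonneg (hq0 t ht.1) _)
        (Real.rpow_le_one (hq0 t ht.1) (by linarith) hb.le)
    exact mul_le_of_le_one_left (by positivity) h3
  have hSiT : ∫⁻ t in S ∩ T, cq t ≤ ∫⁻ t in S ∩ T, c t := by
    refine setLIntegral_mono hcm fun t ht => ENNReal.ofReal_le_ofReal ?_
    refine mul_le_mul_of_nonneg_right ?_ (by positivity)
    exact youngWeight_mono hp (Real.rpow_nonneg (hq0 t ht.1) _)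
      (Real.rpow_le_rpow (hq0 t ht.1) (hq t ht.1) hb.le)
  -- Model points missing from `S` lie beyond `1`, where the Young weight is at least `1`, so they
  -- only lowered the model integral of `n - c`.
  have hTS : ∫⁻ t in T \ S, n t ≤ ∫⁻ t in T \ S, c t := by
    refine setLIntegral_mono hcm fun t ht => ENNReal.ofReal_le_ofReal ?_
    have h1 : 1 ≤ t := by
      rcases ht.1 with h | h
      · exact absurd (hsub h) ht.2
      · have := one_lt_inv_iff₀.2 ⟨hρ, hρ1⟩
        exact (this.trans h).le
    have h3 : 1 ≤ youngWeight p (t ^ ((α - 1) / p)) := by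
      refine le_of_eq_of_le (youngWeight_one hp).symm ?_
      exact youngWeight_mono hp zero_le_one (Real.one_le_rpow h1 hb.le)
    exact le_mul_of_one_le_left (by positivity) h3
  have hfin : ∫⁻ t in T \ S, n t ≠ ∞ :=
    ((lintegral_mono_set sdiff_subset).trans_lt hTfin).ne
  change (∫⁻ t in S, cq t) + K ≤ ∫⁻ t in S, n t
  rw [← lintegral_inter_add_sdiff cq S hTm, ← lintegral_inter_add_sdiff n S hTm]
  -- Subtraction is avoided by adding the finite integral of `n` over `T \ S` to both sides.
  refine ENNReal.le_of_add_le_add_right hfin ?_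
  calc (∫⁻ t in S ∩ T, cq t) + (∫⁻ t in S \ T, cq t) + K + (∫⁻ t in T \ S, n t)
      ≤ (∫⁻ t in S ∩ T, c t) + (∫⁻ t in S \ T, n t) + K + (∫⁻ t in T \ S, c t) := by gcongr
    _ = ((∫⁻ t in T ∩ S, c t) + (∫⁻ t in T \ S, c t) + K) + (∫⁻ t in S \ T, n t) := by
        rw [inter_comm]; ring
    _ = ((∫⁻ t in T ∩ S, n t) + (∫⁻ t in T \ S, n t)) + (∫⁻ t in S \ T, n t) := by
        rw [lintegral_inter_add_sdiff c T hS, lintegral_inter_add_sdiff n T hS, hTeq]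
    _ = _ := by rw [inter_comm]; ring

/-- Normalizes a line: the base point `r = 0` becomes `t = 1`, and the point at distance `a` on the
side given by `-e` becomes `t = 0`. -/
theorem lintegral_eq_lintegral_comp_affine {a e : ℝ} (ha : 0 < a) (he : |e| = 1) (f : ℝ → ℝ≥0∞) :
    ∫⁻ r, f r = ENNReal.ofReal a * ∫⁻ t, f (e * a * (t - 1)) := by
  have he0 : e * a ≠ 0 := by
    refine mul_ne_zero (fun h => ?_) ha.ne'
    simp [h] at he
  have himg : (fun t : ℝ => e * a * (t - 1)) '' univ = univ := by
    rw [image_univ, range_eq_univ]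
    intro r
    exact ⟨(e * a)⁻¹ * r + 1, by simp only [add_sub_cancel_right]; rw [mul_inv_cancel_left₀ he0]⟩
  have h := lintegral_image_eq_lintegral_abs_deriv_mul (s := univ)
    (f := fun t : ℝ => e * a * (t - 1)) (f' := fun _ => e * a) MeasurableSet.univ
    (fun t _ => by
      simpa using! (((hasDerivAt_id t).sub_const 1).const_mul (e * a)).hasDerivWithinAt (s := univ))
    (fun s _ t _ hst => by simpa [he0] using hst) f
  rw [himg, setLIntegral_univ, setLIntegral_univ, abs_mul, he, one_mul, abs_of_pos ha,
    lintegral_const_mul' _ _ ENNReal.ofReal_ne_top] at h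
  exact h

end

/-! ### Distances along lines and truncated pairs. -/

section

open Filter Topology

variable {d : ℕ} {Ω : Set (EuclideanSpace ℝ (Fin d))} {ω x : EuclideanSpace ℝ (Fin d)}

theorem dirDist_le {t : ℝ} (h : x + t • ω ∉ Ω) : dirDist Ω ω x ≤ ENNReal.ofReal |t| :=
  iInf₂_le t h

theorem mem_of_ofReal_abs_lt_dirDist {t : ℝ} (h : ENNReal.ofReal |t| < dirDist Ω ω x) :
    x + t • ω ∈ Ω :=
  not_not.1 fun h' => (dirDist_le h').not_gt h

theorem exists_dirDist_eq (hΩ : IsOpen Ω) (h : dirDist Ω ω x ≠ ∞) :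
    ∃ t : ℝ, x + t • ω ∉ Ω ∧ dirDist Ω ω x = ENNReal.ofReal |t| := by
  set F : Set ℝ := {t | x + t • ω ∉ Ω} with hF
  have hFc : IsClosed F := hΩ.isClosed_compl.preimage (by fun_prop : Continuous fun t : ℝ => x + t • ω)
  have hne : F.Nonempty := by
    by_contra hne
    refine h (iInf₂_eq_top.2 fun t ht => ?_)
    exact absurd ⟨t, ht⟩ hne
  obtain ⟨t, ht, hmin⟩ := hFc.exists_infDist_eq_dist hne 0
  refine ⟨t, ht, le_antisymm (dirDist_le ht) (le_iInf₂ fun s hs => ENNReal.ofReal_le_ofReal ?_)⟩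
  have := Metric.infDist_le_dist_of_mem (x := (0 : ℝ)) (show s ∈ F from hs)
  rw [hmin] at this
  simpa [Real.dist_eq] using this

theorem dirDist_add_smul_le (hΩ : IsOpen Ω) (r : ℝ) :
    dirDist Ω ω (x + r • ω) ≤ dirDist Ω ω x + ENNReal.ofReal |r| := by
  rcases eq_or_ne (dirDist Ω ω x) ∞ with h | h
  · simp [h]
  obtain ⟨t, ht, hd⟩ := exists_dirDist_eq hΩ h
  rw [hd, ← ENNReal.ofReal_add (abs_nonneg _) (abs_nonneg _)]
  refine (dirDist_le (t := t - r) ?_).trans (ENNReal.ofReal_le_ofReal (abs_sub _ _))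
  rwa [add_assoc, ← add_smul, add_sub_cancel]

theorem dirDist_le_add_smul (hΩ : IsOpen Ω) (r : ℝ) :
    dirDist Ω ω x ≤ dirDist Ω ω (x + r • ω) + ENNReal.ofReal |r| := by
  have := dirDist_add_smul_le (x := x + r • ω) (ω := ω) hΩ (-r)
  simpa [add_assoc, ← add_smul] using this

/-- A compact segment inside the open set stays inside when base point and direction are perturbed.
The purpose is joint measurability. -/
theorem lowerSemicontinuous_dirDist (hΩ : IsOpen Ω) :
    LowerSemicontinuous fun z : EuclideanSpace ℝ (Fin d) × EuclideanSpace ℝ (Fin d) =>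
      dirDist Ω z.1 z.2 := by
  intro z y hy
  obtain ⟨w, hyw, hw⟩ := exists_between hy
  lift w to NNReal using (hw.trans_le le_top).ne
  have h : ∀ᶠ z' : EuclideanSpace ℝ (Fin d) × EuclideanSpace ℝ (Fin d) in 𝓝 z,
      ∀ t ∈ Icc (-(w : ℝ)) w, z'.2 + t • z'.1 ∈ Ω := by
    refine isCompact_Icc.eventually_forall_of_forall_eventually fun t ht => ?_
    have hc : Continuous fun q : (EuclideanSpace ℝ (Fin d) × EuclideanSpace ℝ (Fin d)) × ℝ =>
        q.1.2 + q.2 • q.1.1 := by fun_prop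
    refine hc.continuousAt.eventually_mem (hΩ.mem_nhds (mem_of_ofReal_abs_lt_dirDist ?_))
    refine lt_of_le_of_lt ?_ hw
    rw [← ENNReal.ofReal_coe_nnreal]
    exact ENNReal.ofReal_le_ofReal (abs_le.2 ht)
  filter_upwards [h] with z' hz'
  refine hyw.trans_le (le_iInf₂ fun t ht => ?_)
  rw [← ENNReal.ofReal_coe_nnreal]
  refine ENNReal.ofReal_le_ofReal (not_lt.1 fun hlt => ht (hz' t (abs_le.1 hlt.le)))

theorem measurable_dirDist_prod (hΩ : IsOpen Ω) :
    Measurable fun z : EuclideanSpace ℝ (Fin d) × EuclideanSpace ℝ (Fin d) =>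
      dirDist Ω z.1 z.2 :=
  (lowerSemicontinuous_dirDist hΩ).measurable

theorem measurable_dirDist (hΩ : IsOpen Ω) (ω : EuclideanSpace ℝ (Fin d)) :
    Measurable fun x => dirDist Ω ω x := by
  have h := (measurable_dirDist_prod hΩ).comp
    (by fun_prop : Measurable fun x : EuclideanSpace ℝ (Fin d) => (ω, x))
  exact h

theorem exists_le_dirDist {K : Set (EuclideanSpace ℝ (Fin d))} (hΩ : IsOpen Ω) (hK : IsCompact K)
    (hKΩ : K ⊆ Ω) :
    ∃ a : ℝ, 0 < a ∧ ∀ x ∈ K, ∀ ω : EuclideanSpace ℝ (Fin d), ‖ω‖ = 1 →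
      ENNReal.ofReal a ≤ dirDist Ω ω x := by
  obtain ⟨a, ha, h⟩ := hK.exists_thickening_subset_open hΩ hKΩ
  refine ⟨a, ha, fun x hx ω hω => le_iInf₂ fun t ht => ENNReal.ofReal_le_ofReal ?_⟩
  by_contra! hlt
  refine ht (h (Metric.mem_thickening_iff.2 ⟨x, hx, ?_⟩))
  simpa [dist_eq_norm, norm_smul, hω] using hlt

theorem dirDist_pos (hΩ : IsOpen Ω) (hx : x ∈ Ω) : 0 < dirDist Ω ω x := by
  rcases eq_or_ne (dirDist Ω ω x) ∞ with h | h
  · simp [h]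
  obtain ⟨t, ht, hd⟩ := exists_dirDist_eq hΩ h
  rw [hd, ENNReal.ofReal_pos, abs_pos]
  rintro rfl
  simp [hx] at ht

/-- Pairs `(x, r)` such that the segment from `x` to `x + r ω` lies in `Ω` and the distances of its
endpoints to the complement of `Ω` along the line have ratio outside `[ρ, ρ⁻¹]`. -/
def pairSet (Ω : Set (EuclideanSpace ℝ (Fin d))) (ω : EuclideanSpace ℝ (Fin d)) (ρ : ℝ) :
    Set (EuclideanSpace ℝ (Fin d) × ℝ) :=
  {z | (∀ θ ∈ Icc (0 : ℝ) 1, z.1 + (θ * z.2) • ω ∈ Ω) ∧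
    (dirDist Ω ω z.1 ≠ ∞ ∧ dirDist Ω ω (z.1 + z.2 • ω) ≠ ∞) ∧
    (dirDist Ω ω (z.1 + z.2 • ω) < ENNReal.ofReal ρ * dirDist Ω ω z.1 ∨
      dirDist Ω ω z.1 < ENNReal.ofReal ρ * dirDist Ω ω (z.1 + z.2 • ω))}

theorem measurableSet_pairSet (hΩ : IsOpen Ω) (ω : EuclideanSpace ℝ (Fin d)) (ρ : ℝ) :
    MeasurableSet (pairSet Ω ω ρ) := by
  have h1 : Measurable fun z : EuclideanSpace ℝ (Fin d) × ℝ => dirDist Ω ω z.1 :=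
    (measurable_dirDist hΩ ω).comp measurable_fst
  have h2 : Measurable fun z : EuclideanSpace ℝ (Fin d) × ℝ => dirDist Ω ω (z.1 + z.2 • ω) :=
    (measurable_dirDist hΩ ω).comp (by fun_prop)
  refine MeasurableSet.inter (IsOpen.measurableSet ?_) (MeasurableSet.inter ?_ ?_)
  · change IsOpen {z : EuclideanSpace ℝ (Fin d) × ℝ |
      ∀ θ ∈ Icc (0 : ℝ) 1, z.1 + (θ * z.2) • ω ∈ Ω}
    rw [isOpen_iff_mem_nhds]
    intro z hz
    refine isCompact_Icc.eventually_forall_of_forall_eventually fun θ hθ => ?_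
    have hc : Continuous fun q : (EuclideanSpace ℝ (Fin d) × ℝ) × ℝ =>
        q.1.1 + (q.2 * q.1.2) • ω := by fun_prop
    exact hc.continuousAt.eventually_mem (hΩ.mem_nhds (hz θ hθ))
  · exact (measurableSet_eq_fun h1 measurable_const).compl.inter
      (measurableSet_eq_fun h2 measurable_const).compl
  · exact (measurableSet_lt h2 (h1.const_mul _)).union (measurableSet_lt h1 (h2.const_mul _))

theorem mem_pairSet_symm {ρ r : ℝ} (h : (x, r) ∈ pairSet Ω ω ρ) :
    (x + r • ω, -r) ∈ pairSet Ω ω ρ := by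
  obtain ⟨h1, ⟨h2, h3⟩, h4⟩ := h
  have e : x + r • ω + -r • ω = x := by simp
  refine ⟨fun θ hθ => ?_, ⟨h3, by simpa [e] using h2⟩, ?_⟩
  · have := h1 (1 - θ) ⟨by linarith [hθ.2], by linarith [hθ.1]⟩
    convert this using 1
    rw [add_assoc, ← add_smul]
    congr 2; simp only; ring
  · simp only [e]
    exact h4.symm

theorem mem_pairSet_symm_iff {ρ r : ℝ} :
    (x + r • ω, -r) ∈ pairSet Ω ω ρ ↔ (x, r) ∈ pairSet Ω ω ρ := by
  refine ⟨fun h => ?_, mem_pairSet_symm⟩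
  have := mem_pairSet_symm h
  simpa using this

/-- The distance is 1-Lipschitz along the line, so a ratio outside `[ρ, ρ⁻¹]` forces the two points
apart: the truncation removes a neighbourhood of the diagonal, uniformly over a compact subset of
`Ω`. -/
theorem le_abs_of_mem_pairSet (hΩ : IsOpen Ω) {ρ r a : ℝ} (hρ : 0 < ρ) (hρ1 : ρ < 1)
    (ha : ENNReal.ofReal a ≤ dirDist Ω ω x) (h : (x, r) ∈ pairSet Ω ω ρ) : (1 - ρ) * a ≤ |r| := by
  obtain ⟨-, ⟨h2, h3⟩, h4⟩ := h
  have h5 := dirDist_add_smul_le (x := x) (ω := ω) hΩ r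
  have h6 := dirDist_le_add_smul (x := x) (ω := ω) hΩ r
  simp only at h2 h3 h4
  set δ := dirDist Ω ω x
  set δ' := dirDist Ω ω (x + r • ω)
  obtain ⟨D, hD, hδ⟩ : ∃ D : ℝ, 0 ≤ D ∧ δ = ENNReal.ofReal D :=
    ⟨δ.toReal, ENNReal.toReal_nonneg, (ENNReal.ofReal_toReal h2).symm⟩
  obtain ⟨D', hD', hδ'⟩ : ∃ D : ℝ, 0 ≤ D ∧ δ' = ENNReal.ofReal D :=
    ⟨δ'.toReal, ENNReal.toReal_nonneg, (ENNReal.ofReal_toReal h3).symm⟩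
  rw [hδ, hδ', ← ENNReal.ofReal_add (by positivity) (by positivity),
    ENNReal.ofReal_le_ofReal_iff (by positivity)] at h5 h6
  rw [hδ, ENNReal.ofReal_le_ofReal_iff hD] at ha
  rw [hδ, hδ', ← ENNReal.ofReal_mul hρ.le, ← ENNReal.ofReal_mul hρ.le] at h4
  have h7 : (1 - ρ) * a ≤ (1 - ρ) * D := by
    have : 0 ≤ 1 - ρ := by linarith
    gcongr
  rcases h4 with h4 | h4
  · have := (ENNReal.ofReal_lt_ofReal_iff_of_nonneg hD').1 h4
    linarith
  · have := (ENNReal.ofReal_lt_ofReal_iff_of_nonneg hD).1 h4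
    nlinarith

theorem lintegral_abs_rpow_lt_top {m α : ℝ} (hm : 0 < m) (hα : 0 < α) :
    ∫⁻ r in {r : ℝ | m ≤ |r|}, ENNReal.ofReal (|r| ^ (-1 - α)) < ∞ := by
  have h1 : Integrable fun r : ℝ => (1 / m + 1) ^ (1 + α) * (1 + ‖r‖) ^ (-(1 + α)) :=
    (integrable_one_add_norm (by simp [hα])).const_mul _
  refine (setLIntegral_mono' (s := {r : ℝ | m ≤ |r|})
    (measurableSet_le measurable_const (by fun_prop)) fun r hr => ENNReal.ofReal_le_ofReal
    (q := (1 / m + 1) ^ (1 + α) * (1 + ‖r‖) ^ (-(1 + α))) ?_).trans_lt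
    ((setLIntegral_le_lintegral _ _).trans_lt h1.lintegral_lt_top)
  have hr : m ≤ |r| := hr
  have hr0 : 0 < |r| := hm.trans_le hr
  rw [Real.norm_eq_abs, show -1 - α = -(1 + α) by ring, Real.rpow_neg (by positivity),
    Real.rpow_neg (by positivity), ← div_eq_mul_inv, ← Real.div_rpow (by positivity) (by positivity),
    ← Real.inv_rpow (by positivity)]
  refine Real.rpow_le_rpow (by positivity) ?_ (by linarith)
  rw [le_div_iff₀ (by positivity), mul_add, inv_mul_cancel₀ hr0.ne', mul_one, one_div]
  have := inv_anti₀ hm hr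
  linarith

/-- Symmetrization along a fixed direction. -/
theorem lintegral_lintegral_Ioi_add_symm {g : EuclideanSpace ℝ (Fin d) × ℝ → ℝ≥0∞}
    (hg : Measurable g) (ω : EuclideanSpace ℝ (Fin d)) :
    (∫⁻ x, ∫⁻ r in Ioi (0 : ℝ), g (x, r)) + ∫⁻ x, ∫⁻ r in Ioi (0 : ℝ), g (x + r • ω, -r) =
      ∫⁻ x, ∫⁻ r, g (x, r) := by
  have h1 : ∫⁻ x, ∫⁻ r in Ioi (0 : ℝ), g (x + r • ω, -r) = ∫⁻ x, ∫⁻ r in Iio (0 : ℝ), g (x, r) := by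
    rw [lintegral_lintegral_swap (by fun_prop)]
    have h2 : ∀ r : ℝ, ∫⁻ x, g (x + r • ω, -r) = ∫⁻ x, g (x, -r) := fun r =>
      lintegral_add_right_eq_self (fun x => g (x, -r)) (r • ω)
    simp_rw [h2]
    rw [lintegral_lintegral_swap (f := fun r x => g (x, -r)) (by fun_prop)]
    refine lintegral_congr fun x => ?_
    have := (Measure.measurePreserving_neg (volume : Measure ℝ)).setLIntegral_comp_preimage
      (measurableSet_Iio (a := (0 : ℝ))) (f := fun r => g (x, r)) (by fun_prop)
    simpa using this
  rw [h1, ← lintegral_add_left (by fun_prop)]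
  refine lintegral_congr fun x => ?_
  rw [← lintegral_union measurableSet_Iio, union_comm, Iio_union_Ioi, restrict_compl_singleton]
  exact Set.disjoint_left.2 fun r h1 h2 => lt_asymm (mem_Ioi.1 h1) (mem_Iio.1 h2)

end

/-! ### The weighted inequality along a fixed direction. -/

section

open Filter Topology

variable {d : ℕ} {Ω : Set (EuclideanSpace ℝ (Fin d))}

/-- Transports `lintegral_youngWeight_add_le` to the line through `x`, with a nearest missing point
at `t = 0` and `x` at `t = 1`. The scaling factor `a * a ^ (-1 - α)` is the weight `dirDist Ω ω x ^
(-α)`. -/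
theorem lintegral_pairSet_youngWeight_add_le {p α ρ : ℝ} (hp : 1 < p) (hα₁ : 1 < α) (hρ : 0 < ρ)
    (hρ1 : ρ < 1) (hΩ : IsOpen Ω) {x : EuclideanSpace ℝ (Fin d)} (hx : x ∈ Ω)
    (ω : EuclideanSpace ℝ (Fin d)) :
    (∫⁻ r, (pairSet Ω ω ρ).indicator (fun z => ENNReal.ofReal
        (youngWeight p (((dirDist Ω ω (z.1 + z.2 • ω)).toReal / (dirDist Ω ω z.1).toReal) ^
          ((α - 1) / p)) * |z.2| ^ (-1 - α))) (x, r)) +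
      (∫⁻ t in Ioo 0 ρ, ENNReal.ofReal
        (hardyKernel α ((α - 1) / p) (α - 1 - (α - 1) / p) t)) * dirDist Ω ω x ^ (-α) ≤
    ∫⁻ r, (pairSet Ω ω ρ).indicator (fun z => ENNReal.ofReal (|z.2| ^ (-1 - α))) (x, r) := by
  rcases eq_or_ne (dirDist Ω ω x) ∞ with h | h
  -- When the whole line lies in `Ω`, no pair survives the truncation and `∞ ^ (-α) = 0`, so both
  -- sides vanish.
  · have h0 : ∀ r, (x, r) ∉ pairSet Ω ω ρ := fun r hr => hr.2.1.1 h
    simp [h0, h, hα₁.trans' zero_lt_one]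
  obtain ⟨t₀, ht₀, hd⟩ := exists_dirDist_eq hΩ h
  have ha : 0 < |t₀| := by
    have := dirDist_pos (ω := ω) hΩ hx
    rwa [hd, ENNReal.ofReal_pos] at this
  obtain ⟨e, he, hea⟩ : ∃ e : ℝ, |e| = 1 ∧ t₀ = -(e * |t₀|) := by
    rcases le_total 0 t₀ with h | h
    · exact ⟨-1, by simp, by simp [abs_of_nonneg h]⟩
    · exact ⟨1, by simp, by simp [abs_of_nonpos h]⟩
  set a := |t₀| with ha_def
  have hee : e * e = 1 := by rw [← abs_mul_abs_self, he, one_mul]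
  set S : Set ℝ := {t | (x, e * a * (t - 1)) ∈ pairSet Ω ω ρ} with hS
  have hSm : MeasurableSet S :=
    (measurableSet_pairSet hΩ ω ρ).preimage (by fun_prop : Measurable fun t : ℝ =>
      ((x, e * a * (t - 1)) : EuclideanSpace ℝ (Fin d) × ℝ))
  set q : ℝ → ℝ := fun t => (dirDist Ω ω (x + (e * a * (t - 1)) • ω)).toReal / a with hq
  have habs : ∀ t : ℝ, |e * a * (t - 1)| = a * |1 - t| := fun t => by
    rw [abs_mul, abs_mul, he, one_mul, abs_of_pos ha, abs_sub_comm]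
  have hpow : ∀ t : ℝ, |e * a * (t - 1)| ^ (-1 - α) = a ^ (-1 - α) * |1 - t| ^ (-1 - α) := fun t => by
    rw [habs, Real.mul_rpow ha.le (abs_nonneg _)]
  have hle : ∀ t : ℝ, 0 ≤ t → dirDist Ω ω (x + (e * a * (t - 1)) • ω) ≤ ENNReal.ofReal (a * t) := by
    intro t ht
    have hmem : x + (e * a * (t - 1)) • ω + (-(e * a * t)) • ω ∉ Ω := by
      have h1 : e * a * (t - 1) + -(e * a * t) = t₀ := by linarith
      rwa [add_assoc, ← add_smul, h1]
    refine (dirDist_le hmem).trans_eq ?_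
    rw [abs_neg, abs_mul, abs_mul, he, one_mul, abs_of_pos ha, abs_of_nonneg ht]
  have hqle : ∀ t : ℝ, 0 ≤ t → q t ≤ t := by
    intro t ht
    rw [hq, div_le_iff₀ ha, mul_comm t]
    exact ENNReal.toReal_le_of_le_ofReal (by positivity) (hle t ht)
  -- A parameter `t ≤ 0` would put the missing point on the segment from `x`, which `pairSet`
  -- forbids.
  have hpos : S ⊆ Ioi 0 := by
    intro t ht
    by_contra hneg
    have hneg : t ≤ 0 := not_lt.1 hneg
    have h1 : 0 < 1 - t := by linarith
    have := ht.1 (1 / (1 - t)) ⟨by positivity, by rw [div_le_one h1]; linarith⟩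
    have h2 : 1 / (1 - t) * (e * a * (t - 1)) = t₀ := by
      rw [hea]
      have := h1.ne'
      field_simp
      linarith
    simp only [h2] at this
    exact ht₀ this
  have hqS : ∀ t ∈ S, q t < ρ ∨ 1 < ρ * q t := by
    intro t ht
    obtain ⟨-, ⟨-, h3⟩, h4⟩ := ht
    simp only at h3 h4
    have hδ := (ENNReal.ofReal_toReal h3).symm
    rw [hd, hδ, ← ENNReal.ofReal_mul hρ.le, ← ENNReal.ofReal_mul hρ.le] at h4
    rcases h4 with h4 | h4
    · left
      rw [hq, div_lt_iff₀ ha]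
      exact (ENNReal.ofReal_lt_ofReal_iff_of_nonneg ENNReal.toReal_nonneg).1 h4
    · right
      rw [hq, ← mul_div_assoc, lt_div_iff₀ ha, one_mul]
      exact (ENNReal.ofReal_lt_ofReal_iff_of_nonneg ha.le).1 h4
  -- Points with `0 < t < ρ` lie at distance less than `a` from `x`, hence before any missing point,
  -- and their own distance to the complement is at most `a * t`.
  have hsub : Ioo 0 ρ ⊆ S := by
    intro t ht
    refine ⟨fun θ hθ => mem_of_ofReal_abs_lt_dirDist ?_, ⟨h, ?_⟩, Or.inl ?_⟩
    · simp only
      rw [hd, ENNReal.ofReal_lt_ofReal_iff ha, abs_mul, habs, abs_of_nonneg hθ.1,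
        abs_of_pos (by linarith [ht.2])]
      have h1 : 1 - t < 1 := by linarith [ht.1]
      have h2 : 0 < 1 - t := by linarith [ht.2]
      calc θ * (a * (1 - t)) ≤ 1 * (a * (1 - t)) := by
            have := hθ.2
            gcongr
        _ < 1 * (a * 1) := by gcongr
        _ = a := by ring
    · exact ((hle t ht.1.le).trans_lt ENNReal.ofReal_lt_top).ne
    · refine (hle t ht.1.le).trans_lt ?_
      simp only
      rw [hd, ← ENNReal.ofReal_mul hρ.le, mul_comm a,
        ENNReal.ofReal_lt_ofReal_iff (by positivity)]
      exact mul_lt_mul_of_pos_right ht.2 ha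
  have key := lintegral_youngWeight_add_le hp hα₁ hρ hρ1 hSm
    (fun t _ => div_nonneg ENNReal.toReal_nonneg ha.le) (fun t ht => hqle t (le_of_lt (hpos ht)))
    hqS hpos hsub
  have hind : ∀ (f : EuclideanSpace ℝ (Fin d) × ℝ → ℝ≥0∞) (t : ℝ),
      (pairSet Ω ω ρ).indicator f (x, e * a * (t - 1)) =
        S.indicator (fun t => f (x, e * a * (t - 1))) t := fun f t => rfl
  have hap : ENNReal.ofReal a * ENNReal.ofReal (a ^ (-1 - α)) = dirDist Ω ω x ^ (-α) := by
    rw [hd, ENNReal.ofReal_rpow_of_pos ha, ← ENNReal.ofReal_mul ha.le, mul_comm a,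
      ← Real.rpow_add_one ha.ne']
    congr 2; ring
  rw [lintegral_eq_lintegral_comp_affine ha he (fun r => (pairSet Ω ω ρ).indicator (fun z =>
      ENNReal.ofReal (|z.2| ^ (-1 - α))) (x, r)),
    lintegral_eq_lintegral_comp_affine ha he (fun r => (pairSet Ω ω ρ).indicator _ (x, r))]
  simp_rw [hind]
  rw [lintegral_indicator hSm, lintegral_indicator hSm]
  simp only [hpow]
  have e1 : ∀ t, ENNReal.ofReal (a ^ (-1 - α) * |1 - t| ^ (-1 - α)) =
      ENNReal.ofReal (a ^ (-1 - α)) * ENNReal.ofReal (|1 - t| ^ (-1 - α)) := fun t =>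
    ENNReal.ofReal_mul (by positivity)
  have e2 : ∀ t, ENNReal.ofReal (youngWeight p (((dirDist Ω ω (x + (e * a * (t - 1)) • ω)).toReal /
      (dirDist Ω ω x).toReal) ^ ((α - 1) / p)) * (a ^ (-1 - α) * |1 - t| ^ (-1 - α))) =
      ENNReal.ofReal (a ^ (-1 - α)) *
        ENNReal.ofReal (youngWeight p (q t ^ ((α - 1) / p)) * |1 - t| ^ (-1 - α)) := fun t => by
    rw [← ENNReal.ofReal_mul (by positivity), hd, ENNReal.toReal_ofReal ha.le]
    congr 1
    rw [hq]; ring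
  simp_rw [e1, e2]
  rw [lintegral_const_mul' _ _ ENNReal.ofReal_ne_top, lintegral_const_mul' _ _ ENNReal.ofReal_ne_top,
    ← mul_assoc, ← mul_assoc, hap, mul_comm _ (dirDist Ω ω x ^ (-α)), ← mul_add]
  gcongr

theorem measurable_sign : Measurable Real.sign := by
  unfold Real.sign
  exact Measurable.ite measurableSet_Iio measurable_const
    (Measurable.ite measurableSet_Ioi measurable_const measurable_const)

/-- The Sobolev-Bregman integrand `(a - b) (a^⟨p-1⟩ - b^⟨p-1⟩)`. -/
def bregman (p a b : ℝ) : ℝ := (a - b) * (signedPow a (p - 1) - signedPow b (p - 1))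

theorem bregman_nonneg {p : ℝ} (hp : 1 < p) (a b : ℝ) : 0 ≤ bregman p a b :=
  mul_signedPow_sub_nonneg hp a b

theorem bregman_comm (p a b : ℝ) : bregman p a b = bregman p b a := by
  unfold bregman; ring

theorem measurable_bregman (p : ℝ) : Measurable fun z : ℝ × ℝ => bregman p z.1 z.2 := by
  have := measurable_sign
  unfold bregman signedPow
  fun_prop

/-- The contribution of `x` and `x + r ω` to the form along the direction `ω`. -/
def lineIntegrand (p α : ℝ) (Ω : Set (EuclideanSpace ℝ (Fin d))) (u : EuclideanSpace ℝ (Fin d) → ℝ)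
    (ω x : EuclideanSpace ℝ (Fin d)) (r : ℝ) : ℝ≥0∞ :=
  Ω.indicator (fun y => ENNReal.ofReal (bregman p (u x) (u y) * r ^ (-1 - α))) (x + r • ω)

/-- The supersolution estimate at each `x` is weighted with `|u x| ^ p`, the ground state inequality
is integrated over truncated pairs, and the common Young term cancels. It is finite because the
support of `u` is compact and the truncation avoids the diagonal. -/
theorem lintegral_pairSet_le {p α ρ : ℝ} (hp : 1 < p) (hα₁ : 1 < α) (hρ : 0 < ρ) (hρ1 : ρ < 1)
    (hΩ : IsOpen Ω) {u : EuclideanSpace ℝ (Fin d) → ℝ} (hu : IsCc Ω u)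
    {ω : EuclideanSpace ℝ (Fin d)} (hω : ‖ω‖ = 1) :
    (∫⁻ t in Ioo 0 ρ, ENNReal.ofReal (hardyKernel α ((α - 1) / p) (α - 1 - (α - 1) / p) t)) *
      ∫⁻ x in Ω, ENNReal.ofReal (|u x| ^ p) * dirDist Ω ω x ^ (-α) ≤
    ∫⁻ x in Ω, ∫⁻ r in Ioi (0 : ℝ), lineIntegrand p α Ω u ω x r := by
  obtain ⟨huc, hus, hut⟩ := hu
  have hum : Measurable u := huc.measurable
  set b := (α - 1) / p with hb
  set K := ∫⁻ t in Ioo 0 ρ, ENNReal.ofReal (hardyKernel α b (α - 1 - b) t) with hK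
  set S := pairSet Ω ω ρ with hS
  have hSm : MeasurableSet S := measurableSet_pairSet hΩ ω ρ
  have hdm := measurable_dirDist hΩ ω
  have hym := measurable_youngWeight p
  set cw : EuclideanSpace ℝ (Fin d) × ℝ → ℝ := fun z => youngWeight p
    (((dirDist Ω ω (z.1 + z.2 • ω)).toReal / (dirDist Ω ω z.1).toReal) ^ b) with hcw
  have hcwm : Measurable cw := by
    have h2 : Measurable fun z : EuclideanSpace ℝ (Fin d) × ℝ => dirDist Ω ω (z.1 + z.2 • ω) :=
      hdm.comp (by fun_prop)
    have h1 : Measurable fun z : EuclideanSpace ℝ (Fin d) × ℝ => dirDist Ω ω z.1 :=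
      hdm.comp (by fun_prop)
    exact hym.comp ((h2.ennreal_toReal.div h1.ennreal_toReal).pow_const _)
  have hcw0 : ∀ z, 0 ≤ cw z := fun z => youngWeight_nonneg hp
    (Real.rpow_nonneg (div_nonneg ENNReal.toReal_nonneg ENNReal.toReal_nonneg) _)
  set n : EuclideanSpace ℝ (Fin d) × ℝ → ℝ≥0∞ :=
    S.indicator (fun z => ENNReal.ofReal (|z.2| ^ (-1 - α))) with hn
  set c : EuclideanSpace ℝ (Fin d) × ℝ → ℝ≥0∞ :=
    S.indicator (fun z => ENNReal.ofReal (cw z * |z.2| ^ (-1 - α))) with hc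
  have hnm : Measurable n := Measurable.indicator (by fun_prop) hSm
  have hcm : Measurable c := Measurable.indicator (by fun_prop) hSm
  set v : EuclideanSpace ℝ (Fin d) → ℝ≥0∞ := fun x => ENNReal.ofReal (|u x| ^ p) with hv
  have hvm : Measurable v := by fun_prop
  have hSΩ : ∀ x r, (x, r) ∈ S → x ∈ Ω := fun x r h => by
    simpa using h.1 0 ⟨le_rfl, zero_le_one⟩
  have hSΩ' : ∀ x r, (x, r) ∈ S → x + r • ω ∈ Ω := fun x r h => by
    simpa using h.1 1 ⟨zero_le_one, le_rfl⟩
  have hp0 : p ≠ 0 := by linarith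
  -- the pointwise inequality
  have hpt : ∀ x, ∀ r ∈ Ioi (0 : ℝ), v x * n (x, r) + v (x + r • ω) * n (x + r • ω, -r) ≤
      Ω.indicator (fun x => lineIntegrand p α Ω u ω x r) x +
        (v x * c (x, r) + v (x + r • ω) * c (x + r • ω, -r)) := by
    intro x r hr
    have hr : 0 < r := hr
    by_cases hmem : (x, r) ∈ S
    · have hmem' : (x + r • ω, -r) ∈ S := mem_pairSet_symm hmem
      have h2 := hmem.2.1.1
      have h3 := hmem.2.1.2
      have hs : 0 < (dirDist Ω ω x).toReal :=
        ENNReal.toReal_pos (dirDist_pos hΩ (hSΩ x r hmem)).ne' h2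
      have ht : 0 < (dirDist Ω ω (x + r • ω)).toReal :=
        ENNReal.toReal_pos (dirDist_pos hΩ (hSΩ' x r hmem)).ne' h3
      have hy := abs_rpow_add_le_mul_signedPow_sub hp (Real.rpow_pos_of_pos hs b)
        (Real.rpow_pos_of_pos ht b) (u x) (u (x + r • ω))
      rw [← Real.div_rpow ht.le hs.le, ← Real.div_rpow hs.le ht.le] at hy
      have c1 : cw (x, r) = youngWeight p
        (((dirDist Ω ω (x + r • ω)).toReal / (dirDist Ω ω x).toReal) ^ b) := rfl
      have c2 : cw (x + r • ω, -r) = youngWeight p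
        (((dirDist Ω ω x).toReal / (dirDist Ω ω (x + r • ω)).toReal) ^ b) := by
        simp [hcw]
      rw [← c1, ← c2] at hy
      simp only [hn, hc, hv, lineIntegrand, indicator_of_mem hmem, indicator_of_mem hmem',
        indicator_of_mem (hSΩ x r hmem), indicator_of_mem (hSΩ' x r hmem), abs_neg, abs_of_pos hr]
      have hr' : 0 ≤ r ^ (-1 - α) := by positivity
      have := hcw0 (x, r)
      have := hcw0 (x + r • ω, -r)
      have hbr := bregman_nonneg hp (u x) (u (x + r • ω))
      rw [← ENNReal.ofReal_mul (by positivity), ← ENNReal.ofReal_mul (by positivity),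
        ← ENNReal.ofReal_mul (by positivity), ← ENNReal.ofReal_mul (by positivity),
        ← ENNReal.ofReal_add (by positivity) (by positivity),
        ← ENNReal.ofReal_add (by positivity) (by positivity),
        ← ENNReal.ofReal_add (by positivity) (by positivity)]
      refine ENNReal.ofReal_le_ofReal ?_
      have := mul_le_mul_of_nonneg_right hy hr'
      unfold bregman
      linarith
    · have hmem' : (x + r • ω, -r) ∉ S := fun h => hmem (mem_pairSet_symm_iff.1 h)
      simp [hn, hc, hmem, hmem']
  -- The pointwise inequality sees a pair once, with `r > 0`, and contains both endpoint terms;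
  -- symmetrization merges these into one integral over all real `r`.
  have hint : (∫⁻ x, ∫⁻ r, v x * n (x, r)) ≤
      (∫⁻ x in Ω, ∫⁻ r in Ioi (0 : ℝ), lineIntegrand p α Ω u ω x r) +
        ∫⁻ x, ∫⁻ r, v x * c (x, r) := by
    rw [← lintegral_lintegral_Ioi_add_symm (g := fun z => v z.1 * n z) (by fun_prop) ω,
      ← lintegral_lintegral_Ioi_add_symm (g := fun z => v z.1 * c z) (by fun_prop) ω,
      ← lintegral_add_left (by fun_prop), ← lintegral_add_left (by fun_prop),
      ← lintegral_indicator hΩ.measurableSet, ← lintegral_add_right _ (by fun_prop)]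
    refine lintegral_mono fun x => ?_
    simp only
    rw [← lintegral_add_left (by fun_prop), ← lintegral_add_left (by fun_prop)]
    have : Ω.indicator (fun x => ∫⁻ r in Ioi (0 : ℝ), lineIntegrand p α Ω u ω x r) x =
        ∫⁻ r in Ioi (0 : ℝ), Ω.indicator (fun x => lineIntegrand p α Ω u ω x r) x := by
      by_cases hx : x ∈ Ω <;> simp [hx]
    rw [this, ← lintegral_add_right _ (by fun_prop)]
    exact setLIntegral_mono' measurableSet_Ioi fun r hr => hpt x r hr
  have hlow : (∫⁻ x, ∫⁻ r, v x * c (x, r)) + K * ∫⁻ x in Ω, v x * dirDist Ω ω x ^ (-α) ≤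
      ∫⁻ x, ∫⁻ r, v x * n (x, r) := by
    rw [← lintegral_indicator hΩ.measurableSet, ← lintegral_const_mul _
      (Measurable.indicator (by fun_prop) hΩ.measurableSet), ← lintegral_add_left (by fun_prop)]
    refine lintegral_mono fun x => ?_
    simp only
    rw [lintegral_const_mul _ (by fun_prop), lintegral_const_mul _ (by fun_prop)]
    by_cases hx : x ∈ Ω
    · rw [indicator_of_mem hx, mul_left_comm, ← mul_add]
      gcongr
      exact lintegral_pairSet_youngWeight_add_le hp hα₁ hρ hρ1 hΩ hx ω
    · have hux : u x = 0 := image_eq_zero_of_notMem_tsupport fun h => hx (hut h)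
      simp [hx, hv, hux, Real.zero_rpow hp0]
  -- By `hlow` the Young term is dominated by the unweighted term, in which `|r|` is at least `(1 -
  -- ρ) * a` for `x` in the support.
  have hfin : (∫⁻ x, ∫⁻ r, v x * c (x, r)) ≠ ∞ := by
    obtain ⟨a, ha, had⟩ := exists_le_dirDist hΩ hus hut
    set m := (1 - ρ) * a with hm
    have hm0 : 0 < m := mul_pos (by linarith) ha
    set M := ∫⁻ r in {r : ℝ | m ≤ |r|}, ENNReal.ofReal (|r| ^ (-1 - α)) with hM
    have hMfin : M < ∞ := lintegral_abs_rpow_lt_top hm0 (by linarith)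
    have hvint : ∫⁻ x, v x < ∞ := by
      have hcont : Continuous fun x => |u x| ^ p :=
        huc.abs.rpow_const fun x => Or.inr (by linarith)
      have hcs : HasCompactSupport fun x => |u x| ^ p :=
        hus.comp_left (g := fun y : ℝ => |y| ^ p) (by simp [Real.zero_rpow hp0])
      exact (hcont.integrable_of_hasCompactSupport hcs).lintegral_lt_top
    have hle : (∫⁻ x, ∫⁻ r, v x * n (x, r)) ≤ ∫⁻ x, v x * M := by
      refine lintegral_mono fun x => ?_
      simp only
      rw [lintegral_const_mul _ (by fun_prop)]
      by_cases hx : x ∈ tsupport u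
      · gcongr
        rw [hM, ← lintegral_indicator (measurableSet_le measurable_const (by fun_prop))]
        refine lintegral_mono fun r => ?_
        by_cases hr : (x, r) ∈ S
        · have hr' : r ∈ {r : ℝ | m ≤ |r|} :=
            le_abs_of_mem_pairSet hΩ hρ hρ1 (had x hx ω hω) hr
          simp only [hn, indicator_of_mem hr, indicator_of_mem hr', le_refl]
        · simp [hn, hr]
      · simp [hv, image_eq_zero_of_notMem_tsupport hx, Real.zero_rpow hp0]
    rw [lintegral_mul_const _ hvm] at hle
    exact ((le_self_add.trans hlow).trans_lt (hle.trans_lt (ENNReal.mul_lt_top hvint hMfin))).ne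
  refine ENNReal.le_of_add_le_add_left hfin (hlow.trans (hint.trans_eq (add_comm _ _)))

/-- Only the constant on the left depends on `ρ`, and it increases to `kappaOne` as `ρ` increases to
`1`. -/
theorem kappaOne_mul_lintegral_dirDist_le {p α : ℝ} (hp : 1 < p) (hα₁ : 1 < α) (hα₂ : α < 2)
    (hΩ : IsOpen Ω) {u : EuclideanSpace ℝ (Fin d) → ℝ} (hu : IsCc Ω u)
    {ω : EuclideanSpace ℝ (Fin d)} (hω : ‖ω‖ = 1) :
    ENNReal.ofReal (kappaOne p α) *
      ∫⁻ x in Ω, ENNReal.ofReal (|u x| ^ p) * dirDist Ω ω x ^ (-α) ≤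
    ∫⁻ x in Ω, ∫⁻ r in Ioi (0 : ℝ), lineIntegrand p α Ω u ω x r := by
  rw [ofReal_kappaOne_eq_lintegral hp hα₁ hα₂]
  set ρ : ℕ → ℝ := fun n => 1 - 1 / ((n : ℝ) + 2) with hρ
  have hρ0 : ∀ n, 0 < ρ n := fun n => by
    have : (0 : ℝ) ≤ n := n.cast_nonneg
    rw [hρ, sub_pos, div_lt_one (by positivity)]; linarith
  have hρ1 : ∀ n, ρ n < 1 := fun n => by
    have : (0 : ℝ) < 1 / ((n : ℝ) + 2) := by positivity
    simp only [hρ]; linarith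
  have hmono : Monotone fun n => Ioo 0 (ρ n) := fun m n hmn => by
    refine Ioo_subset_Ioo_right ?_
    have : (m : ℝ) ≤ n := by exact_mod_cast hmn
    simp only [hρ]; gcongr
  have hU : Ioo (0 : ℝ) 1 = ⋃ n, Ioo 0 (ρ n) := by
    ext t
    simp only [mem_Ioo, mem_iUnion]
    refine ⟨fun ⟨h0, h1⟩ => ?_, fun ⟨n, h0, h1⟩ => ⟨h0, h1.trans (hρ1 n)⟩⟩
    obtain ⟨n, hn⟩ := exists_nat_gt (1 / (1 - t))
    refine ⟨n, h0, ?_⟩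
    have h2 : 0 < 1 - t := by linarith
    have h3 : 1 / ((n : ℝ) + 2) < 1 - t := by
      rw [div_lt_iff₀ (by positivity)]
      rw [div_lt_iff₀ h2] at hn
      nlinarith
    simp only [hρ]; linarith
  rw [hU, setLIntegral_iUnion_of_directed _ hmono.directed_le, ENNReal.iSup_mul]
  exact iSup_le fun n => lintegral_pairSet_le hp hα₁ (hρ0 n) (hρ1 n) hΩ hu hω

end

/-! ### Averaging over directions, and convex domains. -/

section

variable {d : ℕ} {Ω : Set (EuclideanSpace ℝ (Fin d))}

theorem measurable_lineIntegrand (p α : ℝ) (hΩ : IsOpen Ω) {u : EuclideanSpace ℝ (Fin d) → ℝ}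
    (hu : Measurable u) :
    Measurable fun z : (EuclideanSpace ℝ (Fin d) × EuclideanSpace ℝ (Fin d)) × ℝ =>
      lineIntegrand p α Ω u z.1.1 z.1.2 z.2 := by
  have h := measurable_bregman p
  have hS : MeasurableSet {z : (EuclideanSpace ℝ (Fin d) × EuclideanSpace ℝ (Fin d)) × ℝ |
      z.1.2 + z.2 • z.1.1 ∈ Ω} :=
    hΩ.measurableSet.preimage (by fun_prop)
  have hf : Measurable fun z : (EuclideanSpace ℝ (Fin d) × EuclideanSpace ℝ (Fin d)) × ℝ =>
      ENNReal.ofReal (bregman p (u z.1.2) (u (z.1.2 + z.2 • z.1.1)) * z.2 ^ (-1 - α)) := by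
    refine ENNReal.measurable_ofReal.comp (Measurable.mul ?_ (by fun_prop))
    exact h.comp (Measurable.prodMk (by fun_prop) (by fun_prop))
  exact hf.indicator hS

theorem nontrivial_euclideanSpace [NeZero d] : Nontrivial (EuclideanSpace ℝ (Fin d)) :=
  Module.nontrivial_of_finrank_pos (R := ℝ) (by simpa using Nat.pos_of_ne_zero (NeZero.ne d))

/-- The Jacobian `r ^ (d - 1)` reduces the kernel `r ^ (-(d + α))` to the one-dimensional `r ^ (-1 -
α)`. -/
theorem lintegral_kernel_eq_lintegral_sphere [NeZero d] (p α : ℝ) (hΩ : IsOpen Ω)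
    {u : EuclideanSpace ℝ (Fin d) → ℝ} (hu : Measurable u) (x : EuclideanSpace ℝ (Fin d)) :
    ∫⁻ y in Ω, ENNReal.ofReal (bregman p (u x) (u y) / ‖x - y‖ ^ ((d : ℝ) + α)) =
      ∫⁻ ω : Metric.sphere (0 : EuclideanSpace ℝ (Fin d)) 1,
        (∫⁻ r in Ioi (0 : ℝ), lineIntegrand p α Ω u ω x r)
          ∂(volume : Measure (EuclideanSpace ℝ (Fin d))).toSphere := by
  have := nontrivial_euclideanSpace (d := d)
  have hbm : Measurable fun y => bregman p (u x) (u y) :=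
    (measurable_bregman p).comp (measurable_const.prodMk hu)
  set f : EuclideanSpace ℝ (Fin d) → ℝ≥0∞ :=
    fun y => ENNReal.ofReal (bregman p (u x) (u y) / ‖x - y‖ ^ ((d : ℝ) + α)) with hf
  have hfm : Measurable (Ω.indicator f) :=
    Measurable.indicator (by fun_prop) hΩ.measurableSet
  rw [← lintegral_indicator hΩ.measurableSet, ← lintegral_add_left_eq_self _ x,
    lintegral_eq_lintegral_sphere_lintegral_Ioi volume (by fun_prop)]
  refine lintegral_congr fun ω => setLIntegral_congr_fun measurableSet_Ioi fun r hr => ?_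
  have hr : 0 < r := hr
  have hd : 1 ≤ d := Nat.one_le_iff_ne_zero.2 (NeZero.ne d)
  have hω : ‖(ω : EuclideanSpace ℝ (Fin d))‖ = 1 := by simp
  by_cases hmem : x + r • (ω : EuclideanSpace ℝ (Fin d)) ∈ Ω
  · simp only [lineIntegrand, indicator_of_mem hmem]
    rw [← ENNReal.ofReal_mul (by positivity)]
    congr 1
    have : ‖x - (x + r • (ω : EuclideanSpace ℝ (Fin d)))‖ = r := by
      rw [sub_add_cancel_left, norm_neg, norm_smul, hω, mul_one, Real.norm_of_nonneg hr.le]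
    rw [this, finrank_euclideanSpace_fin, ← Real.rpow_natCast, Nat.cast_sub hd, Nat.cast_one,
      mul_div_assoc', mul_comm, mul_div_assoc, ← Real.rpow_sub hr]
    congr 2; ring
  · simp [lineIntegrand, hmem]

theorem form_eq_lintegral_sphere [NeZero d] (p α : ℝ) (hΩ : IsOpen Ω)
    {u : EuclideanSpace ℝ (Fin d) → ℝ} (hu : Measurable u) :
    form p α Ω u = 1 / 2 * ∫⁻ ω : Metric.sphere (0 : EuclideanSpace ℝ (Fin d)) 1,
      (∫⁻ x in Ω, ∫⁻ r in Ioi (0 : ℝ), lineIntegrand p α Ω u ω x r)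
        ∂(volume : Measure (EuclideanSpace ℝ (Fin d))).toSphere := by
  have hm : Measurable fun z : EuclideanSpace ℝ (Fin d) × EuclideanSpace ℝ (Fin d) =>
      ∫⁻ r in Ioi (0 : ℝ), lineIntegrand p α Ω u z.1 z.2 r :=
    (measurable_lineIntegrand p α hΩ hu).lintegral_prod_right'
  have hm2 : Measurable fun z : Metric.sphere (0 : EuclideanSpace ℝ (Fin d)) 1 ×
      EuclideanSpace ℝ (Fin d) => ∫⁻ r in Ioi (0 : ℝ), lineIntegrand p α Ω u z.1 z.2 r :=
    hm.comp (by fun_prop : Measurable fun z : Metric.sphere (0 : EuclideanSpace ℝ (Fin d)) 1 ×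
      EuclideanSpace ℝ (Fin d) => ((z.1 : EuclideanSpace ℝ (Fin d)), z.2))
  rw [lintegral_lintegral_swap hm2.aemeasurable, form]
  congr 1
  exact lintegral_congr fun x => lintegral_kernel_eq_lintegral_sphere p α hΩ hu x

theorem lintegral_abs_coord_rpow [NeZero d] {α : ℝ} (hα : 0 < α) (i : Fin d) :
    ∫⁻ ω : Metric.sphere (0 : EuclideanSpace ℝ (Fin d)) 1, ENNReal.ofReal (|ω.1 i| ^ α)
      ∂(volume : Measure (EuclideanSpace ℝ (Fin d))).toSphere =
      ENNReal.ofReal (sphereMoment d α) := by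
  rw [← lintegral_sphere_abs_inner_rpow (n := EuclideanSpace.single i (1 : ℝ)) hα (by simp)]
  refine lintegral_congr fun ω => ?_
  rw [EuclideanSpace.inner_single_left]
  simp

/-- The reciprocal of the numerator times the denominator in the definition of `avgDist`. -/
def avgWeight (α : ℝ) (Ω : Set (EuclideanSpace ℝ (Fin d))) (x : EuclideanSpace ℝ (Fin d)) : ℝ≥0∞ :=
  (∫⁻ ω : Metric.sphere (0 : EuclideanSpace ℝ (Fin d)) 1, (dirDist Ω ω.1 x) ^ (-α)
    ∂(volume : Measure (EuclideanSpace ℝ (Fin d))).toSphere) / ENNReal.ofReal (sphereMoment d α)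

/-- The quotient in `avgDist` may be inverted in `ℝ≥0∞` because its numerator, a sphere moment, is
neither `0` nor `∞`; a vanishing denominator is thereby included. -/
theorem div_avgDist_rpow [NeZero d] {α : ℝ} (hα : 0 < α) (x : EuclideanSpace ℝ (Fin d)) (c : ℝ≥0∞) :
    c / avgDist α Ω x ^ α = c * avgWeight α Ω x := by
  have hA : ENNReal.ofReal (sphereMoment d α) ≠ 0 := by
    simpa using sphereMoment_pos (d := d) hα
  rw [avgDist, one_div, ENNReal.rpow_inv_rpow hα.ne', lintegral_abs_coord_rpow hα, avgWeight,
    div_eq_mul_inv, ENNReal.inv_div (Or.inr ENNReal.ofReal_ne_top) (Or.inr hA)]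

theorem kappa_mul_avgHardyIntegral_le [NeZero d] {p α : ℝ} (hp : 1 < p) (hα₁ : 1 < α)
    (hα₂ : α < 2) (hΩ : IsOpen Ω) {u : EuclideanSpace ℝ (Fin d) → ℝ} (hu : IsCc Ω u) :
    ENNReal.ofReal (kappa d p α) * avgHardyIntegral p α Ω u ≤ form p α Ω u := by
  have hα : 0 < α := by linarith
  have hum : Measurable u := hu.1.measurable
  have hA := sphereMoment_pos (d := d) hα
  have hA0 : ENNReal.ofReal (sphereMoment d α) ≠ 0 := by simpa using hA
  have hκ := kappaOne_nonneg hp hα₁ hα₂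
  have hm : Measurable fun z : Metric.sphere (0 : EuclideanSpace ℝ (Fin d)) 1 ×
      EuclideanSpace ℝ (Fin d) => ENNReal.ofReal (|u z.2| ^ p) * dirDist Ω z.1.1 z.2 ^ (-α) := by
    refine Measurable.mul (by fun_prop) (((measurable_dirDist_prod hΩ).comp
      (by fun_prop : Measurable fun z : Metric.sphere (0 : EuclideanSpace ℝ (Fin d)) 1 ×
        EuclideanSpace ℝ (Fin d) => (z.1.1, z.2))).pow_const _)
  have h1 : ENNReal.ofReal (sphereMoment d α) * avgHardyIntegral p α Ω u =
      ∫⁻ ω : Metric.sphere (0 : EuclideanSpace ℝ (Fin d)) 1,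
        (∫⁻ x in Ω, ENNReal.ofReal (|u x| ^ p) * dirDist Ω ω.1 x ^ (-α))
        ∂(volume : Measure (EuclideanSpace ℝ (Fin d))).toSphere := by
    rw [lintegral_lintegral_swap hm.aemeasurable, avgHardyIntegral,
      ← lintegral_const_mul' _ _ ENNReal.ofReal_ne_top]
    refine lintegral_congr fun x => ?_
    rw [div_avgDist_rpow hα, avgWeight, mul_left_comm, ENNReal.mul_div_cancel hA0
      ENNReal.ofReal_ne_top, lintegral_const_mul' _ _ ENNReal.ofReal_ne_top]
  rw [kappa_eq, form_eq_lintegral_sphere p α hΩ hum, ENNReal.ofReal_mul hκ,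
    ENNReal.ofReal_div_of_pos two_pos, ENNReal.ofReal_ofNat, div_eq_mul_inv, mul_assoc,
    mul_right_comm (ENNReal.ofReal (sphereMoment d α)), h1, one_div, mul_comm _ (2 : ℝ≥0∞)⁻¹,
    mul_left_comm]
  gcongr
  rw [← lintegral_const_mul' _ _ ENNReal.ofReal_ne_top]
  exact lintegral_mono fun ω => kappaOne_mul_lintegral_dirDist_le hp hα₁ hα₂ hΩ hu (by simp)

theorem exists_unit_inner_lt (hΩ : IsOpen Ω) (hconv : Convex ℝ Ω) (hne : Ω.Nonempty)
    {x₀ : EuclideanSpace ℝ (Fin d)} (hx₀ : x₀ ∉ Ω) :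
    ∃ n : EuclideanSpace ℝ (Fin d), ‖n‖ = 1 ∧ ∀ x ∈ Ω, 0 < inner ℝ n (x - x₀) := by
  obtain ⟨f, hf⟩ := geometric_hahn_banach_open_point hconv hΩ hx₀
  set m := (InnerProductSpace.toDual ℝ (EuclideanSpace ℝ (Fin d))).symm f with hm
  have hmf : ∀ v, inner ℝ m v = f v := fun v => InnerProductSpace.toDual_symm_apply
  have hm0 : m ≠ 0 := by
    rintro h
    obtain ⟨x, hx⟩ := hne
    have := hf x hx
    rw [← hmf, ← hmf, h] at this
    simp at this
  have hmn : 0 < ‖m‖ := norm_pos_iff.2 hm0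
  refine ⟨-(‖m‖⁻¹ • m), by rw [norm_neg, norm_smul]; simp [hm0], fun x hx => ?_⟩
  rw [inner_neg_left, real_inner_smul_left, inner_sub_right, hmf, hmf]
  have := hf x hx
  have : 0 < ‖m‖⁻¹ * (f x₀ - f x) := mul_pos (by positivity) (by linarith)
  linarith

theorem frontier_nonempty_of_ne (hne : Ω.Nonempty) (hΩ' : Ω ≠ univ) : (frontier Ω).Nonempty := by
  obtain ⟨x, hx⟩ := hne
  obtain ⟨y, hy, -⟩ := exists_mem_frontier_infDist_compl_eq_dist hx hΩ'
  exact ⟨y, hy⟩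

theorem infDist_frontier_pos (hΩ : IsOpen Ω) (hΩ' : Ω ≠ univ) {x : EuclideanSpace ℝ (Fin d)}
    (hx : x ∈ Ω) : 0 < Metric.infDist x (frontier Ω) :=
  (isClosed_frontier.notMem_iff_infDist_pos (frontier_nonempty_of_ne ⟨x, hx⟩ hΩ')).1 fun h =>
    (hΩ.frontier_eq ▸ h).2 hx

/-- Take a supporting hyperplane with normal `n` at a nearest boundary point. The line in direction
`ω` hits it at distance at most `δ / |⟨n, ω⟩|`, so `dirDist` is no larger. The resulting average of
`|⟨n, ω⟩| ^ α` does not depend on `n` and cancels the denominator of `avgWeight`. -/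
theorem rpow_infDist_le_avgWeight [NeZero d] {α : ℝ} (hα : 0 < α) (hΩ : IsOpen Ω) (hΩ' : Ω ≠ univ)
    (hconv : Convex ℝ Ω) {x : EuclideanSpace ℝ (Fin d)} (hx : x ∈ Ω) :
    ENNReal.ofReal (Metric.infDist x (frontier Ω) ^ (-α)) ≤ avgWeight α Ω x := by
  set δ := Metric.infDist x (frontier Ω) with hδ
  have hδ0 : 0 < δ := infDist_frontier_pos hΩ hΩ' hx
  obtain ⟨x₀, hx₀, hdist⟩ := isClosed_frontier.exists_infDist_eq_dist
    (frontier_nonempty_of_ne ⟨x, hx⟩ hΩ') x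
  have hx₀Ω : x₀ ∉ Ω := fun h => (hΩ.frontier_eq ▸ hx₀).2 h
  obtain ⟨n, hn, hlt⟩ := exists_unit_inner_lt hΩ hconv ⟨x, hx⟩ hx₀Ω
  have hle : inner ℝ n (x - x₀) ≤ δ := by
    rw [hδ, hdist, dist_eq_norm]
    simpa [hn] using real_inner_le_norm n (x - x₀)
  have hA := sphereMoment_pos (d := d) hα
  have hA0 : ENNReal.ofReal (sphereMoment d α) ≠ 0 := by simpa using hA
  rw [avgWeight, ENNReal.le_div_iff_mul_le (Or.inl hA0) (Or.inl ENNReal.ofReal_ne_top),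
    ← lintegral_sphere_abs_inner_rpow hα hn, ← lintegral_const_mul' _ _ ENNReal.ofReal_ne_top]
  refine lintegral_mono fun ω => ?_
  simp only
  rw [← ENNReal.ofReal_mul (by positivity)]
  rcases eq_or_ne (inner ℝ n (ω : EuclideanSpace ℝ (Fin d))) 0 with h0 | h0
  · simp [h0, Real.zero_rpow hα.ne']
  have h0' : 0 < |inner ℝ n (ω : EuclideanSpace ℝ (Fin d))| := abs_pos.2 h0
  have hmem : x + (-(inner ℝ n (x - x₀)) / inner ℝ n (ω : EuclideanSpace ℝ (Fin d))) •
      (ω : EuclideanSpace ℝ (Fin d)) ∉ Ω := by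
    intro h
    have := hlt _ h
    rw [add_sub_right_comm, inner_add_right, inner_smul_right, div_mul_cancel₀ _ h0] at this
    simp at this
  have h1 : dirDist Ω ω.1 x ≤
      ENNReal.ofReal (δ / |inner ℝ n (ω : EuclideanSpace ℝ (Fin d))|) := by
    refine (dirDist_le hmem).trans (ENNReal.ofReal_le_ofReal ?_)
    rw [abs_div, abs_neg, abs_of_pos (hlt x hx)]
    gcongr
  calc ENNReal.ofReal (δ ^ (-α) * |inner ℝ n (ω : EuclideanSpace ℝ (Fin d))| ^ α)
      = ENNReal.ofReal (δ / |inner ℝ n (ω : EuclideanSpace ℝ (Fin d))|) ^ (-α) := by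
        rw [ENNReal.ofReal_rpow_of_pos (by positivity), Real.div_rpow hδ0.le h0'.le,
          Real.rpow_neg h0'.le, div_inv_eq_mul]
    _ ≤ _ := by
        rw [ENNReal.rpow_neg, ENNReal.rpow_neg]
        exact ENNReal.inv_le_inv.2 (ENNReal.rpow_le_rpow h1 hα.le)

theorem hardyIntegral_le_avgHardyIntegral [NeZero d] {p α : ℝ} (hα : 0 < α) (hΩ : IsOpen Ω)
    (hΩ' : Ω ≠ univ) (hconv : Convex ℝ Ω) (u : EuclideanSpace ℝ (Fin d) → ℝ) :
    hardyIntegral p α Ω u ≤ avgHardyIntegral p α Ω u := by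
  refine setLIntegral_mono' hΩ.measurableSet fun x hx => ?_
  have hδ := infDist_frontier_pos hΩ hΩ' hx
  rw [div_avgDist_rpow hα, div_eq_mul_inv, ENNReal.ofReal_mul (by positivity),
    ← Real.rpow_neg hδ.le]
  gcongr
  exact rpow_infDist_le_avgWeight hα hΩ hΩ' hconv hx

end

/-! ### The energy density of the half-space profile and the error from freezing the cutoff. -/

section

open Filter Topology

/-- The Sobolev-Bregman integrand in terms of `p/2`-th powers, with `σ = 2/p`. -/
def dualBregman (σ A B : ℝ) : ℝ := (A ^ σ - B ^ σ) * (A ^ (2 - σ) - B ^ (2 - σ))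

theorem measurable_dualBregman (σ : ℝ) : Measurable fun z : ℝ × ℝ => dualBregman σ z.1 z.2 := by
  unfold dualBregman; fun_prop

theorem rpow_mul_rpow_two_sub {σ A : ℝ} (h0 : 0 < σ) (hA : 0 ≤ A) : A ^ σ * A ^ (2 - σ) = A ^ 2 := by
  rcases hA.eq_or_lt with rfl | hA
  · simp [Real.zero_rpow h0.ne']
  · rw [← Real.rpow_add hA, ← Real.rpow_two]; congr 1; ring

theorem dualBregman_eq {σ A B : ℝ} (h0 : 0 < σ) (hA : 0 ≤ A) (hB : 0 ≤ B) :
    dualBregman σ A B = A ^ 2 + B ^ 2 - A ^ σ * B ^ (2 - σ) - A ^ (2 - σ) * B ^ σ := by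
  rw [← rpow_mul_rpow_two_sub h0 hA, ← rpow_mul_rpow_two_sub h0 hB, dualBregman]; ring

/-- The two mixed terms have product `(A * B) ^ 2`, so the arithmetic-geometric mean inequality
applies. -/
theorem dualBregman_le_sq {σ A B : ℝ} (h0 : 0 < σ) (hA : 0 ≤ A) (hB : 0 ≤ B) :
    dualBregman σ A B ≤ (A - B) ^ 2 := by
  rw [dualBregman_eq h0 hA hB]
  have e : A ^ σ * B ^ (2 - σ) * (A ^ (2 - σ) * B ^ σ) = (A * B) ^ 2 := by
    rw [mul_pow, ← rpow_mul_rpow_two_sub h0 hA, ← rpow_mul_rpow_two_sub h0 hB]; ring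
  have h1 : 0 ≤ A ^ σ * B ^ (2 - σ) := by positivity
  have h2 : 0 ≤ A ^ (2 - σ) * B ^ σ := by positivity
  have h3 : 2 * (A * B) ≤ A ^ σ * B ^ (2 - σ) + A ^ (2 - σ) * B ^ σ := by
    refine (pow_le_pow_iff_left₀ (by positivity) (by positivity) two_ne_zero).1 ?_
    nlinarith [sq_nonneg (A ^ σ * B ^ (2 - σ) - A ^ (2 - σ) * B ^ σ)]
  nlinarith

theorem dualBregman_nonneg {σ A B : ℝ} (h0 : 0 < σ) (h2 : σ < 2) (hA : 0 ≤ A) (hB : 0 ≤ B) :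
    0 ≤ dualBregman σ A B := by
  unfold dualBregman
  rcases le_total A B with h | h
  · have h3 := Real.rpow_le_rpow hA h h0.le
    have h4 := Real.rpow_le_rpow hA h (show 0 ≤ 2 - σ by linarith)
    exact mul_nonneg_of_nonpos_of_nonpos (by linarith) (by linarith)
  · have h3 := Real.rpow_le_rpow hB h h0.le
    have h4 := Real.rpow_le_rpow hB h (show 0 ≤ 2 - σ by linarith)
    exact mul_nonneg (by linarith) (by linarith)

/-- Homogeneity of degree 2 for every `p` is the gain from passing to `p/2`-th powers. -/
theorem dualBregman_mul {σ c A B : ℝ} (h0 : 0 < σ) (hc : 0 ≤ c) (hA : 0 ≤ A) (hB : 0 ≤ B) :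
    dualBregman σ (c * A) (c * B) = c ^ 2 * dualBregman σ A B := by
  rw [← rpow_mul_rpow_two_sub h0 hc, dualBregman, dualBregman, Real.mul_rpow hc hA,
    Real.mul_rpow hc hB, Real.mul_rpow hc hA, Real.mul_rpow hc hB]
  ring

theorem signedPow_rpow {p A : ℝ} (hp : 1 < p) (hA : 0 ≤ A) :
    signedPow (A ^ (2 / p)) (p - 1) = A ^ (2 - 2 / p) := by
  have hp0 : 0 < p := by linarith
  rcases hA.eq_or_lt with rfl | hA
  · have : 2 - 2 / p ≠ 0 := by
      have : 2 / p < 2 := by rw [div_lt_iff₀ hp0]; linarith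
      linarith
    rw [Real.zero_rpow this, Real.zero_rpow (by positivity)]
    simp [signedPow]
  · have h : 0 < A ^ (2 / p) := by positivity
    rw [signedPow, Real.sign_of_pos h, mul_one, abs_of_pos h, ← Real.rpow_mul hA.le]
    congr 1; field_simp

theorem bregman_rpow_eq {p A B : ℝ} (hp : 1 < p) (hA : 0 ≤ A) (hB : 0 ≤ B) :
    bregman p (A ^ (2 / p)) (B ^ (2 / p)) = dualBregman (2 / p) A B := by
  rw [bregman, signedPow_rpow hp hA, signedPow_rpow hp hB, dualBregman]

theorem sq_sub_le_rpow_mul_rpow {σ a b δ : ℝ} (h0 : 0 < σ) (h2 : σ < 2) (ha : 0 ≤ a) (ha1 : a ≤ 1)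
    (hb : 0 ≤ b) (hδ : |a - b| ≤ δ) : a ^ 2 - 2 * δ ≤ a ^ σ * b ^ (2 - σ) := by
  have hδ0 : 0 ≤ δ := (abs_nonneg _).trans hδ
  have hab := abs_le.1 hδ
  set m := min a b with hm
  have hm0 : 0 ≤ m := le_min ha hb
  have h1 : m ^ 2 ≤ a ^ σ * b ^ (2 - σ) := by
    rw [← rpow_mul_rpow_two_sub h0 hm0]
    have := Real.rpow_le_rpow hm0 (min_le_left a b) h0.le
    have := Real.rpow_le_rpow hm0 (min_le_right a b) (show 0 ≤ 2 - σ by linarith)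
    gcongr
  have h3 : a - δ ≤ m := le_min (by linarith) (by linarith)
  refine le_trans ?_ h1
  rcases le_total δ a with h | h
  · nlinarith [pow_le_pow_left₀ (sub_nonneg.2 h) h3 2]
  · nlinarith

/-- Replaces the second cutoff value by the first. The cost is linear in `δ`: enough for a pointwise
limit as `δ → 0`, not for integrability at the diagonal. -/
theorem dualBregman_mul_le {σ a b δ τ : ℝ} (h0 : 0 < σ) (h2 : σ < 2) (ha : 0 ≤ a) (ha1 : a ≤ 1)
    (hb : 0 ≤ b) (hb1 : b ≤ 1) (hτ : 0 ≤ τ) (hδ : |a - b| ≤ δ) :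
    dualBregman σ a (τ * b) ≤ a ^ 2 * dualBregman σ 1 τ + 6 * δ * (1 + τ ^ 2) := by
  have hδ0 : 0 ≤ δ := (abs_nonneg _).trans hδ
  have hab := abs_le.1 hδ
  have h1 := sq_sub_le_rpow_mul_rpow h0 h2 ha ha1 hb hδ
  have h3 := sq_sub_le_rpow_mul_rpow (σ := 2 - σ) (by linarith) (by linarith) ha ha1 hb hδ
  rw [show 2 - (2 - σ) = σ by ring] at h3
  have h4 : b ^ 2 ≤ a ^ 2 + 2 * δ := by nlinarith
  have hpow : ∀ s : ℝ, 0 < s → s < 2 → τ ^ s ≤ 1 + τ ^ 2 := by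
    intro s hs0 hs2
    rcases le_total τ 1 with h | h
    · have := Real.rpow_le_one hτ h hs0.le
      nlinarith
    · have := Real.rpow_le_rpow_of_exponent_le h hs2.le
      rw [Real.rpow_two] at this
      linarith
  have h5 := hpow σ h0 h2
  have h6 := hpow (2 - σ) (by linarith) (by linarith)
  rw [dualBregman_eq h0 ha (by positivity), dualBregman_eq h0 zero_le_one hτ, Real.one_rpow,
    Real.one_rpow, Real.mul_rpow hτ hb, Real.mul_rpow hτ hb]
  have q1 : 0 ≤ τ ^ σ := by positivity
  have q2 : 0 ≤ τ ^ (2 - σ) := by positivity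
  nlinarith [mul_le_mul_of_nonneg_left h1 q2, mul_le_mul_of_nonneg_left h3 q1,
    mul_le_mul_of_nonneg_left h4 (sq_nonneg τ), mul_le_mul_of_nonneg_left h5 hδ0,
    mul_le_mul_of_nonneg_left h6 hδ0]

/-- The error made when the cutoff is frozen; `δ` bounds the oscillation of the cutoff. -/
def cutoffError (δ τ : ℝ) : ℝ :=
  min (7 * δ * (1 + τ ^ 2)) (2 * (min 1 δ + |1 - τ|) ^ 2)

theorem cutoffError_nonneg {δ τ : ℝ} (hδ : 0 ≤ δ) : 0 ≤ cutoffError δ τ :=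
  le_min (by positivity) (by positivity)

theorem cutoffError_mono {δ δ' τ : ℝ} (hδ : 0 ≤ δ) (h : δ ≤ δ') :
    cutoffError δ τ ≤ cutoffError δ' τ := by
  unfold cutoffError; gcongr

/-- Of the two bounds in `cutoffError`, the first vanishes with `δ` and the second is quadratic near
the diagonal, hence integrable. The weight `2` belongs to points outside the support of the cutoff,
whose pairs count twice once the double integral is folded onto the support. -/
theorem weight_mul_dualBregman_le {σ a b δ τ w : ℝ} (h0 : 0 < σ) (h2 : σ < 2) (ha : 0 ≤ a)
    (ha1 : a ≤ 1) (hb : 0 ≤ b) (hb1 : b ≤ 1) (hτ : 0 ≤ τ) (hδ : |a - b| ≤ δ)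
    (hw : w = 1 ∨ w = 2 ∧ b = 0) :
    w * dualBregman σ a (τ * b) ≤ a ^ 2 * dualBregman σ 1 τ + cutoffError δ τ := by
  have hδ0 : 0 ≤ δ := (abs_nonneg _).trans hδ
  have hd := dualBregman_nonneg (A := 1) (B := τ) h0 h2 zero_le_one hτ
  have hd' := dualBregman_nonneg (A := a) (B := τ * b) h0 h2 ha (by positivity)
  have hw2 : w ≤ 2 := by rcases hw with h | ⟨h, -⟩ <;> linarith
  rw [cutoffError, ← min_add_add_left]
  refine le_min ?_ ?_
  · have h3 := dualBregman_mul_le h0 h2 ha ha1 hb hb1 hτ hδ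
    rcases hw with rfl | ⟨rfl, rfl⟩
    · have : 0 ≤ δ * (1 + τ ^ 2) := by positivity
      linarith
    · have h4 : dualBregman σ a (τ * 0) ≤ δ := by
        refine (dualBregman_le_sq h0 ha (by simp)).trans ?_
        rw [sub_zero, abs_of_nonneg ha] at hδ
        nlinarith
      nlinarith [mul_nonneg hδ0 (sq_nonneg τ)]
  · have h3 := dualBregman_le_sq (A := a) (B := τ * b) h0 ha (by positivity)
    have h4 : |a - b| ≤ min 1 δ := le_min (abs_le.2 ⟨by linarith, by linarith⟩) hδ
    have h5 : |a - τ * b| ≤ min 1 δ + |1 - τ| := by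
      have e : a - τ * b = (a - b) + b * (1 - τ) := by ring
      rw [e]
      refine (abs_add_le _ _).trans (add_le_add h4 ?_)
      rw [abs_mul, abs_of_nonneg hb]
      exact mul_le_of_le_one_left (abs_nonneg _) hb1
    have h6 : (a - τ * b) ^ 2 ≤ (min 1 δ + |1 - τ|) ^ 2 := by
      rw [← sq_abs]; gcongr
    have h7 : w * dualBregman σ a (τ * b) ≤ 2 * dualBregman σ a (τ * b) := by gcongr
    have h8 : 0 ≤ a ^ 2 * dualBregman σ 1 τ := by positivity
    linarith

theorem abs_one_sub_rpow_le {t g : ℝ} (ht : 0 < t) (hg0 : 0 ≤ g) (hg1 : g ≤ 1) :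
    |1 - t ^ g| ≤ |1 - t| := by
  rcases le_total t 1 with h | h
  · have h1 := Real.rpow_le_rpow_of_exponent_ge ht h hg1
    have h2 := Real.rpow_le_one ht.le h hg0
    rw [Real.rpow_one] at h1
    rw [abs_of_nonneg (by linarith), abs_of_nonneg (by linarith)]
    linarith
  · have h1 := Real.rpow_le_rpow_of_exponent_le h hg1
    have h2 := Real.one_le_rpow h hg0
    rw [Real.rpow_one] at h1
    rw [abs_of_nonpos (by linarith), abs_of_nonpos (by linarith)]
    linarith

/-- For `t ≥ 1/2` the logarithm is at most `2 * r` in absolute value; for smaller `t` one has `r ≥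
1/2`, and the bound `1` suffices. -/
theorem min_one_add_abs_log_le {t r : ℝ} (ht : 0 < t) (hr : |1 - t| ≤ r) :
    min 1 (r + |Real.log t|) ≤ 3 * r := by
  rcases le_total t (1 / 2) with h | h
  · refine (min_le_left _ _).trans ?_
    have := (le_abs_self (1 - t)).trans hr
    linarith
  · refine (min_le_right _ _).trans ?_
    have h1 := Real.log_le_sub_one_of_pos ht
    have h2 := Real.one_sub_inv_le_log_of_pos ht
    have h3 : -(2 * r) ≤ 1 - t⁻¹ := by
      have h4 : 1 - t⁻¹ = -(1 - t) * t⁻¹ := by field_simp; ring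
      have h5 : t⁻¹ ≤ 2 := by
        rw [inv_le_comm₀ ht two_pos]; linarith
      have h6 : 0 < t⁻¹ := inv_pos.2 ht
      have h7 := (le_abs_self (1 - t)).trans hr
      have h8 : 0 ≤ r := (abs_nonneg _).trans hr
      rw [h4]
      nlinarith
    have h9 := (neg_abs_le (1 - t))
    have : |Real.log t| ≤ 2 * r := abs_le.2 ⟨by linarith, by
      have := (abs_nonneg (1 - t)).trans hr
      linarith⟩
    linarith

/-- The radial majorant of the error kernel. -/
def majorant (α : ℝ) (r : ℝ) : ℝ := if r ≤ 1 then 32 * r ^ (2 : ℝ) else 32 * r ^ (α - 1)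

theorem cutoffError_le_majorant {α t r : ℝ} (hα₁ : 1 < α) (hα₂ : α < 2) (ht : 0 < t)
    (hr : |1 - t| ≤ r) :
    cutoffError (r + |Real.log t|) (t ^ ((α - 1) / 2)) ≤ majorant α r := by
  have hr0 : 0 ≤ r := (abs_nonneg _).trans hr
  refine (min_le_right _ _).trans ?_
  have hg0 : 0 ≤ (α - 1) / 2 := by linarith
  have h0 : 0 ≤ min 1 (r + |Real.log t|) := by positivity
  unfold majorant
  split_ifs with h
  · have h1 := abs_one_sub_rpow_le ht hg0 (by linarith)
    have h2 := min_one_add_abs_log_le ht hr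
    calc 2 * (min 1 (r + |Real.log t|) + |1 - t ^ ((α - 1) / 2)|) ^ 2
        ≤ 2 * (3 * r + r) ^ 2 := by
          have := h1.trans hr
          gcongr
      _ = 32 * r ^ (2 : ℝ) := by rw [Real.rpow_two]; ring
  · have h : 1 < r := not_le.1 h
    have ht2 : t ≤ 2 * r := by have := neg_abs_le (1 - t); linarith
    have h1 : t ^ ((α - 1) / 2) ≤ (2 * r) ^ ((α - 1) / 2) := Real.rpow_le_rpow ht.le ht2 hg0
    have h2 : 1 ≤ (2 * r) ^ ((α - 1) / 2) := Real.one_le_rpow (by linarith) hg0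
    have h3 : 0 ≤ t ^ ((α - 1) / 2) := by positivity
    have h4 : |1 - t ^ ((α - 1) / 2)| ≤ (2 * r) ^ ((α - 1) / 2) :=
      abs_le.2 ⟨by linarith, by linarith⟩
    have h5 : (2 * r) ^ (α - 1) ≤ 4 * r ^ (α - 1) := by
      rw [Real.mul_rpow two_pos.le hr0]
      have : (2 : ℝ) ^ (α - 1) ≤ 2 ^ (1 : ℝ) :=
        Real.rpow_le_rpow_of_exponent_le one_le_two (by linarith)
      rw [Real.rpow_one] at this
      have : 0 ≤ r ^ (α - 1) := by positivity
      nlinarith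
    calc 2 * (min 1 (r + |Real.log t|) + |1 - t ^ ((α - 1) / 2)|) ^ 2
        ≤ 2 * ((2 * r) ^ ((α - 1) / 2) + (2 * r) ^ ((α - 1) / 2)) ^ 2 := by
          have := (min_le_left 1 (r + |Real.log t|)).trans h2
          gcongr
      _ = 8 * (2 * r) ^ (α - 1) := by
          have : (2 * r) ^ (α - 1) = ((2 * r) ^ ((α - 1) / 2)) ^ 2 := by
            rw [← Real.rpow_mul_natCast (by positivity)]; congr 1; push_cast; ring
          rw [this]; ring
      _ ≤ 32 * r ^ (α - 1) := by linarith

/-- Radially the integrand is a multiple of `r ^ (1 - α)` near `0`, integrable as `α < 2`, and of `r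
^ (-2)` at infinity. -/
theorem integrable_majorant {d : ℕ} [NeZero d] {α : ℝ} (hα₁ : 1 < α) (hα₂ : α < 2) :
    Integrable fun ζ : EuclideanSpace ℝ (Fin d) => majorant α ‖ζ‖ * ‖ζ‖ ^ (-(d + α)) := by
  have := nontrivial_euclideanSpace (d := d)
  have hd : 1 ≤ d := Nat.one_le_iff_ne_zero.2 (NeZero.ne d)
  rw [integrable_fun_norm_addHaar volume (f := fun r => majorant α r * r ^ (-(d + α))),
    ← Ioc_union_Ioi_eq_Ioi zero_le_one]
  have e : ∀ y : ℝ, 0 < y → ∀ s : ℝ, y ^ (Module.finrank ℝ (EuclideanSpace ℝ (Fin d)) - 1) •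
      (32 * y ^ s * y ^ (-(d + α))) = 32 * y ^ (s - 1 - α) := by
    intro y hy s
    rw [finrank_euclideanSpace_fin, smul_eq_mul, ← Real.rpow_natCast, Nat.cast_sub hd, Nat.cast_one,
      mul_assoc, mul_left_comm, ← Real.rpow_add hy, ← Real.rpow_add hy]
    congr 2; ring
  refine IntegrableOn.union ?_ ?_
  · have h1 : IntegrableOn (fun y : ℝ => 32 * y ^ (1 - α)) (Ioc 0 1) :=
      ((intervalIntegrable_iff_integrableOn_Ioc_of_le zero_le_one).1
        (intervalIntegral.intervalIntegrable_rpow' (by linarith))).const_mul 32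
    refine h1.congr_fun (fun y hy => ?_) measurableSet_Ioc
    simp only [majorant, if_pos hy.2]
    rw [e y hy.1]
    congr 2; ring
  · have h1 : IntegrableOn (fun y : ℝ => 32 * y ^ (-2 : ℝ)) (Ioi 1) :=
      (integrableOn_Ioi_rpow_of_lt (by norm_num) one_pos).const_mul 32
    refine h1.congr_fun (fun y hy => ?_) measurableSet_Ioi
    have hy : 1 < y := hy
    simp only [majorant, if_neg hy.not_ge]
    rw [e y (by linarith)]
    congr 2; ring

variable {d : ℕ}

/-- The total error for the cutoff oscillation parameter `ε`. -/
def totalError (α : ℝ) (n : EuclideanSpace ℝ (Fin d)) (ε : ℝ) : ℝ≥0∞ :=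
  ∫⁻ ζ in {ζ : EuclideanSpace ℝ (Fin d) | 0 < 1 + inner ℝ n ζ},
    ENNReal.ofReal (cutoffError (ε * (‖ζ‖ + |Real.log (1 + inner ℝ n ζ)|))
      ((1 + inner ℝ n ζ) ^ ((α - 1) / 2)) * ‖ζ‖ ^ (-(d + α)))

/-- Dominated convergence: the quadratic bound in `cutoffError` supplies the majorant, uniformly for
`ε ≤ 1`, and the linear bound the pointwise limit. -/
theorem tendsto_totalError [NeZero d] {α : ℝ} (hα₁ : 1 < α) (hα₂ : α < 2)
    {n : EuclideanSpace ℝ (Fin d)} (hn : ‖n‖ = 1) {ε : ℕ → ℝ} (hε0 : ∀ k, 0 ≤ ε k)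
    (hε1 : ∀ k, ε k ≤ 1) (hε : Tendsto ε atTop (𝓝 0)) :
    Tendsto (fun k => totalError α n (ε k)) atTop (𝓝 0) := by
  have hm : MeasurableSet {ζ : EuclideanSpace ℝ (Fin d) | 0 < 1 + inner ℝ n ζ} :=
    measurableSet_lt measurable_const (by fun_prop)
  have h := tendsto_lintegral_of_dominated_convergence
    (μ := volume.restrict {ζ : EuclideanSpace ℝ (Fin d) | 0 < 1 + inner ℝ n ζ})
    (F := fun k ζ => ENNReal.ofReal (cutoffError (ε k * (‖ζ‖ + |Real.log (1 + inner ℝ n ζ)|))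
      ((1 + inner ℝ n ζ) ^ ((α - 1) / 2)) * ‖ζ‖ ^ (-(d + α))))
    (f := fun _ => 0) (fun ζ => ENNReal.ofReal (majorant α ‖ζ‖ * ‖ζ‖ ^ (-(d + α))))
    (fun k => by unfold cutoffError; fun_prop) (fun k => ?_) ?_ ?_
  · simpa [totalError] using h
  · refine ae_restrict_of_forall_mem hm fun ζ hζ => ENNReal.ofReal_le_ofReal ?_
    have h1 : |1 - (1 + inner ℝ n ζ)| ≤ ‖ζ‖ := by
      rw [sub_add_cancel_left, abs_neg]
      simpa [hn] using abs_real_inner_le_norm n ζ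
    have h2 := cutoffError_le_majorant hα₁ hα₂ hζ h1
    have h3 : 0 ≤ ‖ζ‖ + |Real.log (1 + inner ℝ n ζ)| := by positivity
    have h4 := cutoffError_mono (τ := (1 + inner ℝ n ζ) ^ ((α - 1) / 2)) (mul_nonneg (hε0 k) h3)
      (mul_le_of_le_one_left h3 (hε1 k))
    have := h4.trans h2
    gcongr
  · exact ((setLIntegral_le_lintegral _ _).trans_lt
      (integrable_majorant hα₁ hα₂).lintegral_lt_top).ne
  · refine ae_restrict_of_forall_mem hm fun ζ hζ => ?_
    rw [← ENNReal.ofReal_zero]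
    refine ENNReal.tendsto_ofReal ?_
    set A := ‖ζ‖ + |Real.log (1 + inner ℝ n ζ)|
    set τ := (1 + inner ℝ n ζ) ^ ((α - 1) / 2)
    have h1 : Tendsto (fun k => 7 * (ε k * A) * (1 + τ ^ 2) * ‖ζ‖ ^ (-(d + α))) atTop (𝓝 0) := by
      have := (((hε.mul_const A).const_mul 7).mul_const (1 + τ ^ 2)).mul_const (‖ζ‖ ^ (-(d + α)))
      simpa using this
    have hA : 0 ≤ A := by positivity
    refine squeeze_zero (fun k => mul_nonneg (cutoffError_nonneg (mul_nonneg (hε0 k) hA))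
      (by positivity)) (fun k => ?_) h1
    exact mul_le_mul_of_nonneg_right (min_le_left _ _) (by positivity)

/-- The substitution `t = 1 + r * c` maps the ray to `(0, 1)` or `(1, ∞)` according to the sign of
`c`, and `t ↦ t⁻¹` exchanges the two, so both signs give `kappaOne`. -/
theorem lintegral_dualBregman_line {p α c : ℝ} (hp : 1 < p) (hα₁ : 1 < α) (hα₂ : α < 2) :
    ∫⁻ r in Ioi (0 : ℝ), {r : ℝ | 0 < 1 + r * c}.indicator (fun r => ENNReal.ofReal
      (dualBregman (2 / p) 1 ((1 + r * c) ^ ((α - 1) / 2)) * r ^ (-1 - α))) r =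
    ENNReal.ofReal (|c| ^ α) * ENNReal.ofReal (kappaOne p α) := by
  have hp0 : 0 < p := by linarith
  rcases eq_or_ne c 0 with rfl | hc
  · simp [dualBregman, Real.zero_rpow (show α ≠ 0 by linarith)]
  set b := (α - 1) / p with hb
  have hc0 : 0 < |c| := abs_pos.2 hc
  set e : ℝ := (SignType.sign c : ℝ) with he
  have hec : e * |c| = c := by rw [he]; exact sign_mul_abs c
  have hee : |e| = 1 := by
    have := congrArg abs hec
    rw [abs_mul, abs_abs] at this
    exact mul_right_cancel₀ hc0.ne' (this.trans (one_mul _).symm)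
  have hee2 : e * e = 1 := by rw [← abs_mul_abs_self, hee, one_mul]
  have hD : ∀ t : ℝ, 0 < t → dualBregman (2 / p) 1 (t ^ ((α - 1) / 2)) =
      (1 - t ^ b) * (1 - t ^ (α - 1 - b)) := by
    intro t ht
    have e1 : (α - 1) / 2 * (2 / p) = b := by rw [hb]; field_simp
    have e2 : (α - 1) / 2 * (2 - 2 / p) = α - 1 - b := by rw [hb]; field_simp
    rw [dualBregman, Real.one_rpow, Real.one_rpow, ← Real.rpow_mul ht.le, ← Real.rpow_mul ht.le,
      e1, e2]
  set k : ℝ → ℝ≥0∞ := fun t =>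
    ENNReal.ofReal ((1 - t ^ b) * (1 - t ^ (α - 1 - b)) * |1 - t| ^ (-1 - α)) with hk
  have hkm : Measurable k := by fun_prop
  have h1 : ∫⁻ t in Ioo (0 : ℝ) 1, k t = ENNReal.ofReal (kappaOne p α) := by
    rw [ofReal_kappaOne_eq_lintegral hp hα₁ hα₂]
    refine setLIntegral_congr_fun measurableSet_Ioo fun t ht => ?_
    simp only [hk, hardyKernel, abs_of_pos (show 0 < 1 - t by linarith [ht.2]), hb]
  have h2 : ∫⁻ t in Ioi (1 : ℝ), k t = ENNReal.ofReal (kappaOne p α) := by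
    have := setLIntegral_Ioi_inv one_pos k
    rw [inv_one] at this
    rw [this, ← h1]
    refine setLIntegral_congr_fun measurableSet_Ioo fun t ht => ?_
    have ht0 := ht.1
    have ht1 : 0 < 1 - t := by linarith [ht.2]
    simp only [hk]
    rw [← ENNReal.ofReal_mul (by positivity)]
    congr 1
    rw [mul_left_comm, abs_one_sub_inv_rpow ht, abs_of_pos ht1, Real.inv_rpow ht0.le,
      Real.inv_rpow ht0.le, Real.rpow_sub ht0 (α - 1) b]
    have : t ^ b ≠ 0 := (Real.rpow_pos_of_pos ht0 b).ne'
    have : t ^ (α - 1) ≠ 0 := (Real.rpow_pos_of_pos ht0 _).ne'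
    field_simp
    ring
  have h3 : ∫⁻ t in {t : ℝ | 0 < e * (t - 1) ∧ 0 < t}, k t = ENNReal.ofReal (kappaOne p α) := by
    rcases eq_or_eq_neg_of_abs_eq hee with h | h
    · rw [← h2]
      congr 2
      ext t; simp only [h, mem_ofPred_eq, mem_Ioi]
      constructor
      · rintro ⟨h, -⟩; linarith
      · intro h; constructor <;> linarith
    · rw [← h1]
      congr 2
      ext t; simp only [h, mem_ofPred_eq, mem_Ioo]
      constructor
      · rintro ⟨h, h'⟩; constructor <;> linarith
      · rintro ⟨h, h'⟩; constructor <;> linarith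
  rw [← h3, ← lintegral_indicator measurableSet_Ioi,
    lintegral_eq_lintegral_comp_affine (inv_pos.2 hc0) hee]
  have hmS : MeasurableSet {t : ℝ | 0 < e * (t - 1) ∧ 0 < t} := by
    have h1 : MeasurableSet {t : ℝ | 0 < e * (t - 1)} :=
      measurableSet_lt measurable_const (by fun_prop)
    exact h1.inter measurableSet_Ioi
  rw [← lintegral_indicator hmS, ← lintegral_const_mul' _ _ ENNReal.ofReal_ne_top,
    ← lintegral_const_mul' _ _ ENNReal.ofReal_ne_top]
  refine lintegral_congr fun t => ?_
  have e1 : 1 + e * |c|⁻¹ * (t - 1) * c = t := by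
    have : e * |c|⁻¹ * (t - 1) * c = (e * e) * (|c|⁻¹ * |c|) * (t - 1) := by
      nth_rewrite 2 [← hec]; ring
    rw [this, hee2, inv_mul_cancel₀ hc0.ne']; ring
  by_cases ht : 0 < e * (t - 1)
  · have e2 : 0 < e * |c|⁻¹ * (t - 1) := by
      have : e * |c|⁻¹ * (t - 1) = |c|⁻¹ * (e * (t - 1)) := by ring
      rw [this]; positivity
    by_cases ht0 : 0 < t
    · rw [indicator_of_mem (show e * |c|⁻¹ * (t - 1) ∈ Ioi 0 from e2),
        indicator_of_mem (show e * |c|⁻¹ * (t - 1) ∈ {r : ℝ | 0 < 1 + r * c} by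
          simpa [e1] using ht0),
        indicator_of_mem (show t ∈ {t : ℝ | 0 < e * (t - 1) ∧ 0 < t} from ⟨ht, ht0⟩), e1, hD t ht0,
        hk]
      have e3 : e * |c|⁻¹ * (t - 1) = |c|⁻¹ * |1 - t| := by
        rw [← abs_of_pos e2, abs_mul, abs_mul, hee, one_mul, abs_sub_comm t, abs_inv, abs_abs]
      rw [e3, Real.mul_rpow (by positivity) (abs_nonneg _), ← ENNReal.ofReal_mul (by positivity),
        ← ENNReal.ofReal_mul (by positivity)]
      congr 1
      have e4 : |c|⁻¹ * |c|⁻¹ ^ (-1 - α) = |c| ^ α := by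
        rw [mul_comm, ← Real.rpow_add_one (by positivity), show -1 - α + 1 = -α by ring,
          Real.inv_rpow (by positivity), Real.rpow_neg (by positivity), inv_inv]
      rw [← e4]; ring
    · rw [indicator_of_mem (show e * |c|⁻¹ * (t - 1) ∈ Ioi 0 from e2),
        indicator_of_notMem (show e * |c|⁻¹ * (t - 1) ∉ {r : ℝ | 0 < 1 + r * c} by
          simpa [e1] using ht0),
        indicator_of_notMem (show t ∉ {t : ℝ | 0 < e * (t - 1) ∧ 0 < t} from fun h => ht0 h.2)]
      simp
  · have e2 : ¬ 0 < e * |c|⁻¹ * (t - 1) := by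
      have : e * |c|⁻¹ * (t - 1) = |c|⁻¹ * (e * (t - 1)) := by ring
      rw [this, not_lt]
      exact mul_nonpos_of_nonneg_of_nonpos (by positivity) (not_lt.1 ht)
    rw [indicator_of_notMem (show e * |c|⁻¹ * (t - 1) ∉ Ioi 0 from e2),
      indicator_of_notMem (show t ∉ {t : ℝ | 0 < e * (t - 1) ∧ 0 < t} from fun h => ht h.1)]
    simp

/-- The energy density of the half-space ground state at height one: the ray integrals with `c = ⟨n,
ω⟩`, summed over `ω`. -/
theorem lintegral_dualBregman_halfSpace [NeZero d] {p α : ℝ} (hp : 1 < p) (hα₁ : 1 < α)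
    (hα₂ : α < 2) {n : EuclideanSpace ℝ (Fin d)} (hn : ‖n‖ = 1) :
    ∫⁻ ζ in {ζ : EuclideanSpace ℝ (Fin d) | 0 < 1 + inner ℝ n ζ},
      ENNReal.ofReal (dualBregman (2 / p) 1 ((1 + inner ℝ n ζ) ^ ((α - 1) / 2)) *
        ‖ζ‖ ^ (-(d + α))) = 2 * ENNReal.ofReal (kappa d p α) := by
  have := nontrivial_euclideanSpace (d := d)
  have hd : 1 ≤ d := Nat.one_le_iff_ne_zero.2 (NeZero.ne d)
  have hbm := measurable_dualBregman (2 / p)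
  have hm : MeasurableSet {ζ : EuclideanSpace ℝ (Fin d) | 0 < 1 + inner ℝ n ζ} :=
    measurableSet_lt measurable_const (by fun_prop)
  have hf : Measurable fun ζ : EuclideanSpace ℝ (Fin d) =>
      ENNReal.ofReal (dualBregman (2 / p) 1 ((1 + inner ℝ n ζ) ^ ((α - 1) / 2)) *
        ‖ζ‖ ^ (-(d + α))) :=
    ENNReal.measurable_ofReal.comp
      ((hbm.comp (measurable_const.prodMk (by fun_prop))).mul (by fun_prop))
  rw [← lintegral_indicator hm, lintegral_eq_lintegral_sphere_lintegral_Ioi volume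
    (hf.indicator hm)]
  have key : ∀ ω : Metric.sphere (0 : EuclideanSpace ℝ (Fin d)) 1,
      ∫⁻ r in Ioi (0 : ℝ), ENNReal.ofReal
        (r ^ (Module.finrank ℝ (EuclideanSpace ℝ (Fin d)) - 1)) *
        {ζ : EuclideanSpace ℝ (Fin d) | 0 < 1 + inner ℝ n ζ}.indicator (fun ζ =>
        ENNReal.ofReal (dualBregman (2 / p) 1 ((1 + inner ℝ n ζ) ^ ((α - 1) / 2)) *
        ‖ζ‖ ^ (-(d + α)))) (r • (ω : EuclideanSpace ℝ (Fin d))) =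
      ENNReal.ofReal (|inner ℝ n (ω : EuclideanSpace ℝ (Fin d))| ^ α) *
        ENNReal.ofReal (kappaOne p α) := by
    intro ω
    rw [← lintegral_dualBregman_line hp hα₁ hα₂]
    refine setLIntegral_congr_fun measurableSet_Ioi fun r hr => ?_
    have hr : 0 < r := hr
    have hω : ‖(ω : EuclideanSpace ℝ (Fin d))‖ = 1 := by simp
    simp only [indicator_apply, mem_ofPred_eq, inner_smul_right, norm_smul, hω, mul_one,
      Real.norm_of_nonneg hr.le]
    split_ifs with h
    · rw [← ENNReal.ofReal_mul (by positivity)]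
      congr 1
      rw [finrank_euclideanSpace_fin, ← Real.rpow_natCast, Nat.cast_sub hd, Nat.cast_one,
        mul_left_comm, ← Real.rpow_add hr]
      congr 2; ring
    · simp
  simp_rw [key]
  rw [lintegral_mul_const _ (by fun_prop), lintegral_sphere_abs_inner_rpow (by linarith) hn,
    kappa_eq, ← ENNReal.ofReal_ofNat 2, ← ENNReal.ofReal_mul zero_le_two,
    ← ENNReal.ofReal_mul (sphereMoment_pos (by linarith)).le]
  congr 1; ring

end

/-! ### Test functions concentrated near a supporting hyperplane. -/

section

open Filter Topology
open scoped Pointwise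

variable {d : ℕ}

/-- The signed distance of `x` to the hyperplane through `x₀` with unit normal `n`. -/
def height (n x₀ x : EuclideanSpace ℝ (Fin d)) : ℝ := inner ℝ n (x - x₀)

/-- The component of `x - x₀` orthogonal to `n`. -/
def tangent (n x₀ x : EuclideanSpace ℝ (Fin d)) : EuclideanSpace ℝ (Fin d) :=
  (x - x₀) - height n x₀ x • n

theorem continuous_height (n x₀ : EuclideanSpace ℝ (Fin d)) : Continuous (height n x₀) := by
  unfold height; fun_prop

theorem continuous_tangent (n x₀ : EuclideanSpace ℝ (Fin d)) : Continuous (tangent n x₀) := by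
  have := continuous_height n x₀
  unfold tangent; fun_prop

theorem height_add (n x₀ x z : EuclideanSpace ℝ (Fin d)) :
    height n x₀ (x + z) = height n x₀ x + inner ℝ n z := by
  rw [height, add_sub_right_comm, inner_add_right, height]

theorem tangent_add (n x₀ x z : EuclideanSpace ℝ (Fin d)) :
    tangent n x₀ (x + z) = tangent n x₀ x + (z - inner ℝ n z • n) := by
  rw [tangent, height_add, tangent, add_smul]; abel

theorem inner_tangent {n : EuclideanSpace ℝ (Fin d)} (hn : ‖n‖ = 1)
    (x₀ x : EuclideanSpace ℝ (Fin d)) : inner ℝ n (tangent n x₀ x) = 0 := by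
  rw [tangent, inner_sub_right, inner_smul_right, real_inner_self_eq_norm_sq, hn, height]; ring

theorem norm_sq_tangent_add {n : EuclideanSpace ℝ (Fin d)} (hn : ‖n‖ = 1)
    (x₀ x : EuclideanSpace ℝ (Fin d)) (a : ℝ) :
    ‖tangent n x₀ x + a • n‖ ^ 2 = ‖tangent n x₀ x‖ ^ 2 + a ^ 2 := by
  rw [norm_add_sq_real, inner_smul_right, real_inner_comm, inner_tangent hn, norm_smul, hn,
    Real.norm_eq_abs, mul_one, sq_abs]
  ring

theorem norm_sub_inner_smul_le {n : EuclideanSpace ℝ (Fin d)} (hn : ‖n‖ = 1)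
    (z : EuclideanSpace ℝ (Fin d)) : ‖z - inner ℝ n z • n‖ ≤ ‖z‖ := by
  have h := norm_sq_tangent_add hn 0 z (inner ℝ n z)
  simp only [tangent, height, sub_zero, sub_add_cancel] at h
  refine le_of_sq_le_sq ?_ (norm_nonneg _)
  nlinarith [sq_nonneg (inner ℝ n z)]

theorem isBounded_slab {n : EuclideanSpace ℝ (Fin d)} (hn : ‖n‖ = 1)
    (x₀ : EuclideanSpace ℝ (Fin d)) (R M : ℝ) :
    Bornology.IsBounded {x | ‖tangent n x₀ x‖ ≤ R ∧ |height n x₀ x| ≤ M} := by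
  refine (Metric.isBounded_closedBall (x := x₀) (r := R + M)).subset fun x hx => ?_
  rw [Metric.mem_closedBall, dist_eq_norm]
  have : x - x₀ = tangent n x₀ x + height n x₀ x • n := by rw [tangent]; abel
  rw [this]
  refine (norm_add_le _ _).trans (add_le_add hx.1 ?_)
  rw [norm_smul, hn, mul_one]
  exact hx.2

/-- Fubini's theorem on a cylinder around the normal direction. -/
theorem exists_lintegral_cylinder_eq [NeZero d] {n : EuclideanSpace ℝ (Fin d)} (hn : ‖n‖ = 1)
    (x₀ : EuclideanSpace ℝ (Fin d)) :
    ∃ V : ℝ≥0∞, V ≠ 0 ∧ V ≠ ∞ ∧ ∀ R : ℝ, 0 < R → ∀ g : ℝ → ℝ≥0∞, Measurable g →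
      ∫⁻ x in {x | ‖tangent n x₀ x‖ ≤ R}, g (height n x₀ x) =
        V * ENNReal.ofReal (R ^ d / (2 * R)) * ∫⁻ s, g s := by
  set B : ℝ → Set (EuclideanSpace ℝ (Fin d)) :=
    fun R => {x | ‖tangent n 0 x‖ ≤ R ∧ |height n 0 x| ≤ R} with hB
  have hhm : Measurable (height n 0) := (continuous_height n 0).measurable
  have hBpos : volume (B 1) ≠ 0 := by
    have hopen : IsOpen {x | ‖tangent n 0 x‖ < 1 ∧ |height n 0 x| < 1} :=
      (isOpen_lt (continuous_tangent n 0).norm continuous_const).inter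
        (isOpen_lt (continuous_height n 0).abs continuous_const)
    have h0 : volume {x | ‖tangent n 0 x‖ < 1 ∧ |height n 0 x| < 1} ≠ 0 :=
      hopen.measure_ne_zero _ ⟨0, by simp [tangent, height]⟩
    have hsub : {x | ‖tangent n 0 x‖ < 1 ∧ |height n 0 x| < 1} ⊆ B 1 :=
      fun x hx => ⟨hx.1.le, hx.2.le⟩
    exact fun h => h0 (measure_mono_null hsub h)
  refine ⟨volume (B 1), hBpos, (isBounded_slab hn 0 1 1).measure_lt_top.ne, fun R hR g hg => ?_⟩
  set S : Set (EuclideanSpace ℝ (Fin d)) := {x | ‖tangent n 0 x‖ ≤ R} with hS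
  have hSm : MeasurableSet S :=
    (isClosed_le (continuous_tangent n 0).norm continuous_const).measurableSet
  -- The distribution of the height on the cylinder is translation invariant, hence a multiple of
  -- Lebesgue measure. The multiple is read off on `[-R, R]`, whose preimage in the cylinder is `R •
  -- B 1`.
  set ν : Measure ℝ := Measure.map (height n 0) (volume.restrict S) with hν
  have hinv : ν.IsAddLeftInvariant := by
    refine ⟨fun a => ?_⟩
    have hpre : (fun x => x + a • n) ⁻¹' S = S := by
      ext x
      simp only [hS, mem_preimage, mem_ofPred_eq, tangent_add, inner_smul_right,
        real_inner_self_eq_norm_sq, hn]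
      simp
    have hmp := (measurePreserving_add_right (volume : Measure (EuclideanSpace ℝ (Fin d)))
      (a • n)).restrict_preimage hSm
    rw [hpre] at hmp
    have hcomp : (fun s => a + s) ∘ height n 0 = height n 0 ∘ fun x => x + a • n := by
      ext x
      simp [height_add, inner_smul_right, hn, add_comm]
    rw [hν, Measure.map_map (by fun_prop) hhm, hcomp, ← Measure.map_map hhm (by fun_prop), hmp.map_eq]
  have hνapply : ∀ T : Set ℝ, MeasurableSet T → ν T = volume (height n 0 ⁻¹' T ∩ S) := fun T hT => by
    rw [hν, Measure.map_apply hhm hT, Measure.restrict_apply (hhm hT)]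
  have hfin : IsFiniteMeasureOnCompacts ν := by
    refine ⟨fun T hT => ?_⟩
    obtain ⟨M, hM⟩ := hT.isBounded.exists_norm_le
    rw [hνapply T hT.measurableSet]
    have hsub : height n 0 ⁻¹' T ∩ S ⊆ {x | ‖tangent n 0 x‖ ≤ R ∧ |height n 0 x| ≤ M} :=
      fun x hx => ⟨hx.2, hM _ hx.1⟩
    exact (measure_mono hsub).trans_lt
      (isBounded_slab hn 0 R M).measure_lt_top
  have hsmul := Measure.isAddLeftInvariant_eq_smul ν volume
  set c := Measure.addHaarScalarFactor ν volume with hc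
  have hcval : (c : ℝ≥0∞) = volume (B 1) * ENNReal.ofReal (R ^ d / (2 * R)) := by
    have h1 : ν (Icc (-R) R) = volume (B R) := by
      rw [hνapply _ measurableSet_Icc]
      congr 1
      ext x
      simp only [hB, hS, mem_inter_iff, mem_preimage, mem_Icc, mem_ofPred_eq, abs_le]
      exact and_comm
    have h2 : B R = R • B 1 := by
      ext x
      rw [mem_smul_set_iff_inv_smul_mem₀ hR.ne']
      have e1 : height n 0 (R⁻¹ • x) = R⁻¹ * height n 0 x := by
        simp [height, inner_smul_right]
      have e2 : tangent n 0 (R⁻¹ • x) = R⁻¹ • tangent n 0 x := by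
        rw [tangent, e1, tangent, smul_sub, smul_smul]; simp
      simp only [hB, mem_ofPred_eq, e1, e2, norm_smul, abs_mul, Real.norm_eq_abs,
        abs_of_pos (inv_pos.2 hR)]
      rw [inv_mul_le_iff₀ hR, inv_mul_le_iff₀ hR, mul_one]
    rw [h2, Measure.addHaar_smul_of_nonneg _ hR.le, finrank_euclideanSpace_fin, hsmul,
      Measure.smul_apply, Real.volume_Icc, ENNReal.smul_def, smul_eq_mul] at h1
    rw [ENNReal.ofReal_div_of_pos (by positivity), ← mul_div_assoc, mul_comm (volume (B 1)), ← h1,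
      show R - -R = 2 * R by ring, ENNReal.mul_div_cancel_right _ ENNReal.ofReal_ne_top]
    simpa using hR
  have htrans : ∫⁻ x in {x | ‖tangent n x₀ x‖ ≤ R}, g (height n x₀ x) =
      ∫⁻ x in S, g (height n 0 x) := by
    rw [← lintegral_indicator (isClosed_le (continuous_tangent n x₀).norm
      continuous_const).measurableSet, ← lintegral_indicator hSm,
      ← lintegral_sub_right_eq_self (S.indicator fun x => g (height n 0 x)) x₀]
    refine lintegral_congr fun x => ?_
    have e1 : height n 0 (x - x₀) = height n x₀ x := by simp [height]
    have e2 : tangent n 0 (x - x₀) = tangent n x₀ x := by simp [tangent, e1]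
    simp only [indicator_apply, hS, mem_ofPred_eq, e1, e2]
  rw [htrans, ← lintegral_map hg hhm, ← hν, hsmul, lintegral_smul_measure, ENNReal.smul_def,
    smul_eq_mul, hcval]

/-- The cutoff function: a cone in the tangential variables times a tent in the logarithm of the
height, supported on heights in `[exp (-3N), exp (-2N)]`. -/
def cutoff (n x₀ : EuclideanSpace ℝ (Fin d)) (R N : ℝ) (x : EuclideanSpace ℝ (Fin d)) : ℝ :=
  max 0 (1 - ‖tangent n x₀ x‖ / R) *
    max 0 (min ((Real.log (max (height n x₀ x) (Real.exp (-3 * N))) + 3 * N) / N)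
      ((-2 * N - Real.log (max (height n x₀ x) (Real.exp (-3 * N)))) / N))

/-- The test function concentrating near the hyperplane. -/
def testFun (p α : ℝ) (n x₀ : EuclideanSpace ℝ (Fin d)) (R N : ℝ) (x : EuclideanSpace ℝ (Fin d)) :
    ℝ :=
  max (height n x₀ x) (Real.exp (-3 * N)) ^ ((α - 1) / p) * cutoff n x₀ R N x ^ (2 / p)

theorem max_exp_pos (s N : ℝ) : 0 < max s (Real.exp (-3 * N)) :=
  lt_max_of_lt_right (Real.exp_pos _)

theorem continuous_cutoff (n x₀ : EuclideanSpace ℝ (Fin d)) (R N : ℝ) :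
    Continuous (cutoff n x₀ R N) := by
  have h1 := continuous_height n x₀
  have h2 := continuous_tangent n x₀
  have h3 : Continuous fun x => Real.log (max (height n x₀ x) (Real.exp (-3 * N))) :=
    (h1.max continuous_const).log fun x => (max_exp_pos _ _).ne'
  unfold cutoff
  fun_prop

theorem continuous_testFun {p α : ℝ} (hp : 0 < p) (n x₀ : EuclideanSpace ℝ (Fin d)) (R N : ℝ) :
    Continuous (testFun p α n x₀ R N) := by
  have h1 := continuous_height n x₀
  refine Continuous.mul ?_ ?_
  · exact (h1.max continuous_const).rpow_const fun x => Or.inl (max_exp_pos _ _).ne'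
  · exact (continuous_cutoff n x₀ R N).rpow_const fun x => Or.inr (by positivity)

theorem cutoff_nonneg (n x₀ : EuclideanSpace ℝ (Fin d)) (R N : ℝ) (x : EuclideanSpace ℝ (Fin d)) :
    0 ≤ cutoff n x₀ R N x :=
  mul_nonneg (le_max_left _ _) (le_max_left _ _)

theorem tent_le_one {N L : ℝ} (hN : 0 < N) :
    max 0 (min ((L + 3 * N) / N) ((-2 * N - L) / N)) ≤ 1 := by
  refine max_le zero_le_one ?_
  rw [min_le_iff, div_le_one hN, div_le_one hN]
  by_contra! h
  linarith [h.1, h.2]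

theorem cone_le_one {R r : ℝ} (hR : 0 < R) (hr : 0 ≤ r) : max 0 (1 - r / R) ≤ 1 := by
  have : 0 ≤ r / R := by positivity
  exact max_le zero_le_one (by linarith)

theorem cutoff_le_one (n x₀ : EuclideanSpace ℝ (Fin d)) {R N : ℝ} (hR : 0 < R) (hN : 0 < N)
    (x : EuclideanSpace ℝ (Fin d)) : cutoff n x₀ R N x ≤ 1 :=
  mul_le_one₀ (cone_le_one hR (norm_nonneg _)) (le_max_left _ _) (tent_le_one hN)

/-- The floor `exp (-3 * N)` inside the logarithm makes the tent vanish at all lower heights,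
negative ones included, so the floor is inactive on the support. -/
theorem mem_of_cutoff_ne_zero {n x₀ : EuclideanSpace ℝ (Fin d)} {R N : ℝ} (hR : 0 < R) (hN : 0 < N)
    {x : EuclideanSpace ℝ (Fin d)} (hx : cutoff n x₀ R N x ≠ 0) :
    ‖tangent n x₀ x‖ ≤ R ∧ Real.exp (-3 * N) ≤ height n x₀ x ∧
      height n x₀ x ≤ Real.exp (-2 * N) := by
  obtain ⟨h1, h2⟩ := mul_ne_zero_iff.1 hx
  have h1 : 0 < 1 - ‖tangent n x₀ x‖ / R := by
    by_contra! h; exact h1 (max_eq_left h)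
  have h2 : 0 < min ((Real.log (max (height n x₀ x) (Real.exp (-3 * N))) + 3 * N) / N)
      ((-2 * N - Real.log (max (height n x₀ x) (Real.exp (-3 * N)))) / N) := by
    by_contra! h; exact h2 (max_eq_left h)
  rw [lt_min_iff, div_pos_iff_of_pos_right hN, div_pos_iff_of_pos_right hN] at h2
  refine ⟨?_, ?_, ?_⟩
  · rw [sub_pos, div_lt_one hR] at h1; exact h1.le
  · by_contra! h
    rw [max_eq_right h.le, Real.log_exp] at h2
    linarith [h2.1]
  · refine (le_max_left _ (Real.exp (-3 * N))).trans ?_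
    rw [← Real.log_le_iff_le_exp (max_exp_pos _ _)]
    linarith [h2.2]

theorem abs_max_zero_sub_le (a b : ℝ) : |max 0 a - max 0 b| ≤ |a - b| := by
  have := abs_max_sub_max_le_abs a b 0
  simpa [max_comm] using this

theorem abs_tent_sub_le {N L L' : ℝ} (hN : 0 < N) :
    |max 0 (min ((L + 3 * N) / N) ((-2 * N - L) / N)) -
      max 0 (min ((L' + 3 * N) / N) ((-2 * N - L') / N))| ≤ |L - L'| / N := by
  refine (abs_max_zero_sub_le _ _).trans ((abs_min_sub_min_le_max _ _ _ _).trans ?_)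
  refine max_le ?_ ?_
  · rw [← sub_div, abs_div, abs_of_pos hN]
    apply le_of_eq; congr 2; ring
  · rw [← sub_div, abs_div, abs_of_pos hN, abs_sub_comm L]
    apply le_of_eq; congr 2; ring

theorem abs_log_max_sub_le {s t m : ℝ} (hs : 0 < s) (ht : 0 < t) (hm : 0 < m) :
    |Real.log (max s m) - Real.log (max (s * t) m)| ≤ |Real.log t| := by
  have h1 : 0 < max s m := lt_max_of_lt_left hs
  have h2 : 0 < max (s * t) m := lt_max_of_lt_right hm
  have key : ∀ s t : ℝ, 0 < s → 0 < t → Real.log (max (s * t) m) - Real.log (max s m) ≤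
      |Real.log t| := by
    intro s t hs ht
    have h3 : max (s * t) m ≤ max s m * Real.exp |Real.log t| := by
      have h4 : t ≤ Real.exp |Real.log t| := by
        rw [← Real.log_le_iff_le_exp ht]; exact le_abs_self _
      have h5 : 1 ≤ Real.exp |Real.log t| := Real.one_le_exp (abs_nonneg _)
      refine max_le ?_ ?_
      · have := le_max_left s m
        gcongr
      · calc m ≤ max s m := le_max_right _ _
          _ ≤ _ := le_mul_of_one_le_right (hs.le.trans (le_max_left _ _)) h5
    have h6 : 0 < max s m := lt_max_of_lt_left hs
    have h7 := Real.log_le_log (lt_max_of_lt_right hm) h3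
    rw [Real.log_mul h6.ne' (Real.exp_pos _).ne', Real.log_exp] at h7
    linarith
  rw [abs_le]
  constructor
  · linarith [key s t hs ht]
  · have := key (s * t) t⁻¹ (by positivity) (inv_pos.2 ht)
    rwa [mul_assoc, mul_inv_cancel₀ ht.ne', mul_one, Real.log_inv, abs_neg] at this

/-- Moving by `ζ` in units of the height changes the tangential part by at most `exp (-2 * N) *
‖ζ‖`, seen on scale `R`, and the logarithm of the height by at most `|log (1 + ⟨n, ζ⟩)|`, seen on
scale `N`. -/
theorem abs_cutoff_sub_le {n x₀ : EuclideanSpace ℝ (Fin d)} (hn : ‖n‖ = 1) {R N ε : ℝ} (hR : 0 < R)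
    (hN : 0 < N) (hε1 : Real.exp (-2 * N) / R ≤ ε) (hε2 : 1 / N ≤ ε)
    {x ζ : EuclideanSpace ℝ (Fin d)} (hx : cutoff n x₀ R N x ≠ 0) (hζ : 0 < 1 + inner ℝ n ζ) :
    |cutoff n x₀ R N x - cutoff n x₀ R N (x + height n x₀ x • ζ)| ≤
      ε * (‖ζ‖ + |Real.log (1 + inner ℝ n ζ)|) := by
  obtain ⟨-, h1, h2⟩ := mem_of_cutoff_ne_zero hR hN hx
  have hs : 0 < height n x₀ x := (Real.exp_pos _).trans_le h1
  unfold cutoff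
  rw [height_add, tangent_add, inner_smul_right]
  set s := height n x₀ x
  rw [show s + s * inner ℝ n ζ = s * (1 + inner ℝ n ζ) by ring]
  set t := 1 + inner ℝ n ζ
  set P := tangent n x₀ x
  set P' := P + (s • ζ - (s * inner ℝ n ζ) • n)
  set f := max 0 (1 - ‖P‖ / R)
  set f' := max 0 (1 - ‖P'‖ / R)
  set g := max 0 (min ((Real.log (max s (Real.exp (-3 * N))) + 3 * N) / N)
      ((-2 * N - Real.log (max s (Real.exp (-3 * N)))) / N))
  set g' := max 0 (min ((Real.log (max (s * t) (Real.exp (-3 * N))) + 3 * N) / N)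
      ((-2 * N - Real.log (max (s * t) (Real.exp (-3 * N)))) / N))
  have hf : |f - f'| ≤ ε * ‖ζ‖ := by
    refine (abs_max_zero_sub_le _ _).trans ?_
    have e : 1 - ‖P‖ / R - (1 - ‖P'‖ / R) = (‖P'‖ - ‖P‖) / R := by ring
    rw [e, abs_div, abs_of_pos hR]
    have h3 : |‖P'‖ - ‖P‖| ≤ s * ‖ζ‖ := by
      refine (abs_norm_sub_norm_le _ _).trans ?_
      have : P' - P = s • (ζ - inner ℝ n ζ • n) := by
        simp only [P', add_sub_cancel_left, smul_sub, smul_smul]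
      rw [this, norm_smul, Real.norm_of_nonneg hs.le]
      have := norm_sub_inner_smul_le hn ζ
      gcongr
    calc |‖P'‖ - ‖P‖| / R ≤ Real.exp (-2 * N) * ‖ζ‖ / R := by
          have h4 : s * ‖ζ‖ ≤ Real.exp (-2 * N) * ‖ζ‖ := by gcongr
          have := h3.trans h4
          gcongr
      _ = Real.exp (-2 * N) / R * ‖ζ‖ := by ring
      _ ≤ _ := by gcongr
  have hg : |g - g'| ≤ ε * |Real.log t| := by
    refine (abs_tent_sub_le hN).trans ?_
    have := abs_log_max_sub_le hs hζ (Real.exp_pos (-3 * N))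
    calc _ ≤ |Real.log t| / N := by gcongr
      _ = 1 / N * |Real.log t| := by ring
      _ ≤ _ := by gcongr
  have hg1 : |g| ≤ 1 := by
    rw [abs_of_nonneg (le_max_left _ _)]; exact tent_le_one hN
  have hf1 : |f'| ≤ 1 := by
    rw [abs_of_nonneg (le_max_left _ _)]; exact cone_le_one hR (norm_nonneg _)
  calc |f * g - f' * g'| = |(f - f') * g + f' * (g - g')| := by congr 1; ring
    _ ≤ |f - f'| * |g| + |f'| * |g - g'| := by
        rw [← abs_mul, ← abs_mul]; exact abs_add_le _ _
    _ ≤ |f - f'| * 1 + 1 * |g - g'| := by gcongr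
    _ ≤ _ := by linarith

/-- On half the radius the cone is at least `1/2`; on the middle half of the logarithmic range the
tent, whose peak is `1/2`, is at least `1/4`. -/
theorem le_cutoff {n x₀ : EuclideanSpace ℝ (Fin d)} {R N : ℝ} (hR : 0 < R) (hN : 0 < N)
    {x : EuclideanSpace ℝ (Fin d)} (h1 : ‖tangent n x₀ x‖ ≤ R / 2)
    (h2 : Real.exp (-(11 / 4) * N) ≤ height n x₀ x) (h3 : height n x₀ x ≤ Real.exp (-(9 / 4) * N)) :
    1 / 8 ≤ cutoff n x₀ R N x := by
  have hs : 0 < height n x₀ x := (Real.exp_pos _).trans_le h2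
  have h4 : Real.exp (-3 * N) ≤ height n x₀ x :=
    (Real.exp_le_exp.2 (by nlinarith)).trans h2
  have h5 : -(11 / 4) * N ≤ Real.log (height n x₀ x) := (Real.le_log_iff_exp_le hs).2 h2
  have h6 : Real.log (height n x₀ x) ≤ -(9 / 4) * N := (Real.log_le_iff_le_exp hs).2 h3
  have h7 : 1 / 2 ≤ max 0 (1 - ‖tangent n x₀ x‖ / R) := by
    refine le_max_of_le_right ?_
    have : ‖tangent n x₀ x‖ / R ≤ 1 / 2 := by rw [div_le_iff₀ hR]; linarith
    linarith
  have h8 : 1 / 4 ≤ max 0 (min ((Real.log (max (height n x₀ x) (Real.exp (-3 * N))) + 3 * N) / N)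
      ((-2 * N - Real.log (max (height n x₀ x) (Real.exp (-3 * N)))) / N)) := by
    rw [max_eq_left h4]
    refine le_max_of_le_right (le_min ?_ ?_)
    · rw [le_div_iff₀ hN]; linarith
    · rw [le_div_iff₀ hN]; linarith
  calc (1 / 8 : ℝ) = 1 / 2 * (1 / 4) := by norm_num
    _ ≤ _ := mul_le_mul h7 h8 (by norm_num) (by linarith)

theorem isCc_testFun {p α : ℝ} (hp : 0 < p) {n x₀ : EuclideanSpace ℝ (Fin d)} (hn : ‖n‖ = 1)
    {R N : ℝ} (hR : 0 < R) (hN : 0 < N) {Ω : Set (EuclideanSpace ℝ (Fin d))}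
    (hΩ : ∀ x, ‖tangent n x₀ x‖ ≤ R → Real.exp (-3 * N) ≤ height n x₀ x →
      height n x₀ x ≤ Real.exp (-2 * N) → x ∈ Ω) :
    IsCc Ω (testFun p α n x₀ R N) := by
  set Q := {x | ‖tangent n x₀ x‖ ≤ R ∧ Real.exp (-3 * N) ≤ height n x₀ x ∧
      height n x₀ x ≤ Real.exp (-2 * N)} with hQ
  have hQc : IsClosed Q :=
    (isClosed_le (continuous_tangent n x₀).norm continuous_const).inter
      ((isClosed_le continuous_const (continuous_height n x₀)).inter
        (isClosed_le (continuous_height n x₀) continuous_const))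
  have hQb : Bornology.IsBounded Q :=
    (isBounded_slab hn x₀ R (Real.exp (-2 * N))).subset fun x hx =>
      ⟨hx.1, by rw [abs_of_pos ((Real.exp_pos _).trans_le hx.2.1)]; exact hx.2.2⟩
  have hQk : IsCompact Q := Metric.isCompact_of_isClosed_isBounded hQc hQb
  have hsupp : Function.support (testFun p α n x₀ R N) ⊆ Q := by
    intro x hx
    refine mem_of_cutoff_ne_zero hR hN fun h => hx ?_
    rw [testFun, h, Real.zero_rpow (by positivity), mul_zero]
  have htsupp : tsupport (testFun p α n x₀ R N) ⊆ Q := closure_minimal hsupp hQc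
  exact ⟨continuous_testFun hp n x₀ R N, HasCompactSupport.of_support_subset_isCompact hQk hsupp,
    fun x hx => hΩ x (htsupp hx).1 (htsupp hx).2.1 (htsupp hx).2.2⟩

end

/-! ### Upper bound for the energy of the test functions. -/

section

open Filter Topology

variable {d : ℕ}

/-- Pairs with exactly one point in `K` occur in both orders, so folding onto `x ∈ K` gives them
weight `2`. Afterwards the rescaling centre `x` always lies in the support. -/
theorem setLIntegral_setLIntegral_eq_of_symm {E : Type*} [MeasurableSpace E] {μ : Measure E}
    [SFinite μ] {Ω K : Set E} (hΩ : MeasurableSet Ω) (hK : MeasurableSet K) (hKΩ : K ⊆ Ω)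
    {k : E → E → ℝ≥0∞} (hk : Measurable (Function.uncurry k)) (hsymm : ∀ x y, k x y = k y x)
    (hzero : ∀ x ∉ K, ∀ y ∉ K, k x y = 0) :
    ∫⁻ x in Ω, ∫⁻ y in Ω, k x y ∂μ ∂μ =
      ∫⁻ x in K, ∫⁻ y in Ω, (1 + Kᶜ.indicator 1 y) * k x y ∂μ ∂μ := by
  have hkx : ∀ x, Measurable (k x) := fun x => hk.comp measurable_prodMk_left
  have h1 : ∫⁻ x in Ω, ∫⁻ y in Ω, k x y ∂μ ∂μ =
      (∫⁻ x in K, ∫⁻ y in Ω, k x y ∂μ ∂μ) + ∫⁻ x in Ω \ K, ∫⁻ y in Ω, k x y ∂μ ∂μ := by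
    rw [← lintegral_inter_add_sdiff (A := Ω) (B := K) _ hK, inter_eq_right.2 hKΩ]
  have h2 : ∫⁻ x in Ω \ K, ∫⁻ y in Ω, k x y ∂μ ∂μ = ∫⁻ x in Ω \ K, ∫⁻ y in K, k x y ∂μ ∂μ := by
    refine setLIntegral_congr_fun (hΩ.diff hK) fun x hx => ?_
    rw [← lintegral_inter_add_sdiff (A := Ω) (B := K) _ hK, inter_eq_right.2 hKΩ,
      setLIntegral_eq_zero (hΩ.diff hK) fun y hy => hzero x hx.2 y hy.2, add_zero]
  have h3 : ∫⁻ x in Ω \ K, ∫⁻ y in K, k x y ∂μ ∂μ = ∫⁻ x in K, ∫⁻ y in Ω \ K, k x y ∂μ ∂μ := by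
    rw [lintegral_lintegral_swap hk.aemeasurable]
    exact lintegral_congr fun x => lintegral_congr fun y => hsymm _ _
  rw [h1, h2, h3, ← lintegral_add_left
    (show Measurable fun x => ∫⁻ y in Ω, k x y ∂μ from hk.lintegral_prod_right')]
  refine lintegral_congr fun x => ?_
  simp_rw [add_mul, one_mul]
  rw [lintegral_add_left (hkx x)]
  congr 1
  rw [← lintegral_indicator (hΩ.diff hK), ← lintegral_indicator hΩ]
  refine lintegral_congr fun y => ?_
  by_cases hy : y ∈ Ω <;> by_cases hy' : y ∈ K <;> simp [hy, hy']

theorem lintegral_eq_lintegral_add_smul (F : EuclideanSpace ℝ (Fin d) → ℝ≥0∞)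
    (hF : Measurable F) (x : EuclideanSpace ℝ (Fin d)) {s : ℝ} (hs : 0 < s) :
    ∫⁻ y, F y = ENNReal.ofReal (s ^ d) * ∫⁻ ζ, F (x + s • ζ) := by
  rw [← lintegral_add_left_eq_self F x,
    ← lintegral_map (f := fun z => F (x + z)) (g := fun ζ => s • ζ) (by fun_prop) (by fun_prop),
    Measure.map_addHaar_smul _ hs.ne', lintegral_smul_measure, smul_eq_mul, ← mul_assoc,
    ← ENNReal.ofReal_mul (by positivity), finrank_euclideanSpace_fin, abs_of_pos (by positivity),
    mul_inv_cancel₀ (by positivity), ENNReal.ofReal_one, one_mul]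

theorem testFun_eq {p α : ℝ} (hp : 1 < p) {n x₀ x : EuclideanSpace ℝ (Fin d)} {R N : ℝ}
    (hR : 0 < R) (hN : 0 < N) (hx : 0 < height n x₀ x) :
    testFun p α n x₀ R N x = (height n x₀ x ^ ((α - 1) / 2) * cutoff n x₀ R N x) ^ (2 / p) := by
  have hp0 : 0 < p := by linarith
  rcases eq_or_ne (cutoff n x₀ R N x) 0 with h | h
  · rw [testFun, h, mul_zero, Real.zero_rpow (by positivity), mul_zero]
  · obtain ⟨-, h1, -⟩ := mem_of_cutoff_ne_zero hR hN h
    rw [testFun, max_eq_left h1, Real.mul_rpow (by positivity) (cutoff_nonneg _ _ _ _ _),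
      ← Real.rpow_mul hx.le]
    congr 2; field_simp

theorem mul_bregman_testFun_le {p α : ℝ} (hp : 1 < p) {n x₀ : EuclideanSpace ℝ (Fin d)}
    (hn : ‖n‖ = 1) {R N ε : ℝ} (hR : 0 < R) (hN : 0 < N) (hε1 : Real.exp (-2 * N) / R ≤ ε)
    (hε2 : 1 / N ≤ ε) {x ζ : EuclideanSpace ℝ (Fin d)} (hx : cutoff n x₀ R N x ≠ 0)
    (hζ : 0 < 1 + inner ℝ n ζ) {w : ℝ}
    (hw : w = 1 ∨ w = 2 ∧ cutoff n x₀ R N (x + height n x₀ x • ζ) = 0) :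
    w * bregman p (testFun p α n x₀ R N x) (testFun p α n x₀ R N (x + height n x₀ x • ζ)) ≤
      height n x₀ x ^ (α - 1) * (cutoff n x₀ R N x ^ 2 *
        dualBregman (2 / p) 1 ((1 + inner ℝ n ζ) ^ ((α - 1) / 2)) +
          cutoffError (ε * (‖ζ‖ + |Real.log (1 + inner ℝ n ζ)|))
            ((1 + inner ℝ n ζ) ^ ((α - 1) / 2))) := by
  have hp0 : 0 < p := by linarith
  have hσ2 : 2 / p < 2 := by rw [div_lt_iff₀ hp0]; linarith
  have hs : 0 < height n x₀ x := (Real.exp_pos _).trans_le (mem_of_cutoff_ne_zero hR hN hx).2.1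
  have hy : height n x₀ (x + height n x₀ x • ζ) = height n x₀ x * (1 + inner ℝ n ζ) := by
    rw [height_add, inner_smul_right]; ring
  have ha := cutoff_nonneg n x₀ R N x
  have hb := cutoff_nonneg n x₀ R N (x + height n x₀ x • ζ)
  have key := weight_mul_dualBregman_le (σ := 2 / p) (by positivity) hσ2 ha
    (cutoff_le_one n x₀ hR hN x) hb (cutoff_le_one n x₀ hR hN _)
    (Real.rpow_nonneg hζ.le ((α - 1) / 2)) (abs_cutoff_sub_le hn hR hN hε1 hε2 hx hζ) hw
  rw [testFun_eq hp hR hN hs, testFun_eq hp hR hN (hy ▸ mul_pos hs hζ),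
    bregman_rpow_eq hp (by positivity) (by rw [hy]; positivity), hy,
    Real.mul_rpow hs.le hζ.le, mul_assoc (_ ^ ((α - 1) / 2)),
    dualBregman_mul (by positivity) (by positivity) ha (by positivity), ← Real.rpow_natCast,
    ← Real.rpow_mul hs.le, show (α - 1) / 2 * ((2 : ℕ) : ℝ) = α - 1 by push_cast; ring,
    mul_left_comm]
  gcongr

/-- Under `y = x + h ζ`, with `h` the height of `x`, the powers `h ^ d`, `h ^ (α - 1)` and `h ^ (-(d
+ α))` combine to `1 / h`. What remains is the half-space density with frozen cutoff, plus the
error. -/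
theorem lintegral_halfSpace_kernel_le [NeZero d] {p α : ℝ} (hp : 1 < p) (hα₁ : 1 < α) (hα₂ : α < 2)
    {n x₀ : EuclideanSpace ℝ (Fin d)} (hn : ‖n‖ = 1) {R N ε : ℝ} (hR : 0 < R) (hN : 0 < N)
    (hε1 : Real.exp (-2 * N) / R ≤ ε) (hε2 : 1 / N ≤ ε) {x : EuclideanSpace ℝ (Fin d)}
    (hx : cutoff n x₀ R N x ≠ 0) :
    ∫⁻ y in {y | 0 < height n x₀ y}, (1 + {y | cutoff n x₀ R N y ≠ 0}ᶜ.indicator 1 y) *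
      ENNReal.ofReal (bregman p (testFun p α n x₀ R N x) (testFun p α n x₀ R N y) /
        ‖x - y‖ ^ ((d : ℝ) + α)) ≤
      ENNReal.ofReal (1 / height n x₀ x) * (ENNReal.ofReal (cutoff n x₀ R N x ^ 2) *
        (2 * ENNReal.ofReal (kappa d p α)) + totalError α n ε) := by
  have hp0 : 0 < p := by linarith
  have hσ2 : 2 / p < 2 := by rw [div_lt_iff₀ hp0]; linarith
  have hs : 0 < height n x₀ x := (Real.exp_pos _).trans_le (mem_of_cutoff_ne_zero hR hN hx).2.1
  have hε0 : 0 ≤ ε := le_trans (by positivity) hε2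
  have hum : Measurable (testFun p α n x₀ R N) := (continuous_testFun hp0 n x₀ R N).measurable
  have hcm : Measurable (cutoff n x₀ R N) := (continuous_cutoff n x₀ R N).measurable
  have hhm : Measurable (height n x₀) := (continuous_height n x₀).measurable
  have hKm : MeasurableSet {y | cutoff n x₀ R N y ≠ 0} :=
    (hcm (measurableSet_singleton 0)).compl
  have hHm : MeasurableSet {y | 0 < height n x₀ y} := measurableSet_lt measurable_const hhm
  have hTm : MeasurableSet {ζ : EuclideanSpace ℝ (Fin d) | 0 < 1 + inner ℝ n ζ} :=
    measurableSet_lt measurable_const (by fun_prop)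
  have hbm := measurable_bregman p
  have hdm := measurable_dualBregman (2 / p)
  have hwm : Measurable fun y => (1 : ℝ≥0∞) + {y | cutoff n x₀ R N y ≠ 0}ᶜ.indicator 1 y :=
    Measurable.add measurable_const
      (show Measurable fun y => {y | cutoff n x₀ R N y ≠ 0}ᶜ.indicator (1 : EuclideanSpace ℝ (Fin d) → ℝ≥0∞) y from
        measurable_one.indicator hKm.compl)
  have hFm : Measurable fun y => (1 + {y | cutoff n x₀ R N y ≠ 0}ᶜ.indicator 1 y) *
      ENNReal.ofReal (bregman p (testFun p α n x₀ R N x) (testFun p α n x₀ R N y) /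
        ‖x - y‖ ^ ((d : ℝ) + α)) := by
    refine hwm.mul (Measurable.ennreal_ofReal (Measurable.div ?_ (by fun_prop)))
    exact hbm.comp (measurable_const.prodMk hum)
  rw [← lintegral_indicator hHm, lintegral_eq_lintegral_add_smul _ (hFm.indicator hHm) x hs,
    ← lintegral_dualBregman_halfSpace hp hα₁ hα₂ hn, totalError,
    ← lintegral_const_mul' _ _ ENNReal.ofReal_ne_top,
    ← lintegral_const_mul' _ _ ENNReal.ofReal_ne_top]
  have hdm' : Measurable fun ζ : EuclideanSpace ℝ (Fin d) =>
      dualBregman (2 / p) 1 ((1 + inner ℝ n ζ) ^ ((α - 1) / 2)) :=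
    hdm.comp (measurable_const.prodMk (by fun_prop))
  rw [← lintegral_add_left (by fun_prop), ← lintegral_const_mul' _ _ ENNReal.ofReal_ne_top,
    ← lintegral_indicator hTm]
  refine lintegral_mono fun ζ => ?_
  have hy : height n x₀ (x + height n x₀ x • ζ) = height n x₀ x * (1 + inner ℝ n ζ) := by
    rw [height_add, inner_smul_right]; ring
  by_cases hζ : 0 < 1 + inner ℝ n ζ
  swap
  · rw [indicator_of_notMem (by simpa [hy, hs] using hζ), mul_zero]; exact zero_le
  rw [indicator_of_mem (by simpa [hy, hs] using hζ), indicator_of_mem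
    (show ζ ∈ {ζ : EuclideanSpace ℝ (Fin d) | 0 < 1 + inner ℝ n ζ} from hζ)]
  set y := x + height n x₀ x • ζ with hydef
  obtain ⟨w, hw0, hweq, hw⟩ : ∃ w : ℝ, 0 ≤ w ∧
      ((1 : ℝ≥0∞) + {y | cutoff n x₀ R N y ≠ 0}ᶜ.indicator 1 y = ENNReal.ofReal w) ∧
      (w = 1 ∨ w = 2 ∧ cutoff n x₀ R N y = 0) := by
    by_cases h : cutoff n x₀ R N y = 0
    · exact ⟨2, by norm_num, by simp [h, one_add_one_eq_two], Or.inr ⟨rfl, h⟩⟩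
    · exact ⟨1, by norm_num, by simp [h], Or.inl rfl⟩
  have key := mul_bregman_testFun_le (α := α) hp hn hR hN hε1 hε2 hx hζ hw
  have hd0 := dualBregman_nonneg (σ := 2 / p) (A := 1) (B := (1 + inner ℝ n ζ) ^ ((α - 1) / 2))
    (by positivity) hσ2 zero_le_one (by positivity)
  have hc0 := cutoffError_nonneg (δ := ε * (‖ζ‖ + |Real.log (1 + inner ℝ n ζ)|))
    (τ := (1 + inner ℝ n ζ) ^ ((α - 1) / 2)) (by positivity)
  have hnorm : ‖x - y‖ ^ ((d : ℝ) + α) =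
      height n x₀ x ^ ((d : ℝ) + α) * ‖ζ‖ ^ ((d : ℝ) + α) := by
    rw [hydef, sub_add_cancel_left, norm_neg, norm_smul, Real.norm_of_nonneg hs.le,
      Real.mul_rpow hs.le (norm_nonneg _)]
  have hpow : height n x₀ x ^ d * (height n x₀ x ^ (α - 1) *
      (height n x₀ x ^ ((d : ℝ) + α))⁻¹) = 1 / height n x₀ x := by
    rw [← Real.rpow_natCast, ← Real.rpow_neg hs.le, ← Real.rpow_add hs, ← Real.rpow_add hs,
      one_div, ← Real.rpow_neg_one]
    congr 1; ring
  have hz0 : 0 ≤ ‖ζ‖ ^ (-((d : ℝ) + α)) := by positivity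
  rw [hweq, ← ENNReal.ofReal_mul hw0, ← ENNReal.ofReal_mul (by positivity),
    ← ENNReal.ofReal_mul (by positivity), ← ENNReal.ofReal_add (by positivity) (by positivity),
    ← ENNReal.ofReal_mul (by positivity)]
  refine ENNReal.ofReal_le_ofReal ?_
  rw [hnorm, ← hpow]
  calc height n x₀ x ^ d * (w * (bregman p (testFun p α n x₀ R N x) (testFun p α n x₀ R N y) /
        (height n x₀ x ^ ((d : ℝ) + α) * ‖ζ‖ ^ ((d : ℝ) + α))))
      = height n x₀ x ^ d * (height n x₀ x ^ ((d : ℝ) + α))⁻¹ * ‖ζ‖ ^ (-((d : ℝ) + α)) *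
        (w * bregman p (testFun p α n x₀ R N x) (testFun p α n x₀ R N y)) := by
        rw [Real.rpow_neg (norm_nonneg ζ), div_eq_mul_inv, mul_inv]; ring
    _ ≤ height n x₀ x ^ d * (height n x₀ x ^ ((d : ℝ) + α))⁻¹ * ‖ζ‖ ^ (-((d : ℝ) + α)) * _ :=
        mul_le_mul_of_nonneg_left key (by positivity)
    _ = _ := by ring

/-- The inner domain may be enlarged from `Ω` to the half-space since the integrand is nonnegative,
and the prefactor `1 / 2` cancels the `2` of the half-space density. -/
theorem form_testFun_le [NeZero d] {p α : ℝ} (hp : 1 < p) (hα₁ : 1 < α) (hα₂ : α < 2)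
    {n x₀ : EuclideanSpace ℝ (Fin d)} (hn : ‖n‖ = 1) {R N ε : ℝ} (hR : 0 < R) (hN : 0 < N)
    (hε1 : Real.exp (-2 * N) / R ≤ ε) (hε2 : 1 / N ≤ ε) {Ω : Set (EuclideanSpace ℝ (Fin d))}
    (hΩm : MeasurableSet Ω) (hKΩ : {x | cutoff n x₀ R N x ≠ 0} ⊆ Ω)
    (hΩ : ∀ x ∈ Ω, 0 < height n x₀ x) :
    form p α Ω (testFun p α n x₀ R N) ≤
      ENNReal.ofReal (kappa d p α) * (∫⁻ x in {x | cutoff n x₀ R N x ≠ 0},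
        ENNReal.ofReal (cutoff n x₀ R N x ^ 2 / height n x₀ x)) +
      1 / 2 * totalError α n ε * ∫⁻ x in {x | cutoff n x₀ R N x ≠ 0},
        ENNReal.ofReal (1 / height n x₀ x) := by
  have hp0 : 0 < p := by linarith
  have hum : Measurable (testFun p α n x₀ R N) := (continuous_testFun hp0 n x₀ R N).measurable
  have hcm : Measurable (cutoff n x₀ R N) := (continuous_cutoff n x₀ R N).measurable
  have hhm : Measurable (height n x₀) := (continuous_height n x₀).measurable
  have hKm : MeasurableSet {y | cutoff n x₀ R N y ≠ 0} :=
    (hcm (measurableSet_singleton 0)).compl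
  set k : EuclideanSpace ℝ (Fin d) → EuclideanSpace ℝ (Fin d) → ℝ≥0∞ := fun x y =>
    ENNReal.ofReal (bregman p (testFun p α n x₀ R N x) (testFun p α n x₀ R N y) /
        ‖x - y‖ ^ ((d : ℝ) + α)) with hk
  have hkm : Measurable (Function.uncurry k) := by
    refine Measurable.ennreal_ofReal (Measurable.div ?_ (by fun_prop))
    exact (measurable_bregman p).comp
      ((hum.comp measurable_fst).prodMk (hum.comp measurable_snd))
  have hzero : ∀ x, cutoff n x₀ R N x = 0 → testFun p α n x₀ R N x = 0 := fun x hx => by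
    rw [testFun, hx, Real.zero_rpow (by positivity), mul_zero]
  have hform : form p α Ω (testFun p α n x₀ R N) = 1 / 2 * ∫⁻ x in Ω, ∫⁻ y in Ω, k x y := rfl
  rw [hform, setLIntegral_setLIntegral_eq_of_symm hΩm hKm hKΩ hkm
    (fun x y => by simp only [hk]; rw [bregman_comm, norm_sub_rev])
    (fun x hx y hy => by
      simp only [mem_ofPred_eq, not_not] at hx hy
      simp [hk, hzero x hx, hzero y hy, bregman])]
  calc _ ≤ 1 / 2 * ∫⁻ x in {x | cutoff n x₀ R N x ≠ 0}, ENNReal.ofReal (1 / height n x₀ x) *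
        (ENNReal.ofReal (cutoff n x₀ R N x ^ 2) *
        (2 * ENNReal.ofReal (kappa d p α)) + totalError α n ε) := by
        gcongr 1 / 2 * ?_
        refine setLIntegral_mono' hKm fun x hx => ?_
        exact (lintegral_mono_set hΩ).trans
          (lintegral_halfSpace_kernel_le hp hα₁ hα₂ hn hR hN hε1 hε2 hx)
    _ = 1 / 2 * ∫⁻ x in {x | cutoff n x₀ R N x ≠ 0},
        ((2 * ENNReal.ofReal (kappa d p α)) *
          ENNReal.ofReal (cutoff n x₀ R N x ^ 2 / height n x₀ x) +
          ENNReal.ofReal (1 / height n x₀ x) * totalError α n ε) := by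
        congr 1
        refine setLIntegral_congr_fun hKm fun x hx => ?_
        rw [mul_add, div_eq_mul_one_div (cutoff n x₀ R N x ^ 2), ENNReal.ofReal_mul (by positivity)]
        ring
    _ = _ := by
        rw [lintegral_add_left (by fun_prop), lintegral_const_mul _ (by fun_prop),
          lintegral_mul_const _ (by fun_prop), mul_add]
        congr 1
        · rw [← mul_assoc, ← mul_assoc, one_div, ENNReal.inv_mul_cancel two_ne_zero (by simp),
            one_mul]
        · ring

end

/-! ### Comparison of masses and optimality of the constant. -/

section

open Filter Topology

variable {d : ℕ}

theorem lintegral_Icc_exp_one_div {a b : ℝ} (hab : a ≤ b) :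
    ∫⁻ s in Icc (Real.exp a) (Real.exp b), ENNReal.ofReal (1 / s) = ENNReal.ofReal (b - a) := by
  have hle := Real.exp_le_exp.2 hab
  have h := integral_one_div_of_pos (Real.exp_pos a) (Real.exp_pos b)
  rw [intervalIntegral.integral_of_le hle, ← integral_Icc_eq_integral_Ioc, ← Real.exp_sub,
    Real.log_exp] at h
  rw [← h, ofReal_integral_eq_lintegral_ofReal]
  · refine ContinuousOn.integrableOn_Icc ?_
    exact continuousOn_const.div continuousOn_id fun x hx => ((Real.exp_pos a).trans_le hx.1).ne'
  · exact (ae_restrict_iff' measurableSet_Icc).2 (ae_of_all _ fun x hx => by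
      have : 0 < x := (Real.exp_pos a).trans_le hx.1
      positivity)

/-- Since ds/s has mass `N` on the logarithmic range, both integrals are of order `R ^ (d - 1) * N`.
In the constant, `64` comes from squaring `1/8` in `le_cutoff`, and `2 ^ d` from halving the radius
(`2 ^ (d - 1)`) and the logarithmic range (`2`). -/
theorem lintegral_cutoff_comparison [NeZero d] {n x₀ : EuclideanSpace ℝ (Fin d)} (hn : ‖n‖ = 1)
    {R N : ℝ} (hR : 0 < R) (hN : 0 < N) :
    (∫⁻ x in {x | cutoff n x₀ R N x ≠ 0}, ENNReal.ofReal (1 / height n x₀ x) ≤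
      ENNReal.ofReal (64 * 2 ^ d) * ∫⁻ x in {x | cutoff n x₀ R N x ≠ 0},
        ENNReal.ofReal (cutoff n x₀ R N x ^ 2 / height n x₀ x)) ∧
    (∫⁻ x in {x | cutoff n x₀ R N x ≠ 0},
        ENNReal.ofReal (cutoff n x₀ R N x ^ 2 / height n x₀ x) ≠ 0) ∧
    (∫⁻ x in {x | cutoff n x₀ R N x ≠ 0},
        ENNReal.ofReal (cutoff n x₀ R N x ^ 2 / height n x₀ x) ≠ ∞) := by
  obtain ⟨V, hV0, hVt, hV⟩ := exists_lintegral_cylinder_eq hn x₀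
  have hcm : Measurable (cutoff n x₀ R N) := (continuous_cutoff n x₀ R N).measurable
  have hKm : MeasurableSet {y | cutoff n x₀ R N y ≠ 0} :=
    (hcm (measurableSet_singleton 0)).compl
  have hSm : ∀ r, MeasurableSet {x | ‖tangent n x₀ x‖ ≤ r} := fun r =>
    (isClosed_le (continuous_tangent n x₀).norm continuous_const).measurableSet
  have hgm : ∀ a b c : ℝ, Measurable ((Icc (Real.exp a) (Real.exp b)).indicator
      fun s => ENNReal.ofReal c * ENNReal.ofReal (1 / s)) := fun a b c =>
    Measurable.indicator (by fun_prop) measurableSet_Icc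
  have hg : ∀ a b c : ℝ, a ≤ b → ∫⁻ s, (Icc (Real.exp a) (Real.exp b)).indicator
      (fun s => ENNReal.ofReal c * ENNReal.ofReal (1 / s)) s =
        ENNReal.ofReal c * ENNReal.ofReal (b - a) := fun a b c hab => by
    rw [lintegral_indicator measurableSet_Icc, lintegral_const_mul' _ _ ENNReal.ofReal_ne_top,
      lintegral_Icc_exp_one_div hab]
  set A := V * ENNReal.ofReal (R ^ d / (2 * R) * N) with hA
  have hA0 : A ≠ 0 := mul_ne_zero hV0 (ENNReal.ofReal_pos.2 (by positivity)).ne'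
  have hAt : A ≠ ∞ := ENNReal.mul_ne_top hVt ENNReal.ofReal_ne_top
  have hY : ∫⁻ x in {x | cutoff n x₀ R N x ≠ 0}, ENNReal.ofReal (1 / height n x₀ x) ≤ A := by
    calc _ ≤ ∫⁻ x in {x | ‖tangent n x₀ x‖ ≤ R}, (Icc (Real.exp (-3 * N))
          (Real.exp (-2 * N))).indicator (fun s => ENNReal.ofReal 1 * ENNReal.ofReal (1 / s))
            (height n x₀ x) := by
          rw [← lintegral_indicator hKm, ← lintegral_indicator (hSm R)]
          refine lintegral_mono fun x => ?_
          by_cases hx : cutoff n x₀ R N x = 0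
          · rw [indicator_of_notMem (by simpa using hx)]; exact zero_le
          · obtain ⟨h1, h2, h3⟩ := mem_of_cutoff_ne_zero hR hN hx
            rw [indicator_of_mem (by exact hx), indicator_of_mem (by exact h1),
              indicator_of_mem (by exact ⟨h2, h3⟩), ENNReal.ofReal_one, one_mul]
      _ = A := by
          rw [hV R hR _ (hgm _ _ _), hg _ _ _ (by linarith), ENNReal.ofReal_one, one_mul, mul_assoc,
            ← ENNReal.ofReal_mul (by positivity), hA]
          congr 3; ring
  have hX : A * ENNReal.ofReal (64 * 2 ^ d)⁻¹ ≤ ∫⁻ x in {x | cutoff n x₀ R N x ≠ 0},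
        ENNReal.ofReal (cutoff n x₀ R N x ^ 2 / height n x₀ x) := by
    calc A * ENNReal.ofReal (64 * 2 ^ d)⁻¹
        = ∫⁻ x in {x | ‖tangent n x₀ x‖ ≤ R / 2}, (Icc (Real.exp (-(11 / 4) * N))
          (Real.exp (-(9 / 4) * N))).indicator
            (fun s => ENNReal.ofReal (1 / 64) * ENNReal.ofReal (1 / s)) (height n x₀ x) := by
          rw [hV (R / 2) (by positivity) _ (hgm _ _ _), hg _ _ _ (by linarith), hA, mul_assoc,
            mul_assoc, ← ENNReal.ofReal_mul (by positivity), ← ENNReal.ofReal_mul (by positivity),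
            ← ENNReal.ofReal_mul (by positivity)]
          congr 2
          rw [div_pow]
          field_simp
          ring
      _ ≤ _ := by
          rw [← lintegral_indicator hKm, ← lintegral_indicator (hSm (R / 2))]
          refine lintegral_mono fun x => ?_
          by_cases h1 : ‖tangent n x₀ x‖ ≤ R / 2
          swap
          · rw [indicator_of_notMem (by exact h1)]; exact zero_le
          by_cases h2 : height n x₀ x ∈ Icc (Real.exp (-(11 / 4) * N)) (Real.exp (-(9 / 4) * N))
          swap
          · rw [indicator_of_mem (by exact h1), indicator_of_notMem h2]; exact zero_le
          have h3 := le_cutoff hR hN h1 h2.1 h2.2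
          have h4 : 0 < height n x₀ x := (Real.exp_pos _).trans_le h2.1
          rw [indicator_of_mem (by exact h1), indicator_of_mem h2,
            indicator_of_mem (show cutoff n x₀ R N x ≠ 0 by linarith),
            ← ENNReal.ofReal_mul (by norm_num)]
          refine ENNReal.ofReal_le_ofReal ?_
          rw [mul_one_div]
          gcongr
          nlinarith
  refine ⟨hY.trans ?_, fun h => ?_, ne_top_of_le_ne_top hAt (le_trans ?_ hY)⟩
  · calc A = ENNReal.ofReal (64 * 2 ^ d) * (A * ENNReal.ofReal (64 * 2 ^ d)⁻¹) := by
          rw [mul_left_comm, ← ENNReal.ofReal_mul (by positivity), mul_inv_cancel₀ (by positivity),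
            ENNReal.ofReal_one, mul_one]
      _ ≤ _ := by gcongr
  · rw [h] at hX
    exact mul_ne_zero hA0 (ENNReal.ofReal_pos.2 (by positivity)).ne' (le_antisymm hX zero_le)
  · refine setLIntegral_mono' hKm fun x hx => ENNReal.ofReal_le_ofReal ?_
    have h1 := cutoff_nonneg n x₀ R N x
    have h2 := cutoff_le_one n x₀ hR hN x
    have h3 : 0 < height n x₀ x := (Real.exp_pos _).trans_le (mem_of_cutoff_ne_zero hR hN hx).2.1
    gcongr
    exact pow_le_one₀ h1 h2

theorem infDist_compl_le_height {n x₀ : EuclideanSpace ℝ (Fin d)} (hn : ‖n‖ = 1)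
    {Ω : Set (EuclideanSpace ℝ (Fin d))} (hΩ : ∀ x ∈ Ω, 0 < height n x₀ x)
    {x : EuclideanSpace ℝ (Fin d)} (hx : x ∈ Ω) : Metric.infDist x Ωᶜ ≤ height n x₀ x := by
  have h1 : x + -height n x₀ x • n ∈ Ωᶜ := fun h => by
    have := hΩ _ h
    rw [height_add, inner_smul_right, real_inner_self_eq_norm_sq, hn] at this
    linarith
  refine (Metric.infDist_le_dist_of_mem h1).trans_eq ?_
  rw [dist_self_add_right, norm_smul, hn, norm_neg, Real.norm_of_nonneg (hΩ x hx).le, mul_one]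

theorem infDist_frontier_le_height {n x₀ : EuclideanSpace ℝ (Fin d)} (hn : ‖n‖ = 1)
    {Ω : Set (EuclideanSpace ℝ (Fin d))} (hΩ' : Ω ≠ univ) (hΩ : ∀ x ∈ Ω, 0 < height n x₀ x)
    {x : EuclideanSpace ℝ (Fin d)} (hx : x ∈ Ω) : Metric.infDist x (frontier Ω) ≤ height n x₀ x := by
  obtain ⟨y, hy, h⟩ := exists_mem_frontier_infDist_compl_eq_dist hx hΩ'
  exact (Metric.infDist_le_dist_of_mem hy).trans (h ▸ infDist_compl_le_height hn hΩ hx)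

/-- On the support `|u| ^ p` is the square of the cutoff times height to the power `α - 1`, and the
boundary distance is at most the height because `Ω` lies on one side of the hyperplane. -/
theorem lintegral_cutoff_le_hardyIntegral {p α : ℝ} (hp : 1 < p) (hα : 0 < α)
    {n x₀ : EuclideanSpace ℝ (Fin d)} (hn : ‖n‖ = 1) {R N : ℝ} (hR : 0 < R) (hN : 0 < N)
    {Ω : Set (EuclideanSpace ℝ (Fin d))} (hΩo : IsOpen Ω) (hΩ' : Ω ≠ univ)
    (hKΩ : {x | cutoff n x₀ R N x ≠ 0} ⊆ Ω) (hΩ : ∀ x ∈ Ω, 0 < height n x₀ x) :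
    ∫⁻ x in {x | cutoff n x₀ R N x ≠ 0},
        ENNReal.ofReal (cutoff n x₀ R N x ^ 2 / height n x₀ x) ≤
      hardyIntegral p α Ω (testFun p α n x₀ R N) := by
  have hp0 : 0 < p := by linarith
  have hKm : MeasurableSet {y | cutoff n x₀ R N y ≠ 0} :=
    ((continuous_cutoff n x₀ R N).measurable (measurableSet_singleton 0)).compl
  refine le_trans ?_ (lintegral_mono_set hKΩ)
  refine setLIntegral_mono' hKm fun x hx => ENNReal.ofReal_le_ofReal ?_
  have hs := hΩ x (hKΩ hx)
  have hδ := infDist_frontier_pos hΩo hΩ' (hKΩ hx)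
  have hle := infDist_frontier_le_height hn hΩ' hΩ (hKΩ hx)
  have hc := cutoff_nonneg n x₀ R N x
  have h1 : |testFun p α n x₀ R N x| ^ p = height n x₀ x ^ (α - 1) * cutoff n x₀ R N x ^ 2 := by
    rw [testFun_eq hp hR hN hs, abs_of_nonneg (by positivity), ← Real.rpow_mul (by positivity),
      div_mul_cancel₀ _ hp0.ne', Real.rpow_two, mul_pow, ← Real.rpow_natCast, ← Real.rpow_mul hs.le]
    congr 2; push_cast; ring
  rw [h1]
  calc cutoff n x₀ R N x ^ 2 / height n x₀ x
      = height n x₀ x ^ (α - 1) * cutoff n x₀ R N x ^ 2 / height n x₀ x ^ α := by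
        rw [Real.rpow_sub hs, Real.rpow_one]
        have : 0 < height n x₀ x ^ α := by positivity
        field_simp
    _ ≤ _ := by gcongr

/-- At a boundary point closest to an interior point, the domain contains thin slabs concentrating
at a supporting hyperplane. -/
theorem exists_slab_subset {Ω : Set (EuclideanSpace ℝ (Fin d))} (hΩo : IsOpen Ω) (hΩ' : Ω ≠ univ)
    (hconv : Convex ℝ Ω) (hne : Ω.Nonempty) :
    ∃ n x₀ : EuclideanSpace ℝ (Fin d), ∃ ρ : ℝ, ‖n‖ = 1 ∧ 0 < ρ ∧ (∀ x ∈ Ω, 0 < height n x₀ x) ∧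
      ∀ N, Real.exp (-2 * N) < ρ → ∀ x, ‖tangent n x₀ x‖ ≤ √ρ * Real.exp (-(3 / 2) * N) →
        Real.exp (-3 * N) ≤ height n x₀ x → height n x₀ x ≤ Real.exp (-2 * N) → x ∈ Ω := by
  obtain ⟨x₁, hx₁⟩ := id hne
  obtain ⟨x₀, hx₀, hdist⟩ := exists_mem_frontier_infDist_compl_eq_dist hx₁ hΩ'
  have hx₀' : x₀ ∉ Ω := (hΩo.frontier_eq ▸ hx₀).2
  obtain ⟨n, hn, hH⟩ := exists_unit_inner_lt hΩo hconv hne hx₀'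
  set ρ := Metric.infDist x₁ Ωᶜ with hρ
  have hρ0 : 0 < ρ := hdist ▸ dist_pos.2 fun h => hx₀' (h ▸ hx₁)
  have hx₁h : height n x₀ x₁ = ρ := by
    refine le_antisymm ?_ (infDist_compl_le_height hn hH hx₁)
    have := real_inner_le_norm n (x₁ - x₀)
    rwa [hn, one_mul, ← dist_eq_norm, ← hdist] at this
  -- The height of `x₁` already equals its distance to `x₀`, which leaves no tangential part.
  have hx₁t : tangent n x₀ x₁ = 0 := by
    have h := norm_sq_tangent_add hn x₀ x₁ (height n x₀ x₁)
    rw [tangent, sub_add_cancel, ← tangent, ← dist_eq_norm, ← hdist, hx₁h] at h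
    rw [← norm_eq_zero]
    nlinarith [norm_nonneg (tangent n x₀ x₁)]
  refine ⟨n, x₀, ρ, hn, hρ0, hH, fun N hN x h1 h2 h3 => ?_⟩
  -- The ball of radius `ρ` about `x₁` touches the hyperplane at `x₀`. At height `h < ρ` its section
  -- has squared radius `2ρh - h²`, which exceeds `ρh ≥ ρ exp (-3N)`.
  refine Metric.ball_infDist_compl_subset (x := x₁) ?_
  rw [Metric.mem_ball, dist_eq_norm, ← hρ]
  have e : x - x₁ = tangent n x₀ x + (height n x₀ x - ρ) • n := by
    have e1 : x₁ - x₀ = ρ • n := by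
      rw [tangent, hx₁h, sub_eq_zero] at hx₁t; exact hx₁t
    rw [sub_smul, ← e1, tangent]; abel
  refine lt_of_pow_lt_pow_left₀ 2 hρ0.le ?_
  rw [e, norm_sq_tangent_add hn]
  have h4 : ‖tangent n x₀ x‖ ^ 2 ≤ ρ * Real.exp (-3 * N) := by
    calc ‖tangent n x₀ x‖ ^ 2 ≤ (√ρ * Real.exp (-(3 / 2) * N)) ^ 2 := by gcongr
      _ = _ := by
        rw [mul_pow, Real.sq_sqrt hρ0.le, ← Real.exp_nat_mul]
        congr 2; push_cast; ring
  have h5 : 0 < height n x₀ x := (Real.exp_pos _).trans_le h2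
  have h6 : height n x₀ x < ρ := h3.trans_lt hN
  nlinarith [mul_pos h5 (sub_pos.2 h6), mul_le_mul_of_nonneg_left h2 hρ0.le]

theorem le_kappa_of_forall_hardyIntegral_le [NeZero d] {p α : ℝ} (hp : 1 < p) (hα₁ : 1 < α)
    (hα₂ : α < 2) {Ω : Set (EuclideanSpace ℝ (Fin d))} (hΩo : IsOpen Ω) (hΩ' : Ω ≠ univ)
    (hconv : Convex ℝ Ω) (hne : Ω.Nonempty) {c : ℝ}
    (hc : ∀ u : EuclideanSpace ℝ (Fin d) → ℝ, IsCc Ω u →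
      ENNReal.ofReal c * hardyIntegral p α Ω u ≤ form p α Ω u) : c ≤ kappa d p α := by
  obtain ⟨n, x₀, ρ, hn, hρ, hH, hslab⟩ := exists_slab_subset hΩo hΩ' hconv hne
  have hsρ : 0 < √ρ := Real.sqrt_pos.2 hρ
  -- The two oscillation scales for `N = k`: with `R = √ρ * exp (-(3/2) * k)`, the largest radius
  -- the slab permits, `exp (-2 * k) / R` is the first entry. It tends to `0` because the heights
  -- are much smaller than `R`.
  set η : ℕ → ℝ := fun k => max (Real.exp (-(1 / 2) * k) / √ρ) (1 / k) with hη
  have hexp : ∀ a : ℝ, a < 0 → Tendsto (fun k : ℕ => Real.exp (a * k)) atTop (𝓝 0) := fun a ha =>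
    Real.tendsto_exp_atBot.comp (tendsto_natCast_atTop_atTop.const_mul_atTop_of_neg ha)
  have hη0 : Tendsto η atTop (𝓝 0) := by
    have := ((hexp (-(1 / 2)) (by norm_num)).div_const √ρ).max tendsto_one_div_atTop_nhds_zero_nat
    simpa [hη] using this
  have hηnn : ∀ k, 0 ≤ η k := fun k => le_max_of_le_left (by positivity)
  have hε := tendsto_totalError (α := α) hα₁ hα₂ hn (ε := fun k => min 1 (η k))
    (fun k => le_min zero_le_one (hηnn k)) (fun k => min_le_left _ _)
    (by simpa using (tendsto_const_nhds (x := (1 : ℝ))).min hη0)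
  have hlim : Tendsto (fun k => ENNReal.ofReal (kappa d p α) +
      1 / 2 * totalError α n (min 1 (η k)) * ENNReal.ofReal (64 * 2 ^ d)) atTop
        (𝓝 (ENNReal.ofReal (kappa d p α))) := by
    have h1 := ENNReal.Tendsto.mul_const (b := ENNReal.ofReal (64 * 2 ^ d))
      (ENNReal.Tendsto.const_mul (a := 1 / 2) hε (Or.inr (by simp)))
      (Or.inr ENNReal.ofReal_ne_top)
    simpa using (tendsto_const_nhds (x := ENNReal.ofReal (kappa d p α))).add h1
  have hmain : ENNReal.ofReal c ≤ ENNReal.ofReal (kappa d p α) := by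
    refine ge_of_tendsto hlim ?_
    filter_upwards [hη0.eventually_le_const one_pos,
      (hexp (-2) (by norm_num)).eventually_lt_const hρ, eventually_gt_atTop 0] with k hk1 hk2 hk3
    have hN : (0 : ℝ) < k := Nat.cast_pos.2 hk3
    set R := √ρ * Real.exp (-(3 / 2) * k) with hRdef
    have hR : 0 < R := by positivity
    have hε1 : Real.exp (-2 * k) / R ≤ min 1 (η k) := by
      rw [min_eq_right hk1]
      refine le_max_of_le_left (le_of_eq ?_)
      rw [hRdef, div_eq_div_iff hR.ne' hsρ.ne', mul_left_comm, ← Real.exp_add, mul_comm]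
      congr 2; ring
    have hε2 : 1 / (k : ℝ) ≤ min 1 (η k) := by
      rw [min_eq_right hk1]; exact le_max_right _ _
    have hKΩ : {x | cutoff n x₀ R k x ≠ 0} ⊆ Ω := fun x hx => by
      obtain ⟨h1, h2, h3⟩ := mem_of_cutoff_ne_zero hR hN hx
      exact hslab k hk2 x h1 h2 h3
    obtain ⟨hYX, hX0, hXt⟩ := lintegral_cutoff_comparison (x₀ := x₀) hn hR hN
    set X := ∫⁻ x in {x | cutoff n x₀ R k x ≠ 0},
        ENNReal.ofReal (cutoff n x₀ R k x ^ 2 / height n x₀ x)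
    rw [← ENNReal.mul_le_mul_iff_left hX0 hXt]
    calc ENNReal.ofReal c * X ≤ ENNReal.ofReal c * hardyIntegral p α Ω (testFun p α n x₀ R k) := by
          gcongr
          exact lintegral_cutoff_le_hardyIntegral hp (by linarith) hn hR hN hΩo hΩ' hKΩ hH
      _ ≤ form p α Ω (testFun p α n x₀ R k) :=
          hc _ (isCc_testFun (by linarith) hn hR hN (hslab k hk2))
      _ ≤ ENNReal.ofReal (kappa d p α) * X + 1 / 2 * totalError α n (min 1 (η k)) *
            (ENNReal.ofReal (64 * 2 ^ d) * X) := by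
          refine (form_testFun_le hp hα₁ hα₂ hn hR hN hε1 hε2 hΩo.measurableSet hKΩ hH).trans ?_
          gcongr
      _ = _ := by ring
  -- Nonnegativity of `kappa` makes the comparison of truncated values valid for negative `c` as
  -- well.
  exact (ENNReal.ofReal_le_ofReal_iff (kappa_nonneg d hp hα₁ hα₂)).1 hmain

end

end SobolevBregman

end

theorem theorem2 (d : ℕ) [NeZero d] (p α : ℝ) (hp : 1 < p) (hα₁ : 1 < α) (hα₂ : α < 2)
    (Ω : Set (EuclideanSpace ℝ (Fin d))) (hΩ : IsOpen Ω) (hΩ' : Ω ≠ Set.univ) :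
    0 ≤ SobolevBregman.kappa d p α ∧
    (∀ u : EuclideanSpace ℝ (Fin d) → ℝ, SobolevBregman.IsCc Ω u →
      ENNReal.ofReal (SobolevBregman.kappa d p α) * SobolevBregman.avgHardyIntegral p α Ω u
        ≤ SobolevBregman.form p α Ω u) ∧
    (Convex ℝ Ω →
      (∀ u : EuclideanSpace ℝ (Fin d) → ℝ, SobolevBregman.IsCc Ω u →
        ENNReal.ofReal (SobolevBregman.kappa d p α) * SobolevBregman.hardyIntegral p α Ω u
          ≤ SobolevBregman.form p α Ω u) ∧
      (Ω.Nonempty → ∀ c : ℝ,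
        (∀ u : EuclideanSpace ℝ (Fin d) → ℝ, SobolevBregman.IsCc Ω u →
          ENNReal.ofReal c * SobolevBregman.hardyIntegral p α Ω u
            ≤ SobolevBregman.form p α Ω u) →
        c ≤ SobolevBregman.kappa d p α)) := by
  refine ⟨SobolevBregman.kappa_nonneg d hp hα₁ hα₂,
    fun u hu => SobolevBregman.kappa_mul_avgHardyIntegral_le hp hα₁ hα₂ hΩ hu,
    fun hconv => ⟨fun u hu => ?_, fun hne c hc =>
      SobolevBregman.le_kappa_of_forall_hardyIntegral_le hp hα₁ hα₂ hΩ hΩ' hconv hne hc⟩⟩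
  refine le_trans ?_ (SobolevBregman.kappa_mul_avgHardyIntegral_le hp hα₁ hα₂ hΩ hu)
  gcongr
  exact SobolevBregman.hardyIntegral_le_avgHardyIntegral (by linarith) hΩ hΩ' hconv u
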